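/- Let $L$ be a finite relational language. Subsets of $L$-structures are regarded as substructures. Let $\mathbf K$ be a class of finite $L$-structures and $\le$ a binary relation on $\mathbf K$. If $B,C$ are subsets of an $L$-structure and $A=B\cap C$, then a subset $D$ is the free amalgam $B\oplus_A C$ when $D=B\cup C$ and every tuple of $D$ of which a relation symbol of $L$ holds lies in $B$ or lies in $C$. We call $(\mathbf K,\le)$ a full amalgamation class if: $\mathbf K$ is closed under substructures and isomorphisms; $\le$ is isomorphism-invariant and implies $\subseteq$; for all $A,B,C\in\mathbf K$: $A\le A$; $\varnothing\le A$; $A\le B\le C$ implies $A\le C$; $A\le B$ and $A\subseteq C\subseteq B$ imply $A\le C$; $A\le B$ implies $A\cap C\le C$ for all $C\subseteq B$; and if $A\le B$, $A\subseteq C$ and $A=B\cap C$, then $D=B\oplus_A C$ is in $\mathbf K$ and $C\le D$. Let $N$ be an $L$-structure. A minimal pair in $N$ is a pair of finite sets $A\subseteq B\subseteq N$ with $B\in\mathbf K$, $A\not\le B$, and $A\le B_0$ whenever $A\subseteq B_0\subsetneq B$. A set $X\subseteq N$ is closed if $B\subseteq X$ for every minimal pair $(A,B)$ in $N$ with $A\subseteq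 X$, and $\mathrm{cl}_N(X)$ is the smallest closed set containing $X$. For finite $A\subseteq N$, $A\le N$ means that $A\le B$ for all finite $B$ with $A\subseteq B\subseteq N$. A generic of $(\mathbf K,\le)$ is a countable $L$-structure $G$ whose finite subsets are in $\mathbf K$, in which closures of finite sets are finite, and such that whenever $A\le G$ is finite and $A\le B\in\mathbf K$, there is an embedding $g$ of $B$ into $G$ over $A$ with $g(B)\le G$. Let $T=\mathrm{Th}(G)$. For a model $M\models T$ let $\mathfrak C\succeq M$ be a $\kappa$-saturated, strongly $\kappa$-homogeneous model of $T$ with $\kappa>|M|$ infinite, and let $\mathrm{cl}=\mathrm{cl}_{\mathfrak C}$. A type $p\in S(M)$ (a complete $1$-type over $M$) is intrinsic if it is realized by an element of $\mathrm{cl}(M)$, and extrinsic otherwise. For $X\subseteq M$ let $J_0$ be the union of all $B\subseteq\mathfrak C$ such that $B\cap M\subseteq X$ and $(X',B)$ is a minimal pair for some finite $X'\subseteq X$; let $J_{i+1}$ be the union of all $B\subseteq\mathfrak C$ such that $B\cap M\subseteq X$ and $(X',B)$ is a minimal pair for some finite $X'\subseteq J_i$; and let $\mathrm{ecl}_M(X)=X\cup\bigcup_i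 J_i$. A support system over $M$ is a set $\mathcal S$ of subsets of $M$ such that every $a\in\mathrm{cl}(M)\setminus M$ is in $\mathrm{ecl}_M(S)$ for some $S\in\mathcal S$. It * is bounded by $\lambda$ if $|S|<\lambda$ for all $S\in\mathcal S$; * has free closures if for all distinct $S,T\in\mathcal S$, $\mathrm{ecl}_M(S\cup T)=(\mathrm{ecl}_M(S)\cup T)\oplus_{S\cup T}(\mathrm{ecl}_M(T)\cup S)$; * is edge-closed if for each $a\in\mathrm{cl}(M)\setminus M$ there is exactly one $S\in\mathcal S$ with $a\in\mathrm{ecl}_M(S)$, and every tuple of elements of $\mathrm{cl}(M)$ that has $a$ among its entries and of which a relation symbol of $L$ holds lies in $\mathrm{ecl}_M(S)$ (in particular its entries from $M$ lie in $\mathrm{ecl}_M(S)\cap M=S$). The class $(\mathbf K,\le)$ has limiting supports if there is a cardinal $\lambda$ such that every sufficiently large model $M\models T$ has a support system that is bounded by $\lambda$, has free closures and is edge-closed. **Claim.** Let $(\mathbf K,\le)$ be a full amalgamation class with limiting supports, and let $T$ be the theory of its generic. 1. If for every $M\models T$ with $|M|=\kappa\ge 2^{\aleph_0}$ there are at most $\kappa$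 extrinsic types in $S(M)$, then $T$ is superstable (that is, $\mu$-stable for all sufficiently large cardinals $\mu$). 2. If for every $M\models T$ with $|M|=\kappa\ge 2^{\aleph_0}$ there are at most $\kappa^{\aleph_0}$ extrinsic types in $S(M)$, then $T$ is stable (that is, $\mu$-stable for some infinite cardinal $\mu$). -/

import Mathlib

open FirstOrder FirstOrder.Language Cardinal

universe w

namespace GenericStability

/-- In a relational language every subset of a structure carries a substructure. -/
def sub (L : FirstOrder.Language.{0, 0}) [L.IsRelational] {N : Type w} [L.Structure N] (A : Set N) :
    L.Substructure N where
  carrier := A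
  fun_mem f := isEmptyElim f

/-- The substructure with universe `A`, as a structure of its own. -/
def induced (L : FirstOrder.Language.{0, 0}) [L.IsRelational] {N : Type w} [L.Structure N] (A : Set N) :
    CategoryTheory.Bundled.{w} L.Structure :=
  ⟨sub L A, inferInstance⟩

/-- Inside an ambient structure: `D` is the free amalgam `B ⊕_A C`, that is, `B` and `C` intersect
in `A`, `D` has universe `B ∪ C`, and each tuple of `D` of which a relation holds lies in `B` or
lies in `C`. -/
def IsFreeAmalgam (L : FirstOrder.Language.{0, 0}) {N : Type w} [L.Structure N] (A B C D : Set N) : Prop :=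
  B ∩ C = A ∧ B ∪ C = D ∧
    ∀ (n : ℕ) (R : L.Relations n) (x : Fin n → N), Structure.RelMap R x →
      Set.range x ⊆ D → Set.range x ⊆ B ∨ Set.range x ⊆ C

/-- A class `K` of structures together with a relation `A ≤ B`, for `B` a structure and `A` a
subset (that is, a substructure) of `B`.  Only the values at `B ∈ K` matter. -/
structure StrongClass (L : FirstOrder.Language.{0, 0}) where
  K : Set (CategoryTheory.Bundled.{w} L.Structure)
  strong : ∀ B : CategoryTheory.Bundled.{w} L.Structure, Set B → Prop

namespace StrongClass

/-- The relation `A ≤ B` between subsets of an ambient structure. -/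
def Le {L : FirstOrder.Language.{0, 0}} [L.IsRelational] (𝓚 : StrongClass.{w} L) {N : Type w}
    [L.Structure N] (A B : Set N) : Prop :=
  A ⊆ B ∧ 𝓚.strong (induced L B) {b : sub L B | (b : N) ∈ A}

/-- `(K, ≤)` is a full amalgamation class.  The last field says that if `A ≤ B` and `A ⊆ C`, with
`A = B ∩ C`, then `D = B ⊕_A C` is in `K` and `C ≤ D`.  If also `A ≤ C`, then `B ≤ D` by symmetry,
so the (free) amalgamation property is included. -/
structure IsFullAmalgamationClass {L : FirstOrder.Language.{0, 0}} [L.IsRelational]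
    (𝓚 : StrongClass.{w} L) : Prop where
  finite : ∀ B ∈ 𝓚.K, Finite B
  hereditary : ∀ A B : CategoryTheory.Bundled.{w} L.Structure,
    B ∈ 𝓚.K → Nonempty (A ↪[L] B) → A ∈ 𝓚.K
  iso_invariant : ∀ (B B' : CategoryTheory.Bundled.{w} L.Structure) (f : B ≃[L] B') (A : Set B),
    B ∈ 𝓚.K → 𝓚.strong B A → 𝓚.strong B' (f '' A)
  refl : ∀ B ∈ 𝓚.K, 𝓚.strong B Set.univ
  empty : ∀ B ∈ 𝓚.K, 𝓚.strong B ∅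
  trans : ∀ C ∈ 𝓚.K, ∀ A B : Set C, 𝓚.Le A B → 𝓚.strong C B → 𝓚.strong C A
  intermediate : ∀ B ∈ 𝓚.K, ∀ A C : Set B, 𝓚.strong B A → A ⊆ C → 𝓚.Le A C
  inter : ∀ B ∈ 𝓚.K, ∀ A C : Set B, 𝓚.strong B A → 𝓚.Le (A ∩ C) C
  full : ∀ (D : CategoryTheory.Bundled.{w} L.Structure) (A B C : Set D),
    IsFreeAmalgam L A B C Set.univ → induced L B ∈ 𝓚.K → induced L C ∈ 𝓚.K →
      𝓚.Le A B → D ∈ 𝓚.K ∧ 𝓚.strong D C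

/-- `(A, B)` is a minimal pair (with `A` and `B` finite subsets of an ambient structure). -/
def IsMinimalPair {L : FirstOrder.Language.{0, 0}} [L.IsRelational] (𝓚 : StrongClass.{w} L) {N : Type w}
    [L.Structure N] (A B : Set N) : Prop :=
  B.Finite ∧ induced L B ∈ 𝓚.K ∧ A ⊆ B ∧ ¬ 𝓚.Le A B ∧
    ∀ B₀ : Set N, A ⊆ B₀ → B₀ ⊂ B → 𝓚.Le A B₀

/-- `A ≤ N` for a finite subset `A` of `N`. -/
def FinStrong {L : FirstOrder.Language.{0, 0}} [L.IsRelational] (𝓚 : StrongClass.{w} L) {N : Type w}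
    [L.Structure N] (A : Set N) : Prop :=
  A.Finite ∧ ∀ B : Set N, B.Finite → A ⊆ B → 𝓚.Le A B

/-- `X ≤ N` for an arbitrary subset `X` of `N`. -/
def Closed {L : FirstOrder.Language.{0, 0}} [L.IsRelational] (𝓚 : StrongClass.{w} L) {N : Type w}
    [L.Structure N] (X : Set N) : Prop :=
  ∀ A B : Set N, A ⊆ X → 𝓚.IsMinimalPair A B → B ⊆ X

/-- The closure of `X` in `N`: the smallest closed set that contains `X`. -/
def cl {L : FirstOrder.Language.{0, 0}} [L.IsRelational] (𝓚 : StrongClass.{w} L) {N : Type w}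
    [L.Structure N] (X : Set N) : Set N :=
  ⋂₀ {Y : Set N | X ⊆ Y ∧ 𝓚.Closed Y}

/-- `G` is a `(K, ≤)`-generic. -/
structure IsGeneric {L : FirstOrder.Language.{0, 0}} [L.IsRelational] (𝓚 : StrongClass.{w} L) (G : Type w)
    [L.Structure G] : Prop where
  countable : Countable G
  age : ∀ A : Set G, A.Finite → induced L A ∈ 𝓚.K
  extension : ∀ B ∈ 𝓚.K, ∀ A : Set B, 𝓚.strong B A →
    ∀ e : sub L A ↪[L] G, 𝓚.FinStrong (Set.range e) →
      ∃ g : B ↪[L] G, 𝓚.FinStrong (Set.range g) ∧ ∀ a : sub L A, g a = e a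
  finite_cl : ∀ A : Set G, A.Finite → (𝓚.cl A).Finite

end StrongClass

/-- The complete `1`-types over a set `A` of parameters from `N`. -/
abbrev TypesOverSet (L : FirstOrder.Language.{0, 0}) {N : Type w} [L.Structure N] (A : Set N) : Type w :=
  (L[[A]].completeTheory N).CompleteType (Fin 1)

/-- The space `S(M)` of complete `1`-types over a structure `M`. -/
abbrev TypesOver (L : FirstOrder.Language.{0, 0}) (M : Type w) [L.Structure M] : Type w :=
  (L.elementaryDiagram M).CompleteType (Fin 1)

/-- The element `c` of `C` realizes the type `p` over `M`, when `M` is mapped to `C` by `j`. -/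
def Realizes {L : FirstOrder.Language.{0, 0}} {M C : Type w} [L.Structure M] [L.Structure C] (j : M → C)
    (c : C) (p : TypesOver L M) : Prop :=
  letI : (constantsOn M).Structure C := constantsOn.structure j
  ∀ φ : L[[M]].Formula (Fin 1), Formula.equivSentence φ ∈ p → φ.Realize (fun _ : Fin 1 => c)

/-- `C` is a `κ`-saturated and strongly `κ`-homogeneous model of `T`. -/
structure IsUniversalDomain {L : FirstOrder.Language.{0, 0}} (T : L.Theory) (κ : Cardinal.{w}) (C : Type w)
    [L.Structure C] : Prop where
  aleph0_le : ℵ₀ ≤ κ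
  model : C ⊨ T
  saturated : ∀ A : Set C, #A < κ → ∀ p : TypesOverSet L A,
    ∃ c : C, ∀ φ : L[[A]].Formula (Fin 1), Formula.equivSentence φ ∈ p →
      φ.Realize (fun _ : Fin 1 => c)
  homogeneous : ∀ (A : Set C) (f : A → C), #A < κ →
    (∀ (n : ℕ) (φ : L.Formula (Fin n)) (v : Fin n → A),
      φ.Realize (fun i => (v i : C)) ↔ φ.Realize (fun i => f (v i))) →
    ∃ σ : C ≃[L] C, ∀ a : A, σ a = f a

/-- `C` is a universal domain for `T` in which `M` lies, by `j`, as a small elementary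
submodel. -/
def IsUniversalDomainOver {L : FirstOrder.Language.{0, 0}} (T : L.Theory) {M C : Type w} [L.Structure M]
    [L.Structure C] (_j : M ↪ₑ[L] C) : Prop :=
  ∃ κ : Cardinal.{w}, #M < κ ∧ IsUniversalDomain T κ C

/-- `T` is `μ`-stable: there are at most `μ` types over each set of at most `μ` parameters. -/
def IsStableIn {L : FirstOrder.Language.{0, 0}} (T : L.Theory) (μ : Cardinal.{w}) : Prop :=
  ∀ (N : Type w) [L.Structure N] [N ⊨ T] (A : Set N), #A ≤ μ → #(TypesOverSet L A) ≤ μ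

/-- `T` is stable: `μ`-stable for some infinite `μ`. -/
def IsStable {L : FirstOrder.Language.{0, 0}} (T : L.Theory) : Prop :=
  ∃ μ : Cardinal.{w}, ℵ₀ ≤ μ ∧ IsStableIn T μ

/-- `T` is superstable: `μ`-stable for all sufficiently large `μ`. -/
def IsSuperstable {L : FirstOrder.Language.{0, 0}} (T : L.Theory) : Prop :=
  ∃ μ₀ : Cardinal.{w}, ∀ μ : Cardinal.{w}, μ₀ ≤ μ → IsStableIn T μ

namespace StrongClass

/-- The stages `J_i` of the external closure of `X ⊆ M`, inside a structure `C` that contains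
`M`. -/
def extStage {L : FirstOrder.Language.{0, 0}} [L.IsRelational] (𝓚 : StrongClass.{w} L) {C : Type w}
    [L.Structure C] (M X : Set C) : ℕ → Set C
  | 0 => ⋃₀ {B | ∃ X' ⊆ X, 𝓚.IsMinimalPair X' B ∧ B ∩ M ⊆ X}
  | i + 1 => ⋃₀ {B | ∃ X' ⊆ extStage 𝓚 M X i, 𝓚.IsMinimalPair X' B ∧ B ∩ M ⊆ X}

/-- The external closure `ecl_M(X)` of `X ⊆ M`. -/
def ecl {L : FirstOrder.Language.{0, 0}} [L.IsRelational] (𝓚 : StrongClass.{w} L) {C : Type w}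
    [L.Structure C] (M X : Set C) : Set C :=
  X ∪ ⋃ i, 𝓚.extStage M X i

/-- `𝒮` is a support system for `cl(M)` over `M`. -/
def IsSupportSystem {L : FirstOrder.Language.{0, 0}} [L.IsRelational] (𝓚 : StrongClass.{w} L) {C : Type w}
    [L.Structure C] (M : Set C) (𝒮 : Set (Set C)) : Prop :=
  (∀ S ∈ 𝒮, S ⊆ M) ∧ ∀ a ∈ 𝓚.cl M \ M, ∃ S ∈ 𝒮, a ∈ 𝓚.ecl M S

/-- `𝒮` has unique supports. -/
def HasUniqueSupports {L : FirstOrder.Language.{0, 0}} [L.IsRelational] (𝓚 : StrongClass.{w} L)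
    {C : Type w} [L.Structure C] (M : Set C) (𝒮 : Set (Set C)) : Prop :=
  ∀ a ∈ 𝓚.cl M \ M, ∃! S : Set C, S ∈ 𝒮 ∧ a ∈ 𝓚.ecl M S

/-- `𝒮` has free closures: for distinct `S, T` in `𝒮`, `ecl(S ∪ T)` is the free amalgam over
`S ∪ T` of `ecl(S)` and `ecl(T)`, each enlarged by the base `S ∪ T`. -/
def HasFreeClosures {L : FirstOrder.Language.{0, 0}} [L.IsRelational] (𝓚 : StrongClass.{w} L)
    {C : Type w} [L.Structure C] (M : Set C) (𝒮 : Set (Set C)) : Prop :=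
  ∀ S ∈ 𝒮, ∀ T ∈ 𝒮, S ≠ T →
    IsFreeAmalgam L (S ∪ T) (𝓚.ecl M S ∪ T) (𝓚.ecl M T ∪ S) (𝓚.ecl M (S ∪ T))

/-- `𝒮` is edge-closed: it has unique supports, and if a relation holds of a tuple of `cl(M)` one
of whose entries is `a ∉ M`, then the tuple lies in `ecl(S)`, where `S` is the support of `a`.
Since `ecl(S) ∩ M = S`, the entries of the tuple that are in `M` then lie in `S`. -/
def IsEdgeClosed {L : FirstOrder.Language.{0, 0}} [L.IsRelational] (𝓚 : StrongClass.{w} L)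
    {C : Type w} [L.Structure C] (M : Set C) (𝒮 : Set (Set C)) : Prop :=
  𝓚.HasUniqueSupports M 𝒮 ∧
    ∀ a ∈ 𝓚.cl M \ M, ∀ S ∈ 𝒮, a ∈ 𝓚.ecl M S →
      ∀ (n : ℕ) (R : L.Relations n) (x : Fin n → C), Structure.RelMap R x →
        Set.range x ⊆ 𝓚.cl M → a ∈ Set.range x → Set.range x ⊆ 𝓚.ecl M S

/-- `(K, ≤)`, with `T` the theory of its generic, has limiting supports: for some cardinal `lam`,
every sufficiently large model `M` of `T` has (inside a universal domain) a support system that is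
bounded by `lam`, has free closures and is edge-closed. -/
def HasLimitingSupports {L : FirstOrder.Language.{0, 0}} [L.IsRelational] (𝓚 : StrongClass.{w} L)
    (T : L.Theory) : Prop :=
  ∃ lam θ : Cardinal.{w}, ∀ (M : Type w) [L.Structure M] [M ⊨ T], θ ≤ #M →
    ∃ (C : Type w) (_ : L.Structure C) (j : M ↪ₑ[L] C), IsUniversalDomainOver T j ∧
      ∃ 𝒮 : Set (Set C), 𝓚.IsSupportSystem (Set.range j) 𝒮 ∧
        (∀ S ∈ 𝒮, #S < lam) ∧
        𝓚.HasFreeClosures (Set.range j) 𝒮 ∧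
        𝓚.IsEdgeClosed (Set.range j) 𝒮

/-- A type over a model `M` of `T` is intrinsic if it is realized in a universal domain by an
element of `cl(M)`. -/
def IsIntrinsic {L : FirstOrder.Language.{0, 0}} [L.IsRelational] (𝓚 : StrongClass.{w} L)
    (T : L.Theory) {M : Type w} [L.Structure M] (p : TypesOver L M) : Prop :=
  ∃ (C : Type w) (_ : L.Structure C) (j : M ↪ₑ[L] C), IsUniversalDomainOver T j ∧
    ∃ a ∈ 𝓚.cl (Set.range j), Realizes j a p

/-- A type over a model is extrinsic if it is not intrinsic. -/
def IsExtrinsic {L : FirstOrder.Language.{0, 0}} [L.IsRelational] (𝓚 : StrongClass.{w} L)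
    (T : L.Theory) {M : Type w} [L.Structure M] (p : TypesOver L M) : Prop :=
  ¬ 𝓚.IsIntrinsic T p

end StrongClass

end GenericStability

-- Fix a large μ such that models of size μ have at most μ extrinsic types. In a universal domain C
-- there is a chain M₀ ⊆ M₁ ⊆ … of elementary submodels of size μ such that every point outside
-- cl(M_k) has a conjugate over M_k in M_{k+1} (`exists_isConjChain`). It suffices that C has at
-- most μ orbits over M₀ (`mk_orbits_le`), because distinct types over a small subset of M₀ are
-- realized in distinct orbits.
--
-- Let Z be `goodAdd M`: the points that can be added to any finite set with a conjugate over M₀ in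
-- ⋃ M_k without losing that property. Points of Z and points outside cl(M₀) have conjugates in ⋃
-- M_k, so they contribute at most μ orbits. The set Z contains M₀ and everything algebraic over M₀
-- together with finitely many points of Z. It also contains every point of cl(M₀) that shares an
-- edge with a point outside cl(M₀) (`mem_goodAdd_of_edge`); this rests on realizing strong
-- extensions freely over a closure (`exists_free_extension`).
--
-- It remains to treat a in cl(M₀) \ Z. Cut the hypergraph of edges along Z. The component of a (its
-- `core`) stays inside cl(M₀) and is attached to the rest of C only through boundary points in Z.
-- Full amalgamation gives a minimal pair (F, B) with F in the boundary and B \ F in the core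
-- (`exists_isMinimalPair_core`). Since F is a finite subset of Z, it has a conjugate in ⋃ M_k, so
-- up to conjugacy there are at most μ choices of F.
--
-- For fixed F, let D be the set of all boundary points of cores based on F. Limiting supports give
-- |D| < λ (`mk_boundary_lt`). Indeed, take a model N of size μ that contains M₀, F and λ supposed
-- points of D. The cores contain nothing algebraic over Z, so finite parts of them have copies
-- outside N. Edge-closedness spreads the support of such a copy along paths of edges to every
-- boundary point, while F alone already makes a set of the system a support. So one support of size
-- less than λ would contain all λ points.
--
-- With D fixed, the type of a over M₀ is determined by the back-and-forth invariants of its core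
-- over D (`tpEq_of_code`), since exchanging two cores with equal invariants preserves all formulas.
-- The number of invariants depends only on λ. Altogether there are at most μ orbits. For
-- superstability every large μ qualifies; for stability the choice μ = 2^{μ₀} gives μ^{ℵ₀} = μ.

universe u₁ u₂

namespace GenericStability

/-! ### Transport of `K` and `≤` along partial isomorphisms. -/

section Calculus

variable {L : FirstOrder.Language.{0, 0}}

/-- `f` restricts to an isomorphism of the substructure with universe `B` onto its image. -/
structure PartialIso (L : FirstOrder.Language.{0, 0}) {N N' : Type w} [L.Structure N]
    [L.Structure N'] (f : N → N') (B : Set N) : Prop where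
  injOn : Set.InjOn f B
  rel : ∀ (n : ℕ) (R : L.Relations n) (x : Fin n → N), (∀ i, x i ∈ B) →
    (Structure.RelMap R (fun i => f (x i)) ↔ Structure.RelMap R x)

theorem PartialIso.mono {N N' : Type w} [L.Structure N] [L.Structure N'] {f : N → N'}
    {B B' : Set N} (h : PartialIso L f B) (hB : B' ⊆ B) : PartialIso L f B' :=
  ⟨h.injOn.mono hB, fun n R x hx => h.rel n R x fun i => hB (hx i)⟩

theorem partialIso_of_embedding {N N' : Type w} [L.Structure N] [L.Structure N'] (f : N ↪[L] N')
    (B : Set N) : PartialIso L f B :=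
  ⟨f.injective.injOn, fun _ R x _ => f.map_rel R x⟩

variable [L.IsRelational]

theorem partialIso_val {N : Type w} [L.Structure N] (D : Set N) (B : Set (sub L D)) :
    PartialIso L (Subtype.val : sub L D → N) B :=
  partialIso_of_embedding (sub L D).subtype B

/-- The isomorphism of induced structures given by a partial isomorphism. -/
noncomputable def PartialIso.equiv {N N' : Type w} [L.Structure N] [L.Structure N'] {f : N → N'}
    {B : Set N} (h : PartialIso L f B) : induced L B ≃[L] induced L (f '' B) where
  toEquiv := (Equiv.Set.imageOfInjOn f B h.injOn)
  map_fun' g := isEmptyElim g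
  map_rel' R x := h.rel _ R (fun i => (x i).1) fun i => (x i).2

variable {𝓚 : StrongClass.{w} L}

namespace StrongClass.IsFullAmalgamationClass

variable (h𝓚 : 𝓚.IsFullAmalgamationClass)
include h𝓚

theorem mem_image {N N' : Type w} [L.Structure N] [L.Structure N'] {f : N → N'} {B : Set N}
    (h : PartialIso L f B) : induced L (f '' B) ∈ 𝓚.K ↔ induced L B ∈ 𝓚.K :=
  ⟨fun hK => h𝓚.hereditary _ _ hK ⟨h.equiv.toEmbedding⟩,
    fun hK => h𝓚.hereditary _ _ hK ⟨h.equiv.symm.toEmbedding⟩⟩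

theorem mem_subset {N : Type w} [L.Structure N] {A B : Set N} (hB : induced L B ∈ 𝓚.K)
    (hAB : A ⊆ B) : induced L A ∈ 𝓚.K :=
  h𝓚.hereditary _ _ hB ⟨Substructure.inclusion (S := sub L A) (T := sub L B) hAB⟩

theorem le_image {N N' : Type w} [L.Structure N] [L.Structure N'] {f : N → N'} {A B : Set N}
    (h : PartialIso L f B) (hK : induced L B ∈ 𝓚.K) (hAB : A ⊆ B) :
    𝓚.Le (f '' A) (f '' B) ↔ 𝓚.Le A B := by
  have key : h.equiv '' {b : sub L B | (b : N) ∈ A} =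
      {b : sub L (f '' B) | (b : N') ∈ f '' A} := by
    ext ⟨b, hb⟩
    constructor
    · rintro ⟨a, ha, hab⟩
      exact ⟨Subtype.val (p := (· ∈ B)) a, ha,
        congrArg (fun z : sub L (f '' B) => (z : N')) hab⟩
    · rintro ⟨a, ha, hab⟩
      exact ⟨⟨a, hAB ha⟩, ha, Subtype.ext hab⟩
  constructor
  · rintro ⟨-, h2⟩
    refine ⟨hAB, ?_⟩
    have := h𝓚.iso_invariant _ _ h.equiv.symm _ ((h𝓚.mem_image h).2 hK) h2
    have h3 := congrArg (fun s => h.equiv.symm '' s) key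
    have h4 : (⇑h.equiv.symm ∘ ⇑h.equiv) = id := by
      ext x; simp
    simp only [← Set.image_comp, h4, Set.image_id] at h3
    exact h3 ▸ this
  · rintro ⟨-, h2⟩
    refine ⟨Set.image_mono hAB, ?_⟩
    have := h𝓚.iso_invariant _ _ h.equiv _ hK h2
    rwa [key] at this

theorem le_refl {N : Type w} [L.Structure N] {A : Set N} (hA : induced L A ∈ 𝓚.K) :
    𝓚.Le A A := by
  refine ⟨subset_rfl, ?_⟩
  convert h𝓚.refl _ hA
  ext x
  exact ⟨fun _ => trivial, fun _ => x.2⟩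

theorem empty_le {N : Type w} [L.Structure N] {A : Set N} (hA : induced L A ∈ 𝓚.K) :
    𝓚.Le ∅ A := by
  refine ⟨Set.empty_subset _, ?_⟩
  exact (Set.ofPred_false : {b : sub L A | False} = ∅) ▸ h𝓚.empty _ hA

omit h𝓚 in
theorem val_image {N : Type w} [L.Structure N] {A C : Set N} (h : A ⊆ C) :
    (Subtype.val '' {c : sub L C | (c : N) ∈ A} : Set N) = A := by
  ext x
  constructor
  · rintro ⟨y, hy, rfl⟩
    exact hy
  · intro hx
    exact ⟨⟨x, h hx⟩, hx, rfl⟩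

theorem le_preimage {N : Type w} [L.Structure N] {A B C : Set N} (hC : induced L C ∈ 𝓚.K)
    (hAB : A ⊆ B) (hBC : B ⊆ C) :
    𝓚.Le {c : sub L C | (c : N) ∈ A} {c : sub L C | (c : N) ∈ B} ↔ 𝓚.Le A B := by
  have h1 := h𝓚.mem_image (partialIso_val C {c : sub L C | (c : N) ∈ B})
  have h2 := h𝓚.le_image (partialIso_val C {c : sub L C | (c : N) ∈ B})
    (A := {c : sub L C | (c : N) ∈ A})
  rw [val_image hBC] at h1 h2
  rw [val_image (hAB.trans hBC)] at h2
  exact (h2 (h1.1 (h𝓚.mem_subset hC hBC)) fun c hc => hAB hc).symm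

theorem le_trans {N : Type w} [L.Structure N] {A B C : Set N} (hC : induced L C ∈ 𝓚.K)
    (h1 : 𝓚.Le A B) (h2 : 𝓚.Le B C) : 𝓚.Le A C :=
  ⟨h1.1.trans h2.1, h𝓚.trans _ hC _ {c : sub L C | (c : N) ∈ B}
    ((h𝓚.le_preimage hC h1.1 h2.1).2 h1) h2.2⟩

theorem le_inter {N : Type w} [L.Structure N] {A B C : Set N} (hB : induced L B ∈ 𝓚.K)
    (h1 : 𝓚.Le A B) (hCB : C ⊆ B) : 𝓚.Le (A ∩ C) C :=
  (h𝓚.le_preimage hB Set.inter_subset_right hCB).1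
    (h𝓚.inter _ hB {c : sub L B | (c : N) ∈ A} {c : sub L B | (c : N) ∈ C} h1.2)

theorem le_full {N : Type w} [L.Structure N] {A B C D : Set N} (hB : induced L B ∈ 𝓚.K)
    (hC : induced L C ∈ 𝓚.K) (hD : IsFreeAmalgam L A B C D) (h1 : 𝓚.Le A B) :
    induced L D ∈ 𝓚.K ∧ 𝓚.Le C D := by
  have hBD : B ⊆ D := by rw [← hD.2.1]; exact Set.subset_union_left
  have hCD : C ⊆ D := by rw [← hD.2.1]; exact Set.subset_union_right
  have key := h𝓚.full (induced L D) {c : sub L D | (c : N) ∈ A} {c : sub L D | (c : N) ∈ B}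
    {c : sub L D | (c : N) ∈ C} ?_ ?_ ?_ ?_
  · exact ⟨key.1, hCD, key.2⟩
  · refine ⟨?_, ?_, ?_⟩
    · ext x
      rw [← hD.1]
      exact Iff.rfl
    · ext ⟨x, hx⟩
      rw [← hD.2.1] at hx
      exact ⟨fun _ => trivial, fun _ => hx⟩
    · intro n R x hx _
      have := hD.2.2 n R (fun i => (x i).1) hx (by rintro _ ⟨i, rfl⟩; exact (x i).2)
      refine this.imp ?_ ?_ <;>
      · rintro h _ ⟨i, rfl⟩
        exact h ⟨i, rfl⟩
  · have := h𝓚.mem_image (partialIso_val D {c : sub L D | (c : N) ∈ B})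
    rw [val_image hBD] at this
    exact this.1 hB
  · have := h𝓚.mem_image (partialIso_val D {c : sub L D | (c : N) ∈ C})
    rw [val_image hCD] at this
    exact this.1 hC
  · have hAB := h1.1
    have := h𝓚.le_image (partialIso_val D {c : sub L D | (c : N) ∈ B}) ?_
      (A := {c : sub L D | (c : N) ∈ A}) (fun c hc => hAB hc)
    · rw [val_image (hAB.trans hBD), val_image hBD] at this
      exact this.1 h1
    · have := h𝓚.mem_image (partialIso_val D {c : sub L D | (c : N) ∈ B})
      rw [val_image hBD] at this
      exact this.1 hB

theorem isMinimalPair_image {N N' : Type w} [L.Structure N] [L.Structure N'] {f : N → N'}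
    {A B : Set N} (h : PartialIso L f B) (hAB : 𝓚.IsMinimalPair A B) :
    𝓚.IsMinimalPair (f '' A) (f '' B) := by
  obtain ⟨h1, h2, h3, h4, h5⟩ := hAB
  refine ⟨h1.image f, (h𝓚.mem_image h).2 h2, Set.image_mono h3, fun h6 =>
    h4 ((h𝓚.le_image h h2 h3).1 h6), fun B₀ hA hB => ?_⟩
  obtain ⟨C, hC, rfl⟩ := Set.subset_image_iff.1 hB.1
  have hCB : C ⊂ B := ⟨hC, fun hBC => hB.2 (Set.image_mono hBC)⟩
  have hAC : A ⊆ C := by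
    intro a ha
    obtain ⟨c, hc, hca⟩ := hA ⟨a, ha, rfl⟩
    rwa [← h.injOn (hC hc) (h3 ha) hca]
  exact (h𝓚.le_image (h.mono hC) (h𝓚.mem_subset h2 hC) hAC).2 (h5 C hAC hCB)

end StrongClass.IsFullAmalgamationClass

end Calculus

/-! ### Closed sets, strong sets, and bounded approximations of the closure. -/

section Closure

variable {L : FirstOrder.Language.{0, 0}} [L.IsRelational] {𝓚 : StrongClass.{w} L}

/-- All finite subsets of `N` are in `K`. -/
def HasAge (𝓚 : StrongClass.{w} L) (N : Type w) [L.Structure N] : Prop :=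
  ∀ A : Set N, A.Finite → induced L A ∈ 𝓚.K

/-- `b` lies in the closure of `X ∩ Y` computed in `Y`. -/
def GenIn (𝓚 : StrongClass.{w} L) {N : Type w} [L.Structure N] (X Y : Set N) (b : N) : Prop :=
  b ∈ Y ∧ ∀ Y' ⊆ Y, X ∩ Y ⊆ Y' → 𝓚.Le Y' Y → b ∈ Y'

/-- The points that are in the closure of `X` as witnessed by sets with at most `s` elements. -/
def cls (𝓚 : StrongClass.{w} L) {N : Type w} [L.Structure N] (X : Set N) (s : ℕ) : Set N :=
  {b | ∃ Y : Set N, Y.Finite ∧ induced L Y ∈ 𝓚.K ∧ Y.ncard ≤ s ∧ GenIn 𝓚 X Y b}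

namespace StrongClass

variable {N : Type w} [L.Structure N]

theorem subset_cl (X : Set N) : X ⊆ 𝓚.cl X := Set.subset_sInter fun _ hY => hY.1

theorem closed_cl (X : Set N) : 𝓚.Closed (𝓚.cl X) := fun A B hA hAB =>
  Set.subset_sInter fun _ hY => hY.2 A B (hA.trans (Set.sInter_subset_of_mem hY)) hAB

theorem cl_subset {X Y : Set N} (h : X ⊆ Y) (hY : 𝓚.Closed Y) : 𝓚.cl X ⊆ Y :=
  Set.sInter_subset_of_mem ⟨h, hY⟩

theorem cl_mono {X Y : Set N} (h : X ⊆ Y) : 𝓚.cl X ⊆ 𝓚.cl Y :=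
  cl_subset (h.trans (subset_cl Y)) (closed_cl Y)

theorem exists_isMinimalPair {A B : Set N} (hage : HasAge 𝓚 N) (hB : B.Finite) (hAB : A ⊆ B)
    (h : ¬ 𝓚.Le A B) : ∃ B' ⊆ B, 𝓚.IsMinimalPair A B' := by
  obtain ⟨B', hB', hmin⟩ := (hB.finite_subsets.subset
    (s := {C | C ⊆ B}) (t := {C : Set N | C ⊆ B ∧ A ⊆ C ∧ ¬ 𝓚.Le A C}) fun C hC => hC.1).exists_minimal
    ⟨B, subset_rfl, hAB, h⟩
  refine ⟨B', hB'.1, hB.subset hB'.1, hage _ (hB.subset hB'.1), hB'.2.1, hB'.2.2, ?_⟩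
  intro B₀ hA h0
  by_contra hn
  exact h0.2 (hmin ⟨h0.1.trans hB'.1, hA, hn⟩ h0.1)

variable (h𝓚 : 𝓚.IsFullAmalgamationClass)
include h𝓚

/-- A failure would produce a minimal pair over X ∩ Y inside Y, and closedness would push it back
into X ∩ Y. With `closed_of_inter_le` this characterizes closed sets by strongness in finite sets,
so that the axioms for `≤` apply to them. -/
theorem Closed.inter_le {X Y : Set N} (hage : HasAge 𝓚 N) (hX : 𝓚.Closed X) (hY : Y.Finite) :
    𝓚.Le (X ∩ Y) Y := by
  by_contra h
  obtain ⟨B, hB, hAB⟩ := exists_isMinimalPair hage hY Set.inter_subset_right h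
  have h1 := hX _ _ Set.inter_subset_left hAB
  have : X ∩ Y = B := Set.Subset.antisymm hAB.2.2.1 (Set.subset_inter h1 hB)
  rw [this] at hAB
  exact hAB.2.2.2.1 (h𝓚.le_refl hAB.2.1)

theorem closed_of_inter_le {X : Set N}
    (h : ∀ Y : Set N, Y.Finite → 𝓚.Le (X ∩ Y) Y) : 𝓚.Closed X := by
  intro A B hA hAB
  by_contra hn
  refine hAB.2.2.2.1 (h𝓚.le_trans hAB.2.1 (hAB.2.2.2.2 (X ∩ B) (Set.subset_inter hA hAB.2.2.1)
    ⟨Set.inter_subset_right, fun h1 => hn (h1.trans Set.inter_subset_left)⟩) (h B hAB.1))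

theorem FinStrong.closed {X : Set N} (hage : HasAge 𝓚 N) (hX : 𝓚.FinStrong X) : 𝓚.Closed X := by
  refine closed_of_inter_le h𝓚 fun Y hY => ?_
  exact h𝓚.le_inter (hage _ (hX.1.union hY)) (hX.2 _ (hX.1.union hY) Set.subset_union_left)
    Set.subset_union_right

theorem Closed.finStrong {X : Set N} (hage : HasAge 𝓚 N) (hX : 𝓚.Closed X) (hfin : X.Finite) :
    𝓚.FinStrong X := by
  refine ⟨hfin, fun B hB hXB => ?_⟩
  have := hX.inter_le h𝓚 hage hB
  rwa [Set.inter_eq_left.2 hXB] at this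

theorem cls_subset_cl (hage : HasAge 𝓚 N) (X : Set N) (s : ℕ) : cls 𝓚 X s ⊆ 𝓚.cl X := by
  rintro b ⟨Y, hY, -, -, h1, h2⟩
  exact (h2 (𝓚.cl X ∩ Y) Set.inter_subset_right
    (Set.inter_subset_inter_left _ (subset_cl X)) ((closed_cl X).inter_le h𝓚 hage hY)).1

omit h𝓚 in
theorem cls_mono_left {X X' : Set N} (h : X ⊆ X') (s : ℕ) : cls 𝓚 X s ⊆ cls 𝓚 X' s :=
  fun _ ⟨Y, hY, hK, hs, h1, h2⟩ => ⟨Y, hY, hK, hs, h1, fun Y' hY' hX' => h2 Y' hY'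
    ((Set.inter_subset_inter_left _ h).trans hX')⟩

omit h𝓚 in
theorem cls_mono_right (X : Set N) {s s' : ℕ} (h : s ≤ s') : cls 𝓚 X s ⊆ cls 𝓚 X s' :=
  fun _ ⟨Y, hY, hK, hs, h1⟩ => ⟨Y, hY, hK, hs.trans h, h1⟩

omit h𝓚 in
theorem mem_cls_of_mem (hage : HasAge 𝓚 N) {X : Set N} {b : N} (h : b ∈ X) {s : ℕ} (hs : 1 ≤ s) : b ∈ cls 𝓚 X s :=
  ⟨{b}, Set.finite_singleton b, hage _ (Set.finite_singleton b), by simpa using hs, rfl, fun _ _ h1 _ => h1 ⟨h, rfl⟩⟩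

/-- The union is closed: for a minimal pair (P, Q), the witnesses for the finitely many points of P,
joined with Q, form a single finite witness for all of Q. -/
theorem cl_eq_iUnion_cls (hage : HasAge 𝓚 N) (X : Set N) : 𝓚.cl X = ⋃ s, cls 𝓚 X s := by
  refine Set.Subset.antisymm (cl_subset (fun b hb => Set.mem_iUnion.2
    ⟨1, mem_cls_of_mem hage hb le_rfl⟩) ?_) (Set.iUnion_subset fun s => cls_subset_cl h𝓚 hage X s)
  intro P Q hP hPQ
  have hP' : ∀ p : P, ∃ Y : Set N, Y.Finite ∧ GenIn 𝓚 X Y p := fun p => by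
    obtain ⟨s, Y, hY, -, -, h⟩ := Set.mem_iUnion.1 (hP p.2)
    exact ⟨Y, hY, h⟩
  choose Y hYfin hY using hP'
  have : Finite P := hPQ.1.subset hPQ.2.2.1
  have hUfin : ((⋃ p, Y p) ∪ Q).Finite := (Set.finite_iUnion hYfin).union hPQ.1
  intro b hb
  refine Set.mem_iUnion.2 ⟨_, (⋃ p, Y p) ∪ Q, hUfin, hage _ hUfin, le_rfl, Or.inr hb, ?_⟩
  intro Y' hY' hXY' hle
  have hPY' : P ⊆ Y' := by
    intro p hp
    have hsub : Y ⟨p, hp⟩ ⊆ (⋃ p, Y p) ∪ Q :=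
      (Set.subset_iUnion Y ⟨p, hp⟩).trans Set.subset_union_left
    exact ((hY ⟨p, hp⟩).2 (Y' ∩ Y ⟨p, hp⟩) Set.inter_subset_right
      (Set.subset_inter ((Set.inter_subset_inter_right _ hsub).trans hXY') Set.inter_subset_right)
      (h𝓚.le_inter (hage _ hUfin) hle hsub)).1
  by_contra hbY
  refine hPQ.2.2.2.1 (h𝓚.le_trans hPQ.2.1 (hPQ.2.2.2.2 (Y' ∩ Q)
    (Set.subset_inter hPY' hPQ.2.2.1) ⟨Set.inter_subset_right, fun h => hbY (h hb).1⟩)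
    (h𝓚.le_inter (hage _ hUfin) hle Set.subset_union_right))

/-- Finite character: the closure is a union of sets that are definable over finitely many
parameters, which is what compactness can handle. -/
theorem mem_cl_iff (hage : HasAge 𝓚 N) {X : Set N} {b : N} :
    b ∈ 𝓚.cl X ↔ ∃ F : Set N, F.Finite ∧ F ⊆ X ∧ ∃ s, b ∈ cls 𝓚 F s := by
  rw [cl_eq_iUnion_cls h𝓚 hage, Set.mem_iUnion]
  constructor
  · rintro ⟨s, Y, hY, hK, hs, h1, h2⟩
    exact ⟨X ∩ Y, hY.subset Set.inter_subset_right, Set.inter_subset_left, s, Y, hY, hK, hs, h1,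
      fun Y' hY' hX => h2 Y' hY' (by rwa [Set.inter_assoc, Set.inter_self] at hX)⟩
  · rintro ⟨F, -, hF, s, h⟩
    exact ⟨s, cls_mono_left hF s h⟩

end StrongClass
end Closure

/-! ### Properties of tuples defined by one formula in all structures. -/

section Uniform

/-- The predicate `P` on `α`-tuples in `L`-structures is defined by one formula. -/
def FO (L : FirstOrder.Language.{0, 0}) (α : Type u₁)
    (P : ∀ (N : Type w) [L.Structure N], (α → N) → Prop) : Prop :=
  ∃ φ : L.Formula α, ∀ (N : Type w) [L.Structure N] (v : α → N), φ.Realize v ↔ P N v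

variable {L : FirstOrder.Language.{0, 0}} {α : Type u₁} {β : Type u₂}
  {P Q : ∀ (N : Type w) [L.Structure N], (α → N) → Prop}

theorem FO.congr (hP : FO L α P)
    (h : ∀ (N : Type w) [L.Structure N] (v : α → N), P N v ↔ Q N v) : FO L α Q :=
  let ⟨φ, hφ⟩ := hP
  ⟨φ, fun N _ v => (hφ N v).trans (h N v)⟩

theorem FO.not (hP : FO L α P) : FO L α (fun N _ v => ¬ P N v) :=
  let ⟨φ, hφ⟩ := hP
  ⟨φ.not, fun N _ v => by rw [Formula.realize_not, hφ]⟩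

theorem FO.and (hP : FO L α P) (hQ : FO L α Q) : FO L α (fun N _ v => P N v ∧ Q N v) :=
  let ⟨φ, hφ⟩ := hP
  let ⟨ψ, hψ⟩ := hQ
  ⟨φ ⊓ ψ, fun N _ v => by rw [Formula.realize_inf, hφ, hψ]⟩

theorem FO.imp (hP : FO L α P) (hQ : FO L α Q) : FO L α (fun N _ v => P N v → Q N v) :=
  let ⟨φ, hφ⟩ := hP
  let ⟨ψ, hψ⟩ := hQ
  ⟨φ.imp ψ, fun N _ v => by rw [Formula.realize_imp, hφ, hψ]⟩

theorem FO.or (hP : FO L α P) (hQ : FO L α Q) : FO L α (fun N _ v => P N v ∨ Q N v) :=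
  (hP.not.imp hQ).congr fun _ _ _ => or_iff_not_imp_left.symm

theorem FO.relabel {P : ∀ (N : Type w) [L.Structure N], (α → N) → Prop} (hP : FO L α P)
    (g : α → β) : FO L β (fun N _ v => P N (fun i => v (g i))) :=
  let ⟨φ, hφ⟩ := hP
  ⟨φ.relabel g, fun N _ v => by rw [Formula.realize_relabel, hφ]; rfl⟩

theorem FO.all_fin {ι : Type u₂} [Finite ι]
    {P : ι → ∀ (N : Type w) [L.Structure N], (α → N) → Prop} (hP : ∀ i, FO L α (P i)) :
    FO L α (fun N _ v => ∀ i, P i N v) := by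
  choose φ hφ using hP
  exact ⟨Formula.iInf φ, fun N _ v => by simp [hφ]⟩

theorem FO.ex_fin {ι : Type u₂} [Finite ι]
    {P : ι → ∀ (N : Type w) [L.Structure N], (α → N) → Prop} (hP : ∀ i, FO L α (P i)) :
    FO L α (fun N _ v => ∃ i, P i N v) := by
  choose φ hφ using hP
  exact ⟨Formula.iSup φ, fun N _ v => by simp [hφ]⟩

theorem FO.ex [Finite β] {P : ∀ (N : Type w) [L.Structure N], (α ⊕ β → N) → Prop}
    (hP : FO L (α ⊕ β) P) : FO L α (fun N _ v => ∃ x : β → N, P N (Sum.elim v x)) :=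
  let ⟨φ, hφ⟩ := hP
  ⟨φ.iExs β, fun N _ v => by simp [hφ]⟩

theorem FO.all [Finite β] {P : ∀ (N : Type w) [L.Structure N], (α ⊕ β → N) → Prop}
    (hP : FO L (α ⊕ β) P) : FO L α (fun N _ v => ∀ x : β → N, P N (Sum.elim v x)) :=
  hP.not.ex.not.congr fun _ _ _ => by simp

theorem FO.const (p : Prop) : FO L α (fun (_ : Type w) _ _ => p) := by
  by_cases hp : p
  · exact ⟨⊤, fun N _ v => by simp [hp]⟩
  · exact ⟨⊥, fun N _ v => by simp [hp]⟩

theorem FO.eq (i j : α) : FO L α (fun (_ : Type w) _ v => v i = v j) :=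
  ⟨(Term.var i).equal (Term.var j), fun N _ v => by simp⟩

theorem FO.rel {n : ℕ} (R : L.Relations n) (t : Fin n → α) :
    FO L α (fun (_ : Type w) _ v => Structure.RelMap R fun i => v (t i)) :=
  ⟨R.formula fun i => Term.var (t i), fun N _ v => by simp [Formula.realize_rel]⟩

/-- The tuples `v` and `v'` satisfy the same atomic formulas. -/
structure AtomEq (L : FirstOrder.Language.{0, 0}) {N N' : Type w} [L.Structure N]
    [L.Structure N'] (v : α → N) (v' : α → N') : Prop where
  eq : ∀ i j, v i = v j ↔ v' i = v' j
  rel : ∀ (n : ℕ) (R : L.Relations n) (t : Fin n → α),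
    Structure.RelMap R (fun i => v (t i)) ↔ Structure.RelMap R fun i => v' (t i)

theorem AtomEq.comp {N N' : Type w} [L.Structure N] [L.Structure N'] {v : α → N} {v' : α → N'}
    (h : AtomEq L v v') (g : β → α) : AtomEq L (fun i => v (g i)) (fun i => v' (g i)) :=
  ⟨fun i j => h.eq (g i) (g j), fun n R t => h.rel n R fun i => g (t i)⟩

theorem AtomEq.exists_partialIso [Nonempty α] {N N' : Type w} [L.Structure N] [L.Structure N']
    {v : α → N} {v' : α → N'} (h : AtomEq L v v') :
    ∃ f : N → N', PartialIso L f (Set.range v) ∧ ∀ i, f (v i) = v' i := by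
  classical
  have hf : ∀ x : N, ∃ y : N', ∀ i, v i = x → v' i = y := by
    intro x
    by_cases hx : ∃ i, v i = x
    · obtain ⟨i, rfl⟩ := hx
      exact ⟨v' i, fun j hj => (h.eq j i).1 hj⟩
    · exact ⟨v' (Classical.arbitrary α), fun i hi => absurd ⟨i, hi⟩ hx⟩
  choose f hf using hf
  have hf' : ∀ i, f (v i) = v' i := fun i => (hf (v i) i rfl).symm
  refine ⟨f, ⟨?_, ?_⟩, hf'⟩
  · rintro _ ⟨i, rfl⟩ _ ⟨j, rfl⟩ hij
    rw [hf', hf'] at hij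
    exact (h.eq i j).2 hij
  · intro n R x hx
    choose t ht using hx
    obtain rfl : (fun i => v (t i)) = x := funext ht
    simp only [hf']
    exact (h.rel n R t).symm

theorem PartialIso.atomEq {N N' : Type w} [L.Structure N] [L.Structure N'] {f : N → N'}
    {v : α → N} (h : PartialIso L f (Set.range v)) : AtomEq L v fun i => f (v i) :=
  ⟨fun i j => (h.injOn.eq_iff ⟨i, rfl⟩ ⟨j, rfl⟩).symm,
    fun n R t => (h.rel n R (fun i => v (t i)) fun i => ⟨t i, rfl⟩).symm⟩

/-- A finite tuple in a finite relational language has finitely many atomic diagrams, so a property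
that depends on the diagram only is a finite disjunction of diagrams. -/
theorem FO.of_atomEq [Finite α] [Finite (Σ n, L.Relations n)]
    (hP : ∀ (N N' : Type w) [L.Structure N] [L.Structure N'] (v : α → N) (v' : α → N'),
      AtomEq L v v' → P N v → P N' v') : FO L α P := by
  let At := (α × α) ⊕ Σ R : (Σ n, L.Relations n), (Fin R.1 → α)
  let holds : At → ∀ (N : Type w) [L.Structure N], (α → N) → Prop := fun a N _ v =>
    Sum.elim (fun p : α × α => v p.1 = v p.2)
      (fun q : Σ R : (Σ n, L.Relations n), (Fin R.1 → α) =>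
        Structure.RelMap q.1.2 fun i => v (q.2 i)) a
  have hholds : ∀ a, FO L α (holds a) := by
    rintro (⟨i, j⟩ | ⟨⟨n, R⟩, t⟩)
    · exact FO.eq i j
    · exact FO.rel R t
  -- Here `s` runs through the possible diagrams. That `s` is the diagram of some tuple with the
  -- property is a constant proposition; only the last conjunct speaks of `v`.
  have key : FO L α (fun N _ v => ∃ s : Set At,
      (∃ (N' : Type w) (_ : L.Structure N') (v' : α → N'), (∀ a, a ∈ s ↔ holds a N' v') ∧ P N' v') ∧
        ∀ a, (holds a N v → a ∈ s) ∧ (a ∈ s → holds a N v)) :=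
    FO.ex_fin fun s => (FO.const _).and (FO.all_fin fun a => ((hholds a).imp (FO.const _)).and
      ((FO.const _).imp (hholds a)))
  refine key.congr fun N _ v => ⟨?_, fun h => ⟨{a | holds a N v}, ⟨N, _, v, fun a => Iff.rfl, h⟩,
    fun a => ⟨id, id⟩⟩⟩
  rintro ⟨s, ⟨N', _, v', hs, hP'⟩, hv⟩
  refine hP N' N v' v ⟨fun i j => ?_, fun n R t => ?_⟩ hP'
  · exact (hs (Sum.inl (i, j))).symm.trans ⟨(hv (Sum.inl (i, j))).2, (hv (Sum.inl (i, j))).1⟩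
  · exact (hs (Sum.inr ⟨⟨n, R⟩, t⟩)).symm.trans
      ⟨(hv (Sum.inr ⟨⟨n, R⟩, t⟩)).2, (hv (Sum.inr ⟨⟨n, R⟩, t⟩)).1⟩

end Uniform

/-! ### Definability of the bounded closures. -/

section Definability

variable {L : FirstOrder.Language.{0, 0}} [L.IsRelational] {𝓚 : StrongClass.{w} L}
  (h𝓚 : 𝓚.IsFullAmalgamationClass) {α : Type u₁}
include h𝓚

theorem AtomEq.mem_range {N N' : Type w} [L.Structure N] [L.Structure N'] {v : α → N}
    {v' : α → N'} (h : AtomEq L v v') (hv : induced L (Set.range v) ∈ 𝓚.K) :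
    induced L (Set.range v') ∈ 𝓚.K := by
  have hc : ∀ y : sub L (Set.range v'), ∃ i, v' i = y := fun y => y.2
  choose c hc using hc
  refine h𝓚.hereditary _ _ hv ⟨⟨⟨fun y => ⟨v (c y), c y, rfl⟩, fun y z hyz => ?_⟩,
    fun f => isEmptyElim f, fun {n} R x => ?_⟩⟩
  · have h1 : v (c y) = v (c z) := congrArg Subtype.val hyz
    exact Subtype.ext ((hc y).symm.trans (((h.eq _ _).1 h1).trans (hc z)))
  · refine (h.rel n R fun i => c (x i)).trans (Iff.of_eq (congrArg _ (funext fun i => ?_)))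
    exact hc (x i)

theorem FO.mem_range [Finite α] [Finite (Σ n, L.Relations n)] :
    FO L α (fun (_ : Type w) _ v => induced L (Set.range v) ∈ 𝓚.K) :=
  FO.of_atomEq fun _ _ _ _ _ _ h => h.mem_range h𝓚

theorem GenIn.image {N N' : Type w} [L.Structure N] [L.Structure N'] {f : N → N'} {X Y : Set N}
    {b : N} (hf : PartialIso L f (X ∪ Y)) (hY : induced L Y ∈ 𝓚.K) (h : GenIn 𝓚 X Y b) :
    GenIn 𝓚 (f '' X) (f '' Y) (f b) := by
  refine ⟨⟨b, h.1, rfl⟩, fun Z hZ hXZ hle => ?_⟩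
  obtain ⟨Y', hY', rfl⟩ := Set.subset_image_iff.1 hZ
  refine ⟨b, h.2 Y' hY' ?_ ((h𝓚.le_image (hf.mono Set.subset_union_right) hY hY').1 hle), rfl⟩
  rintro x ⟨hxX, hxY⟩
  obtain ⟨y, hy, hyx⟩ := hXZ ⟨⟨x, hxX, rfl⟩, ⟨x, hxY, rfl⟩⟩
  rwa [← hf.injOn (Or.inr (hY' hy)) (Or.inl hxX) hyx]

omit h𝓚 in
-- Listing the witness with repetitions replaces a bounded set by one block of `s` quantified
-- variables.
theorem mem_cls_iff {N : Type w} [L.Structure N] {X : Set N} {s : ℕ} {b : N} :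
    b ∈ cls 𝓚 X s ↔ ∃ y : Fin s → N, induced L (Set.range y) ∈ 𝓚.K ∧
      GenIn 𝓚 X (Set.range y) b := by
  constructor
  · rintro ⟨Y, hY, hK, hs, h⟩
    have : Finite Y := hY
    have : Nonempty Y := ⟨⟨b, h.1⟩⟩
    obtain ⟨e⟩ : Nonempty (Y ↪ Fin s) := by
      have := Fintype.ofFinite Y
      refine Function.Embedding.nonempty_of_card_le ?_
      rwa [Fintype.card_fin, ← Nat.card_eq_fintype_card, Nat.card_coe_set_eq]
    have hr : Set.range (fun i => ((Function.invFun e i : Y) : N)) = Y := by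
      ext x
      constructor
      · rintro ⟨i, rfl⟩
        exact (Function.invFun e i : Y).2
      · intro hx
        exact ⟨e ⟨x, hx⟩, congrArg Subtype.val (Function.leftInverse_invFun e.injective ⟨x, hx⟩)⟩
    exact ⟨_, hr.symm ▸ hK, hr.symm ▸ h⟩
  · rintro ⟨y, hK, h⟩
    refine ⟨_, Set.finite_range y, hK, ?_, h⟩
    rw [← Nat.card_coe_set_eq]
    simpa using Finite.card_range_le y

theorem FO.cls [Finite α] [Finite (Σ n, L.Relations n)] (s : ℕ) (β : Type u₂) (i : β) (p : α → β) :
    FO L β (fun (_ : Type w) _ v => v i ∈ cls 𝓚 (Set.range fun a => v (p a)) s) := by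
  have h1 : FO L ((α ⊕ Unit) ⊕ Fin s) (fun (N : Type w) _ v =>
      induced L (Set.range fun j : Fin s => v (Sum.inr j)) ∈ 𝓚.K ∧
      GenIn 𝓚 (Set.range fun a => v (Sum.inl (Sum.inl a)))
        (Set.range fun j : Fin s => v (Sum.inr j)) (v (Sum.inl (Sum.inr ())))) := by
    refine FO.of_atomEq ?_
    intro N N' _ _ v v' hv h
    refine ⟨(hv.comp Sum.inr).mem_range h𝓚 h.1, ?_⟩
    obtain ⟨f, hf, hfv⟩ := hv.exists_partialIso
    have := GenIn.image h𝓚 (hf.mono ?_) h.1 h.2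
    · simpa only [← Set.range_comp, Function.comp_def, hfv] using this
    · rintro _ (⟨a, rfl⟩ | ⟨j, rfl⟩) <;> exact ⟨_, rfl⟩
  refine (h1.ex.relabel (Sum.elim p fun _ => i)).congr fun N _ v => ?_
  rw [mem_cls_iff]
  rfl

end Definability

/-! ### Equality of types. -/

section Types

variable {L : FirstOrder.Language.{0, 0}} {α : Type u₁} {β : Type u₂}

/-- The tuples `a` and `b` have the same type. -/
def TpEq (L : FirstOrder.Language.{0, 0}) {N N' : Type w} [L.Structure N] [L.Structure N']
    (a : α → N) (b : α → N') : Prop :=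
  ∀ φ : L.Formula α, φ.Realize a ↔ φ.Realize b

section

variable {N N' N'' : Type w} [L.Structure N] [L.Structure N'] [L.Structure N'']
  {a : α → N} {b : α → N'}

theorem TpEq.symm (h : TpEq L a b) : TpEq L b a := fun φ => (h φ).symm

theorem TpEq.trans {c : α → N''} (h : TpEq L a b) (h' : TpEq L b c) : TpEq L a c :=
  fun φ => (h φ).trans (h' φ)

theorem TpEq.comp (h : TpEq L a b) (g : β → α) :
    TpEq L (fun i => a (g i)) (fun i => b (g i)) := fun φ => by
  have := h (φ.relabel g)
  rwa [Formula.realize_relabel, Formula.realize_relabel] at this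

theorem TpEq.fo (h : TpEq L a b) {P : ∀ (N : Type w) [L.Structure N], (α → N) → Prop}
    (hP : FO L α P) : P N a ↔ P N' b := by
  obtain ⟨φ, hφ⟩ := hP
  rw [← hφ, ← hφ, h φ]

theorem TpEq.atomEq (h : TpEq L a b) : AtomEq L a b :=
  ⟨fun i j => h.fo (FO.eq i j), fun _ R t => h.fo (FO.rel R t)⟩

theorem tpEq_equiv (σ : N ≃[L] N') (a : α → N) : TpEq L a fun i => σ (a i) := fun φ =>
  (StrongHomClass.realize_formula σ φ).symm

theorem tpEq_elementary (j : N ↪ₑ[L] N') (a : α → N) : TpEq L a fun i => j (a i) := fun φ =>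
  (j.map_formula φ a).symm

theorem fo_of_model {G : Type w} [L.Structure G] (hN : N ⊨ L.completeTheory G)
    {P : ∀ (N : Type w) [L.Structure N], (Empty → N) → Prop} (hP : FO L Empty P) :
    P N default ↔ P G default := by
  obtain ⟨φ, hφ⟩ := hP
  rw [← hφ, ← hφ]
  have key : ∀ ψ : L.Sentence, ψ.Realize G → ψ.Realize N := fun ψ hψ =>
    hN.realize_of_mem ψ (mem_completeTheory.2 hψ)
  refine ⟨fun h => ?_, key φ⟩
  by_contra h2
  exact Formula.realize_not.1 (key φ.not (Formula.realize_not.2 h2)) h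

end

end Types

/-! ### Extending type equalities by saturation and homogeneity. -/

namespace IsUniversalDomain

variable {L : FirstOrder.Language.{0, 0}} {T : L.Theory} {κ : Cardinal.{w}} {C : Type w}
  [L.Structure C]

theorem exists_tpEq_option (hC : IsUniversalDomain T κ C) {I : Type w} (hI : #I < κ)
    {N : Type w} [L.Structure N] {a : I → N} {c : I → C} (h : TpEq L a c) (d : N) :
    ∃ d' : C, TpEq L (fun o : Option I => o.elim d a) (fun o : Option I => o.elim d' c) := by
  -- Saturation speaks of a set of parameters, not of a family, so the constants are the points of
  -- the range of `c`. The choice of an index for each is harmless because `a` and `c` satisfy the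
  -- same equalities.
  have hpre : ∀ x : Set.range c, ∃ i, c i = x := fun x => x.2
  choose pre hpre using hpre
  have key : ∀ ψ : L.Formula (Set.range c),
      ψ.Realize (Subtype.val : Set.range c → C) ↔ ψ.Realize (fun x => a (pre x)) := by
    intro ψ
    have := h.comp pre ψ
    rw [this]
    simp only [hpre]
  let : (constantsOn (Set.range c)).Structure N := constantsOn.structure fun x => a (pre x)
  have hmod : N ⊨ L[[Set.range c]].completeTheory C := by
    refine ⟨fun φ hφ => ?_⟩
    rw [mem_completeTheory] at hφ
    refine (Formula.realize_equivSentence_symm N φ fun x => a (pre x)).1 ?_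
    rw [← key]
    exact (Formula.realize_equivSentence_symm C φ Subtype.val).2 hφ
  have : Nonempty N := ⟨d⟩
  obtain ⟨d', hd'⟩ := hC.saturated (Set.range c) (mk_range_le.trans_lt hI)
    ((L[[Set.range c]].completeTheory C).typeOf fun _ : Fin 1 => d)
  have hd : ∀ φ : L[[Set.range c]].Formula (Fin 1),
      φ.Realize (fun _ : Fin 1 => d) → φ.Realize (fun _ : Fin 1 => d') := fun φ hφ =>
    hd' φ (Theory.CompleteType.formula_mem_typeOf.2 hφ)
  have key2 : ∀ θ : L.Formula (Option I),
      θ.Realize (fun o : Option I => o.elim d a) → θ.Realize (fun o : Option I => o.elim d' c) := by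
    intro θ hθ
    let g : Option I → Set.range c ⊕ Fin 1 := fun o => o.elim (Sum.inr 0) fun i => Sum.inl ⟨c i, i, rfl⟩
    let φ : L[[Set.range c]].Formula (Fin 1) := BoundedFormula.constantsVarsEquiv.symm (θ.relabel g)
    have hφ : ∀ (K : Type w) [L.Structure K] [(constantsOn (Set.range c)).Structure K] (x : K),
        φ.Realize (fun _ => x) ↔ θ.Realize (fun o => Sum.elim (fun y => ((L.con y : L[[Set.range c]].Constants) : K)) (fun _ => x) (g o)) := by
      intro K _ _ x
      rw [Formula.Realize, ← BoundedFormula.realize_constantsVarsEquiv]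
      simp only [φ, _root_.Equiv.apply_symm_apply]
      exact Formula.realize_relabel
    have h1 := (hφ C d').1 (hd φ ((hφ N d).2 ?_))
    · convert h1 using 1
      funext o
      cases o <;> rfl
    · convert hθ using 1
      funext o
      cases o with
      | none => rfl
      | some i =>
        have : a (pre ⟨c i, i, rfl⟩) = a i := (h.atomEq.eq _ _).2 (hpre _)
        exact this
  exact ⟨d', fun θ => ⟨key2 θ, fun h1 => by
    by_contra h2
    exact (Formula.realize_not.1 (key2 θ.not (Formula.realize_not.2 h2))) h1⟩⟩

theorem exists_equiv (hC : IsUniversalDomain T κ C) {I : Type w} (hI : #I < κ)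
    {a c : I → C} (h : TpEq L a c) : ∃ σ : C ≃[L] C, ∀ i, σ (a i) = c i := by
  have hpre : ∀ x : Set.range a, ∃ i, a i = x := fun x => x.2
  choose pre hpre using hpre
  obtain ⟨σ, hσ⟩ := hC.homogeneous (Set.range a) (fun x => c (pre x)) (mk_range_le.trans_lt hI) (by
    intro n φ v
    have := h.comp (fun i => pre (v i)) φ
    simpa only [hpre] using this)
  refine ⟨σ, fun i => ?_⟩
  have h1 := hσ ⟨a i, i, rfl⟩
  have h2 : c (pre ⟨a i, i, rfl⟩) = c i := (h.atomEq.eq _ _).1 (hpre _)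
  exact h1.trans h2

theorem exists_tpEq_fin (hC : IsUniversalDomain T κ C) {I : Type w} (hI : #I < κ)
    {N : Type w} [L.Structure N] {a : I → N} {c : I → C} (h : TpEq L a c) (n : ℕ)
    (b : Fin n → N) : ∃ b' : Fin n → C, TpEq L (Sum.elim a b) (Sum.elim c b') := by
  induction n with
  | zero =>
    refine ⟨Fin.elim0, ?_⟩
    have := h.comp (fun x : I ⊕ Fin 0 => x.elim id fun i => i.elim0)
    convert this using 1 <;>
    · funext x
      rcases x with x | x
      · rfl
      · exact x.elim0
  | succ n ih =>
    obtain ⟨b', hb'⟩ := ih (Fin.init b)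
    have hI' : #(I ⊕ Fin n) < κ := by
      rw [mk_sum]
      simp only [mk_fin, lift_natCast, lift_uzero]
      exact add_lt_of_lt hC.aleph0_le hI ((natCast_lt_aleph0 (n := n)).trans_le hC.aleph0_le)
    obtain ⟨d, hd⟩ := hC.exists_tpEq_option hI' hb' (b (Fin.last n))
    refine ⟨Fin.snoc b' d, ?_⟩
    have := hd.comp (fun x : I ⊕ Fin (n + 1) => x.elim (fun i => some (Sum.inl i))
      (Fin.lastCases none fun i => some (Sum.inr i)))
    convert this using 1 <;>
    · funext x
      rcases x with x | x
      · rfl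
      · refine Fin.lastCases ?_ (fun i => ?_) x
        · simp
        · simp [Fin.init]

theorem exists_tpEq_finite (hC : IsUniversalDomain T κ C) {I : Type w} (hI : #I < κ)
    {N : Type w} [L.Structure N] {a : I → N} {c : I → C} (h : TpEq L a c) {J : Type u₁} [Finite J]
    (b : J → N) : ∃ b' : J → C, TpEq L (Sum.elim a b) (Sum.elim c b') := by
  obtain ⟨n, ⟨e⟩⟩ := Finite.exists_equiv_fin J
  obtain ⟨b', hb'⟩ := hC.exists_tpEq_fin hI h n fun i => b (e.symm i)
  refine ⟨fun i => b' (e i), ?_⟩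
  have := hb'.comp (Sum.map id e)
  convert this using 1 <;>
  · funext x
    rcases x with x | x <;> simp

end IsUniversalDomain

/-! ### Compactness in a universal domain. -/

section Compactness

variable {L : FirstOrder.Language.{0, 0}} {C : Type w} [L.Structure C]

theorem exists_realization [Nonempty C] {I : Type w} {J : Type} (c : I → C)
    (Γ : Set (L.Formula (I ⊕ J)))
    (hΓ : ∀ Γ₀ : Finset (L.Formula (I ⊕ J)), (Γ₀ : Set (L.Formula (I ⊕ J))) ⊆ Γ →
      ∃ x : J → C, ∀ φ ∈ Γ₀, φ.Realize (Sum.elim c x)) :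
    ∃ (N : Type w) (_ : L.Structure N) (a : I → N) (b : J → N), TpEq L a c ∧
      ∀ φ ∈ Γ, φ.Realize (Sum.elim a b) := by
  classical
  let Δ : Set (L.Formula (I ⊕ J)) := {φ | ∃ ψ : L.Formula I, ψ.Realize c ∧ φ = ψ.relabel Sum.inl} ∪ Γ
  let 𝒯 : L[[I ⊕ J]].Theory := Formula.equivSentence '' Δ
  have hsat : 𝒯.IsSatisfiable := by
    rw [Theory.isSatisfiable_iff_isFinitelySatisfiable]
    intro T₀ hT₀
    obtain ⟨Δ₀, hΔ₀, rfl⟩ := Finset.subset_set_image_iff.1 hT₀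
    obtain ⟨x, hx⟩ := hΓ (Δ₀.filter (· ∈ Γ)) (by intro φ hφ; simp at hφ; exact hφ.2)
    let : (constantsOn (I ⊕ J)).Structure C := constantsOn.structure (Sum.elim c x)
    have : C ⊨ (↑(Δ₀.image Formula.equivSentence) : L[[I ⊕ J]].Theory) := by
      refine ⟨fun φ hφ => ?_⟩
      obtain ⟨φ, hφ', rfl⟩ := Finset.mem_image.1 hφ
      refine (Formula.realize_equivSentence C φ).2 ?_
      rcases hΔ₀ hφ' with ⟨ψ, hψ, rfl⟩ | h
      · refine Formula.realize_relabel.2 hψ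
      · exact hx φ (Finset.mem_filter.2 ⟨hφ', h⟩)
    exact Theory.Model.isSatisfiable C
  obtain ⟨N⟩ := hsat
  let : L.Structure N := (L.lhomWithConstants (I ⊕ J)).reduct N
  have : (L.lhomWithConstants (I ⊕ J)).IsExpansionOn N := LHom.isExpansionOn_reduct _ _
  have hN : ∀ φ ∈ Δ, φ.Realize (fun i => ((L.con i : L[[I ⊕ J]].Constants) : N)) := fun φ hφ =>
    (Formula.realize_equivSentence N φ).1 (N.is_model.realize_of_mem _ ⟨φ, hφ, rfl⟩)
  have hle : ∀ ψ : L.Formula I, ψ.Realize c →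
      ψ.Realize (fun i : I => ((L.con (Sum.inl i : I ⊕ J) : L[[I ⊕ J]].Constants) : N)) :=
    fun ψ hψ => Formula.realize_relabel.1 (hN _ (Or.inl ⟨ψ, hψ, rfl⟩))
  refine ⟨N, inferInstance, fun i => ((L.con (Sum.inl i : I ⊕ J) : L[[I ⊕ J]].Constants) : N),
    fun i => ((L.con (Sum.inr i : I ⊕ J) : L[[I ⊕ J]].Constants) : N), fun ψ => ⟨fun h => ?_, hle ψ⟩,
    fun φ hφ => ?_⟩
  · by_contra h2
    exact Formula.realize_not.1 (hle ψ.not (Formula.realize_not.2 h2)) h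
  · convert hN φ (Or.inr hφ) using 1
    funext i
    rcases i with i | i <;> rfl

/-- Compactness realizes all the conditions in an auxiliary structure, over a copy of `c` with the
same type. Saturation then brings the finite tuple back into `C` over `c` itself. -/
theorem IsUniversalDomain.exists_forall [Nonempty C] {T : L.Theory} {κ : Cardinal.{w}}
    (hC : IsUniversalDomain T κ C) {I : Type w} (hI : #I < κ) {J : Type} [Finite J] (c : I → C)
    {τ : Type u₁} {P : τ → ∀ (N : Type w) [L.Structure N], (I ⊕ J → N) → Prop}
    (hP : ∀ t, FO L (I ⊕ J) (P t))
    (hfin : ∀ s : Finset τ, ∃ x : J → C, ∀ t ∈ s, P t C (Sum.elim c x)) :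
    ∃ x : J → C, ∀ t, P t C (Sum.elim c x) := by
  classical
  choose φ hφ using hP
  obtain ⟨N, _, a, b, hac, hΓ⟩ := exists_realization (J := J) c (Set.range φ) (by
    intro Γ₀ hΓ₀
    rw [← Set.image_univ] at hΓ₀
    obtain ⟨s, -, rfl⟩ := Finset.subset_set_image_iff.1 hΓ₀
    obtain ⟨x, hx⟩ := hfin s
    refine ⟨x, fun ψ hψ => ?_⟩
    obtain ⟨t, ht, rfl⟩ := Finset.mem_image.1 hψ
    exact (hφ t C _).2 (hx t ht))
  obtain ⟨x, hx⟩ := hC.exists_tpEq_finite hI hac b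
  exact ⟨x, fun t => (hφ t C _).1 ((hx _).1 (hΓ _ ⟨t, rfl⟩))⟩

end Compactness

/-! ### Free amalgams inside the generic. -/

section FreeExtension

variable {L : FirstOrder.Language.{0, 0}} [L.IsRelational] {𝓚 : StrongClass.{w} L}

section Amalgam

variable {G N : Type w} [L.Structure N] {X : Set G} {A B : Set N} {f : N → G}

open Classical in
/-- The map of `B` to the amalgam of `X` and `B` over `A`, where `A` is mapped to `X` by `f`. -/
noncomputable def amalgamMap (X : Set G) (A B : Set N) (f : N → G) (hfA : f '' A ⊆ X)
    (b : sub L B) : X ⊕ (B \ A : Set N) :=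
  if h : (b : N) ∈ A then Sum.inl ⟨f b, hfA ⟨b, h, rfl⟩⟩ else Sum.inr ⟨b, b.2, h⟩

/-- The free amalgam of `X` and `B` over `A`, where `A` is mapped to `X` by `f`. -/
@[reducible]
noncomputable def amalgamStructure [L.Structure G] (X : Set G) (A B : Set N) (f : N → G) (hfA : f '' A ⊆ X) :
    L.Structure (X ⊕ (B \ A : Set N)) where
  funMap g := isEmptyElim g
  RelMap {n} R x := (∃ y : Fin n → X, x = (fun i => Sum.inl (y i)) ∧
      Structure.RelMap R fun i => (y i : G)) ∨
    ∃ y : Fin n → sub L B, x = (fun i => amalgamMap X A B f hfA (y i)) ∧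
      Structure.RelMap R fun i => (y i : N)

theorem amalgamMap_eq_inl {hfA : f '' A ⊆ X} {b : sub L B} {x : X}
    (h : amalgamMap X A B f hfA b = Sum.inl x) : (b : N) ∈ A ∧ f b = x := by
  unfold amalgamMap at h
  split_ifs at h with hb
  exact ⟨hb, congrArg Subtype.val (Sum.inl.inj h)⟩

theorem amalgamMap_of_mem {hfA : f '' A ⊆ X} {b : sub L B} (h : (b : N) ∈ A) :
    amalgamMap X A B f hfA b = Sum.inl ⟨f b, hfA ⟨b, h, rfl⟩⟩ := by
  unfold amalgamMap
  rw [dif_pos h]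

theorem amalgamMap_injective (hfA : f '' A ⊆ X) (hf : Set.InjOn f A) :
    Function.Injective (amalgamMap (L := L) X A B f hfA) := by
  intro a b hab
  by_cases ha : (a : N) ∈ A
  · rw [amalgamMap_of_mem ha] at hab
    obtain ⟨hb, h⟩ := amalgamMap_eq_inl hab.symm
    exact Subtype.ext (hf ha hb h.symm)
  · by_cases hb : (b : N) ∈ A
    · rw [amalgamMap_of_mem hb] at hab
      exact absurd (amalgamMap_eq_inl hab).1 ha
    · unfold amalgamMap at hab
      rw [dif_neg ha, dif_neg hb] at hab
      simp only [Sum.inr.injEq] at hab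
      exact Subtype.ext (congrArg (fun z : (B \ A : Set N) => (z : N)) hab)

end Amalgam

variable (h𝓚 : 𝓚.IsFullAmalgamationClass) {G : Type w} [L.Structure G]
include h𝓚

/-- Fullness puts the abstract free amalgam D of X and B into `K` with X ≤ D. The extension property
embeds D over X onto a strong set, and the freeness is read off from D. -/
theorem StrongClass.IsGeneric.exists_amalgam (hG : 𝓚.IsGeneric G) {N : Type w} [L.Structure N]
    {A B : Set N} (hB : induced L B ∈ 𝓚.K) (hAB : 𝓚.Le A B) {f : N → G} (hf : PartialIso L f A)
    {X : Set G} (hX : 𝓚.FinStrong X) (hfA : f '' A ⊆ X) :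
    ∃ g : N → G, PartialIso L g B ∧ Set.EqOn g f A ∧ X ∩ g '' B ⊆ f '' A ∧
      (∀ (n : ℕ) (R : L.Relations n) (y : Fin n → G), Structure.RelMap R y →
        Set.range y ⊆ X ∪ g '' B → Set.range y ⊆ X ∨ Set.range y ⊆ g '' B) ∧
      𝓚.FinStrong (X ∪ g '' B) := by
  classical
  let D := X ⊕ (B \ A : Set N)
  let _ : L.Structure D := amalgamStructure X A B f hfA
  let β : sub L B → D := amalgamMap X A B f hfA
  have hβ : Function.Injective β := amalgamMap_injective hfA hf.injOn
  have hrelX : ∀ (n : ℕ) (R : L.Relations n) (y : Fin n → X),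
      Structure.RelMap R (fun i => (Sum.inl (y i) : D)) ↔ Structure.RelMap R fun i => (y i : G) := by
    intro n R y
    refine ⟨?_, fun h => Or.inl ⟨y, rfl, h⟩⟩
    rintro (⟨z, hz, h⟩ | ⟨z, hz, h⟩)
    · obtain rfl : y = z := funext fun i => Sum.inl.inj (congrFun hz i)
      exact h
    · have hz' := fun i => amalgamMap_eq_inl (congrFun hz i).symm
      have := (hf.rel n R (fun i => (z i : N)) fun i => (hz' i).1).2 h
      simpa only [fun i => (hz' i).2] using this
  have hrelB : ∀ (n : ℕ) (R : L.Relations n) (y : Fin n → sub L B),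
      Structure.RelMap R (fun i => β (y i)) ↔ Structure.RelMap R fun i => (y i : N) := by
    intro n R y
    refine ⟨?_, fun h => Or.inr ⟨y, rfl, h⟩⟩
    rintro (⟨z, hz, h⟩ | ⟨z, hz, h⟩)
    · have hz' := fun i => amalgamMap_eq_inl (congrFun hz i)
      refine (hf.rel n R (fun i => (y i : N)) fun i => (hz' i).1).1 ?_
      simpa only [fun i => (hz' i).2] using h
    · obtain rfl : y = z := funext fun i => hβ (congrFun hz i)
      exact h
  have hβiso : PartialIso L β Set.univ := ⟨hβ.injOn, fun n R x _ => hrelB n R x⟩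
  have hXiso : PartialIso L (fun x : sub L X => (Sum.inl x : D)) Set.univ :=
    ⟨Sum.inl_injective.injOn, fun n R x _ => hrelX n R x⟩
  have hage : HasAge 𝓚 G := hG.age
  have huniv : ∀ {N : Type w} [L.Structure N] {B : Set N}, induced L B ∈ 𝓚.K →
      induced L (Set.univ : Set (sub L B)) ∈ 𝓚.K := by
    intro N _ B hB
    have h1 := h𝓚.mem_image (partialIso_val B Set.univ)
    have h2 : (Subtype.val '' (Set.univ : Set (sub L B)) : Set N) = B := by
      simp only [Set.image_univ]; exact Subtype.range_coe
    rw [h2] at h1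
    exact h1.1 hB
  have hA' : 𝓚.Le (β '' {b | (b : N) ∈ A}) (β '' Set.univ) := by
    rw [h𝓚.le_image hβiso (huniv hB) (Set.subset_univ _)]
    have h1 := h𝓚.le_preimage hB hAB.1 subset_rfl
    have h2 : {c : sub L B | (c : N) ∈ B} = Set.univ := Set.eq_univ_of_forall fun c => c.2
    rw [h2] at h1
    exact h1.2 hAB
  have hinter : β '' Set.univ ∩ (fun x : sub L X => (Sum.inl x : D)) '' Set.univ =
      β '' {b | (b : N) ∈ A} := by
    ext z
    constructor
    · rintro ⟨⟨b, -, rfl⟩, x, -, hx⟩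
      exact ⟨b, (amalgamMap_eq_inl hx.symm).1, rfl⟩
    · rintro ⟨b, hb, rfl⟩
      exact ⟨⟨b, trivial, rfl⟩, ⟨f b, hfA ⟨b, hb, rfl⟩⟩, trivial, (amalgamMap_of_mem hb).symm⟩
  have hfull := h𝓚.full ⟨D, inferInstance⟩ _ _ _ (⟨hinter, ?_, ?_⟩)
    ((h𝓚.mem_image hβiso).2 (huniv hB)) ((h𝓚.mem_image hXiso).2 (huniv (hage _ hX.1))) hA'
  rotate_left
  · refine Set.eq_univ_of_forall ?_
    rintro (x | ⟨b, hb, hbA⟩)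
    · exact Or.inr ⟨x, trivial, rfl⟩
    · exact Or.inl ⟨⟨b, hb⟩, trivial, dif_neg hbA⟩
  · rintro n R x (⟨y, rfl, -⟩ | ⟨y, rfl, -⟩) -
    · right
      rintro _ ⟨i, rfl⟩
      exact ⟨y i, trivial, rfl⟩
    · left
      rintro _ ⟨i, rfl⟩
      exact ⟨y i, trivial, rfl⟩
  obtain ⟨hDK, hDs⟩ := hfull
  have hcX : ∀ c : sub L ((fun x : sub L X => (Sum.inl x : D)) '' Set.univ),
      ∃ x : sub L X, (Sum.inl x : D) = c := fun c => let ⟨x, _, hx⟩ := c.2; ⟨x, hx⟩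
  choose r hr using hcX
  let e : sub L ((fun x : sub L X => (Sum.inl x : D)) '' Set.univ) ↪[L] G :=
    ⟨⟨fun c => (r c : G), fun c d hcd =>
      Subtype.ext ((hr c).symm.trans ((congrArg Sum.inl (Subtype.ext hcd)).trans (hr d)))⟩,
      fun f => isEmptyElim f, fun {n} R c =>
        (hrelX n R fun i => r (c i)).symm.trans (Iff.of_eq (congrArg _ (funext fun i => hr (c i))))⟩
  have he : Set.range e = X := by
    ext x
    constructor
    · rintro ⟨c, rfl⟩
      exact (r c).2
    · intro hx
      refine ⟨⟨Sum.inl ⟨x, hx⟩, ⟨x, hx⟩, trivial, rfl⟩, ?_⟩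
      have := hr ⟨Sum.inl ⟨x, hx⟩, ⟨x, hx⟩, trivial, rfl⟩
      exact congrArg Subtype.val (Sum.inl.inj this)
  obtain ⟨g, hg, hge⟩ := hG.extension _ hDK _ hDs e (he.symm ▸ hX)
  have hgX : ∀ x : X, g (Sum.inl x : D) = x := fun x => by
    refine (hge ⟨Sum.inl x, x, trivial, rfl⟩).trans ?_
    have := hr ⟨Sum.inl x, x, trivial, rfl⟩
    exact congrArg Subtype.val (Sum.inl.inj this)
  let g' : N → G := fun b => if h : b ∈ B then g (β ⟨b, h⟩) else f b
  have hg' : ∀ b : sub L B, g' b = g (β b) := fun b => dif_pos b.2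
  have hginj : Function.Injective (fun z : D => g z) := g.injective
  have hgrel : ∀ (n : ℕ) (R : L.Relations n) (z : Fin n → D),
      Structure.RelMap R (fun i => g (z i)) ↔ Structure.RelMap R z := fun n R z => g.map_rel R z
  have hrange : Set.range g = X ∪ g' '' B := by
    ext z
    constructor
    · rintro ⟨x | b, rfl⟩
      · exact Or.inl ((hgX x).symm ▸ x.2)
      · refine Or.inr ⟨b, b.2.1, (hg' ⟨b, b.2.1⟩).trans (congrArg g ?_)⟩
        exact dif_neg b.2.2
    · rintro (hz | ⟨b, hb, rfl⟩)
      · exact ⟨Sum.inl ⟨z, hz⟩, hgX ⟨z, hz⟩⟩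
      · exact ⟨β ⟨b, hb⟩, (hg' ⟨b, hb⟩).symm⟩
  refine ⟨g', ⟨?_, ?_⟩, ?_, ?_, ?_, ?_⟩
  · intro a ha b hb hab
    have h1 := (hg' ⟨a, ha⟩).symm.trans (hab.trans (hg' ⟨b, hb⟩))
    exact congrArg Subtype.val (hβ (hginj h1))
  · intro n R x hx
    have h1 := (hgrel n R fun i => β ⟨x i, hx i⟩).trans (hrelB n R fun i => ⟨x i, hx i⟩)
    simpa only [← hg'] using h1
  · intro a ha
    refine (hg' ⟨a, hAB.1 ha⟩).trans ((congrArg g (amalgamMap_of_mem ha)).trans (hgX _))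
  · rintro z ⟨hz, b, hb, rfl⟩
    have h1 : g (β ⟨b, hb⟩) = g (Sum.inl ⟨g' b, hz⟩ : D) :=
      (hg' ⟨b, hb⟩).symm.trans (hgX ⟨g' b, hz⟩).symm
    obtain ⟨h2, h3⟩ := amalgamMap_eq_inl (hginj h1)
    exact ⟨b, h2, h3⟩
  · intro n R y hy hyr
    rw [← hrange] at hyr
    have h1 : ∀ i, ∃ z : D, g z = y i := fun i => hyr ⟨i, rfl⟩
    choose z hz using h1
    obtain rfl : (fun i => g (z i)) = y := funext hz
    rcases (hgrel n R z).1 hy with ⟨u, rfl, -⟩ | ⟨u, rfl, -⟩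
    · left
      rintro _ ⟨i, rfl⟩
      exact Set.mem_of_eq_of_mem (hgX (u i)) (u i).2
    · right
      rintro _ ⟨i, rfl⟩
      exact ⟨u i, (u i).2, hg' (u i)⟩
  · rw [← hrange]
    exact hg

end FreeExtension

/-! ### Freeness as a first-order property, and its transfer from the generic to its theory. -/

section Transfer

variable {L : FirstOrder.Language.{0, 0}} [L.IsRelational] {𝓚 : StrongClass.{w} L}

/-- The tuple `x`, whose entries with index in `q` lie in `P`, is free over the part of the closure
of `P` that is witnessed by sets of size `s`, and adds nothing to it but its own entries. -/
structure FreeOver (𝓚 : StrongClass.{w} L) {N : Type w} [L.Structure N] {n : ℕ} (P : Set N)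
    (q : Set (Fin n)) (x : Fin n → N) (s : ℕ) : Prop where
  disjoint : ∀ i, i ∉ q → x i ∉ cls 𝓚 P s
  edge : ∀ (R : Σ m, L.Relations m) (y : Fin R.1 → N), Structure.RelMap R.2 y →
    (∀ i, y i ∈ cls 𝓚 P s ∨ ∃ j, y i = x j) →
      (∀ i, ∃ j, y i = x j) ∨ ∀ i j, j ∉ q → y i ≠ x j
  cls_subset : ∀ b ∈ cls 𝓚 (P ∪ Set.range x) s, (∃ j, b = x j) ∨ b ∈ cls 𝓚 P (s + n)

variable (h𝓚 : 𝓚.IsFullAmalgamationClass)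
include h𝓚

theorem FreeOver.fo [Finite (Σ n, L.Relations n)] {n : ℕ} (q : Set (Fin n)) (s : ℕ)
    {π : Type u₁} [Finite π] {β : Type u₂} (p : π → β) (x : Fin n → β) :
    FO L β (fun (_ : Type w) _ v =>
      FreeOver 𝓚 (Set.range fun a => v (p a)) q (fun i => v (x i)) s) := by
  have h1 : FO L β (fun (N : Type w) _ v =>
      ∀ i : {i // i ∉ q}, ¬ v (x i) ∈ cls 𝓚 (Set.range fun a => v (p a)) s) :=
    FO.all_fin fun i => (FO.cls h𝓚 s β (x i) p).not
  have h2 : FO L β (fun (N : Type w) _ v => ∀ R : (Σ m, L.Relations m), ∀ y : Fin R.1 → N,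
      Structure.RelMap R.2 y →
      (∀ i, y i ∈ cls 𝓚 (Set.range fun a => v (p a)) s ∨ ∃ j, y i = v (x j)) →
        (∀ i, ∃ j, y i = v (x j)) ∨ ∀ i, ∀ j : {j // j ∉ q}, ¬ y i = v (x j)) := by
    refine FO.all_fin fun R => ((FO.imp (FO.rel R.2 Sum.inr) (FO.imp (FO.all_fin fun i =>
      FO.or (FO.cls h𝓚 s _ (Sum.inr i) fun a => Sum.inl (p a))
        (FO.ex_fin fun j => FO.eq (Sum.inr i) (Sum.inl (x j)))) (FO.or (FO.all_fin fun i =>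
          FO.ex_fin fun j => FO.eq (Sum.inr i) (Sum.inl (x j))) (FO.all_fin fun i =>
          FO.all_fin fun j : {j // j ∉ q} => (FO.eq (Sum.inr i) (Sum.inl (x j))).not))))).all
  have h3 : FO L β (fun (N : Type w) _ v => ∀ b : Unit → N,
      b () ∈ cls 𝓚 (Set.range fun a : π ⊕ Fin n => a.elim (fun a => v (p a)) fun i => v (x i)) s →
      (∃ j, b () = v (x j)) ∨ b () ∈ cls 𝓚 (Set.range fun a => v (p a)) (s + n)) := by
    have := FO.imp (FO.cls h𝓚 s (β ⊕ Unit) (Sum.inr ())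
        fun a : π ⊕ Fin n => Sum.inl (a.elim p x))
      (FO.or (FO.ex_fin fun j => FO.eq (Sum.inr ()) (Sum.inl (x j)))
        (FO.cls h𝓚 (s + n) _ (Sum.inr ()) fun a => Sum.inl (p a)))
    refine this.all.congr fun N _ v => forall_congr' fun b => ?_
    have : (fun a : π ⊕ Fin n => Sum.elim v b (Sum.inl (a.elim p x))) =
        fun a : π ⊕ Fin n => a.elim (fun a => v (p a)) fun i => v (x i) := by
      funext a
      rcases a with a | a <;> rfl
    rw [this]
    rfl
  refine (h1.and (h2.and h3)).congr fun N _ v => ⟨fun h => ⟨fun i hi => h.1 ⟨i, hi⟩, fun R y hR hy =>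
    (h.2.1 R y hR hy).imp id fun h i j hj => h i ⟨j, hj⟩, fun b hb => h.2.2 (fun _ => b) ?_⟩,
    fun h => ⟨fun i => h.1 i i.2, fun R y hR hy => (h.2 R y hR hy).imp id fun h i j => h i j j.2,
      fun b hb => h.3 (b ()) ?_⟩⟩
  · convert hb
    exact Set.Sum.elim_range _ _
  · convert hb
    exact (Set.Sum.elim_range _ _).symm

/-- In a generic structure, strong extensions can be realized freely. -/
theorem StrongClass.IsGeneric.exists_freeOver {G : Type w} [L.Structure G] (hG : 𝓚.IsGeneric G)
    {N : Type w} [L.Structure N] {n : ℕ} {β : Fin n → N} (hβ : Function.Injective β)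
    (hB : induced L (Set.range β) ∈ 𝓚.K) {q : Set (Fin n)} (hq : 𝓚.Le (β '' q) (Set.range β))
    {f : N → G} (hf : PartialIso L f (β '' q)) {P : Set G} (hP : P.Finite)
    (hfP : ∀ i ∈ q, f (β i) ∈ P) :
    ∃ x : Fin n → G, AtomEq L β x ∧ (∀ i ∈ q, x i = f (β i)) ∧
      ∀ P' ⊆ P, (∀ i ∈ q, f (β i) ∈ P') → ∀ s, FreeOver 𝓚 P' q x s := by
  have hage : HasAge 𝓚 G := hG.age
  -- Amalgamating over the finite strong set cl(P) makes one and the same tuple free over every P' ⊆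
  -- P and for every bound; the compactness argument needs this uniformity.
  have hXs := (closed_cl (𝓚 := 𝓚) P).finStrong h𝓚 hage (hG.finite_cl P hP)
  set X := 𝓚.cl P with hX
  have hfX : f '' (β '' q) ⊆ X := by
    rintro _ ⟨_, ⟨i, hi, rfl⟩, rfl⟩
    exact subset_cl P (hfP i hi)
  obtain ⟨g, hg, hgf, hXg, hedge, hD⟩ := hG.exists_amalgam h𝓚 hB hq hf hXs hfX
  set gB := g '' Set.range β with hgB
  have hx : Set.range (fun i => g (β i)) = gB := by rw [hgB, ← Set.range_comp]; rfl
  have hmem : ∀ {y}, (∃ j, y = g (β j)) ↔ y ∈ gB := fun {y} => by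
    rw [← hx]; exact ⟨fun ⟨j, h⟩ => ⟨j, h.symm⟩, fun ⟨j, h⟩ => ⟨j, h.symm⟩⟩
  have hgfin : gB.Finite := (Set.finite_range β).image g
  have hqfin : (f '' (β '' q)).Finite := (q.toFinite.image β).image f
  refine ⟨fun i => g (β i), hg.atomEq, fun i hi => hgf ⟨i, hi, rfl⟩, fun P' hP' hfP' s =>
    ⟨?_, ?_, ?_⟩⟩
  · intro i hi hc
    have hc' : g (β i) ∈ X := cl_mono hP' (cls_subset_cl h𝓚 hage _ _ hc)
    obtain ⟨_, ⟨j, hj, rfl⟩, h⟩ := hXg ⟨hc', β i, ⟨i, rfl⟩, rfl⟩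
    rw [← hgf ⟨j, hj, rfl⟩] at h
    exact hi (hβ (hg.injOn ⟨j, rfl⟩ ⟨i, rfl⟩ h) ▸ hj)
  · intro R y hR hy
    rcases hedge _ R.2 y hR (by
      rintro _ ⟨i, rfl⟩
      exact (hy i).imp (fun h => cl_mono hP' (cls_subset_cl h𝓚 hage _ _ h)) hmem.1) with h | h
    · right
      intro i j hj hij
      have hc' : g (β j) ∈ X := hij ▸ h ⟨i, rfl⟩
      obtain ⟨_, ⟨k, hk, rfl⟩, h⟩ := hXg ⟨hc', β j, ⟨j, rfl⟩, rfl⟩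
      rw [← hgf ⟨k, hk, rfl⟩] at h
      exact hj (hβ (hg.injOn ⟨k, rfl⟩ ⟨j, rfl⟩ h) ▸ hk)
    · left
      exact fun i => hmem.2 (h ⟨i, rfl⟩)
  · intro b hb
    rw [hx] at hb
    rw [hmem, or_iff_not_imp_left]
    intro hbB
    have hDc := hD.closed h𝓚 hage
    obtain ⟨Y, hYfin, hYK, hYs, hbY, hY⟩ := hb
    have hPD : P' ∪ gB ⊆ X ∪ gB := Set.union_subset_union_left _ (hP'.trans (subset_cl P))
    have hbX : b ∈ X := (((hY ((X ∪ gB) ∩ Y) Set.inter_subset_right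
      (Set.inter_subset_inter_left _ hPD) (hDc.inter_le h𝓚 hage hYfin)).1).resolve_right hbB)
    have hY₁fin : ((Y ∩ X) ∪ f '' (β '' q)).Finite := (hYfin.subset Set.inter_subset_left).union hqfin
    have hqB : f '' (β '' q) ⊆ gB := by
      rintro _ ⟨_, ⟨i, hi, rfl⟩, rfl⟩
      exact ⟨β i, ⟨i, rfl⟩, hgf ⟨i, hi, rfl⟩⟩
    have hqP : f '' (β '' q) ⊆ P' := by
      rintro _ ⟨_, ⟨i, hi, rfl⟩, rfl⟩
      exact hfP' i hi
    have hY₁X : (Y ∩ X) ∪ f '' (β '' q) ⊆ X := Set.union_subset Set.inter_subset_right hfX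
    -- The new witness drops the points outside X and adds the base of the extension. The base has
    -- at most `n` points, hence the bound `s + n`.
    refine ⟨(Y ∩ X) ∪ f '' (β '' q), hY₁fin, hage _ hY₁fin, ?_, Or.inl ⟨hbY, hbX⟩, ?_⟩
    · refine (Set.ncard_union_le _ _).trans (add_le_add ((Set.ncard_le_ncard
        Set.inter_subset_left hYfin).trans hYs) ?_)
      refine (Set.ncard_image_le (q.toFinite.image β)).trans ((Set.ncard_image_le q.toFinite).trans ?_)
      simpa using Set.ncard_le_ncard (Set.subset_univ q)
    · intro Y' hY' hPY' hle
      have hqY' : f '' (β '' q) ⊆ Y' := fun z hz => hPY' ⟨hqP hz, Or.inr hz⟩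
      -- By fullness, Y' strong in the new witness makes Y' ∪ gB strong in the witness enlarged by
      -- gB. Cutting down to (X ∪ gB) ∩ Y, which is strong in Y, gives a strong subset of Y that
      -- contains (P' ∪ gB) ∩ Y. It therefore contains `b`, and since `b` is not in gB, it lies in
      -- Y'.
      have hfree : IsFreeAmalgam L Y' ((Y ∩ X) ∪ f '' (β '' q)) (Y' ∪ gB)
          (((Y ∩ X) ∪ f '' (β '' q)) ∪ gB) := by
        refine ⟨?_, ?_, ?_⟩
        · ext z
          constructor
          · rintro ⟨h1, h2 | h2⟩
            · exact h2
            · exact hqY' (hXg ⟨hY₁X h1, h2⟩)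
          · exact fun h => ⟨hY' h, Or.inl h⟩
        · rw [← Set.union_assoc, Set.union_eq_left.2 hY']
        · intro m R y hR hy
          rcases hedge m R y hR (hy.trans (Set.union_subset_union_left _ hY₁X)) with h | h
          · left
            intro z hz
            exact (hy hz).elim id fun h' => Or.inr (hXg ⟨h hz, h'⟩)
          · exact Or.inr (h.trans Set.subset_union_right)
      have hle2 := (h𝓚.le_full (hage _ hY₁fin) (hage _ ((hY₁fin.subset hY').union hgfin)) hfree
        hle).2
      have hDY := hDc.inter_le h𝓚 hage hYfin
      have hsub : (X ∪ gB) ∩ Y ⊆ ((Y ∩ X) ∪ f '' (β '' q)) ∪ gB := by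
        rintro z ⟨h1 | h1, h2⟩
        · exact Or.inl (Or.inl ⟨h2, h1⟩)
        · exact Or.inr h1
      have hle3 := h𝓚.le_trans hYK (h𝓚.le_inter (hage _ (hY₁fin.union hgfin)) hle2 hsub) hDY
      have hb' := hY _ hle3.1 ?_ hle3
      · exact hb'.1.resolve_right hbB
      · rintro z ⟨hz | hz, hzY⟩
        · have hzX := subset_cl (𝓚 := 𝓚) P (hP' hz)
          exact ⟨Or.inl (hPY' ⟨hz, Or.inl ⟨hzY, hzX⟩⟩), Or.inl hzX, hzY⟩
        · exact ⟨Or.inr hz, Or.inr hz, hzY⟩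

variable [Finite (Σ n, L.Relations n)] {G : Type w} [L.Structure G] {C : Type w} [L.Structure C]

theorem hasAge_of_model (hG : 𝓚.IsGeneric G) (hC : C ⊨ L.completeTheory G) : HasAge 𝓚 C := by
  intro A hA
  have := hA.fintype
  have e := (Fintype.equivFin A).symm
  have h1 : FO L Empty (fun (N : Type w) _ v => ∀ x : Fin (Fintype.card A) → N,
      induced L (Set.range fun i => x i) ∈ 𝓚.K) :=
    ((FO.mem_range h𝓚).relabel Sum.inr).all
  have h2 := (fo_of_model hC h1).2 (fun x => hG.age _ (Set.finite_range _)) fun i => e i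
  convert h2
  ext z
  constructor
  · intro hz
    exact ⟨e.symm ⟨z, hz⟩, by simp⟩
  · rintro ⟨i, rfl⟩
    exact (e i).2

/-- For fixed sizes and a bound `s`, the existence of free realizations in `G` is a single sentence.
The finitely many subsets `π'` of the parameter indices take the place of the sets P', and only
bounds below `s` can be mentioned. -/
theorem exists_freeOver_of_model [Nonempty G] (hG : 𝓚.IsGeneric G) (hC : C ⊨ L.completeTheory G)
    {n : ℕ} {β : Fin n → C} (hβ : Function.Injective β) {q : Set (Fin n)}
    (hq : 𝓚.Le (β '' q) (Set.range β)) {π : Type u₁} [Finite π] (p : π → C) (ι : q → π)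
    (hι : ∀ i, p (ι i) = β i) (s : ℕ) :
    ∃ x : Fin n → C, AtomEq L β x ∧ (∀ i : q, x i = β i) ∧
      ∀ (π' : Set π), (∀ i, ι i ∈ π') → ∀ s' : Fin s, FreeOver 𝓚 (Set.range fun a : π' => p a) q x s' := by
  have hage := hasAge_of_model h𝓚 hG hC
  have h1 : FO L Empty (fun (N : Type w) _ v => ∀ r : π → N, AtomEq L (fun i : q => β i) (fun i : q => r (ι i)) →
      ∃ x : Fin n → N, AtomEq L β (fun i => x i) ∧ (∀ i : q, x i = r (ι i)) ∧
        ∀ π' : {π' : Set π // ∀ i, ι i ∈ π'}, ∀ s' : Fin s,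
          FreeOver 𝓚 (Set.range fun a : π'.1 => r a) q (fun i => x i) s') := by
    have hat : ∀ {γ : Type} [Finite γ] (b : γ → C), FO L γ (fun (N : Type w) _ v => AtomEq L b v) :=
      fun b => FO.of_atomEq fun N N' _ _ v v' h h' =>
        ⟨fun i j => (h'.eq i j).trans (h.eq i j), fun n R t => (h'.rel n R t).trans (h.rel n R t)⟩
    refine (FO.imp ((hat fun i : q => β i).relabel fun i => Sum.inr (ι i)) (FO.and
      ((hat β).relabel fun i => Sum.inr i) (FO.and (FO.all_fin fun i : q =>
        FO.eq (Sum.inr (i : Fin n)) (Sum.inl (Sum.inr (ι i)))) (FO.all_fin fun π' : {π' : Set π // ∀ i, ι i ∈ π'} =>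
        FO.all_fin fun s' : Fin s =>
          FreeOver.fo h𝓚 q s' (fun a : π'.1 => Sum.inl (Sum.inr a.1)) Sum.inr))).ex).all
  have h2 := (fo_of_model hC h1).2 (fun r hr => ?_) p ?_
  · obtain ⟨x, hx1, hx2, hx3⟩ := h2
    exact ⟨x, hx1, fun i => (hx2 i).trans (hι i), fun π' hπ' s' => hx3 ⟨π', hπ'⟩ s'⟩
  · have hex : ∃ f : C → G, PartialIso L f (β '' q) ∧ ∀ i : q, f (β i) = r (ι i) := by
      by_cases hne : Nonempty q
      · obtain ⟨f, hf, hfv⟩ := hr.exists_partialIso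
        refine ⟨f, ?_, hfv⟩
        rwa [Set.image_eq_range]
      · have hqe : q = ∅ := Set.not_nonempty_iff_eq_empty.1 fun ⟨i, hi⟩ => hne ⟨i, hi⟩
        refine ⟨fun _ => Classical.arbitrary G, ⟨?_, ?_⟩, fun i => absurd ⟨i⟩ hne⟩
        · rw [hqe, Set.image_empty]
          exact Set.injOn_empty _
        · intro m R x hx
          -- Over an empty base only nullary relations are left to compare; these agree by the
          -- atomic equality of the empty tuples.
          rcases m with - | m
          · have := hr.rel 0 R (fun i => i.elim0)
            convert this.symm using 2
          · rw [hqe, Set.image_empty] at hx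
            exact (hx 0).elim
    obtain ⟨f, hf, hfr⟩ := hex
    obtain ⟨x, hx1, hx2, hx3⟩ := hG.exists_freeOver h𝓚 hβ (hage _ (Set.finite_range β)) hq hf
      (Set.finite_range r) fun i hi => ⟨ι ⟨i, hi⟩, (hfr ⟨i, hi⟩).symm⟩
    refine ⟨x, hx1, fun i => (hx2 i i.2).trans (hfr i), fun π' s' => hx3 _ ?_ ?_ s'⟩
    · rintro _ ⟨a, rfl⟩
      exact ⟨a, rfl⟩
    · exact fun i hi => ⟨⟨ι ⟨i, hi⟩, π'.2 _⟩, (hfr ⟨i, hi⟩).symm⟩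
  · simp only [hι]
    exact ⟨fun i j => Iff.rfl, fun n R t => Iff.rfl⟩

end Transfer

/-! ### Free extensions over the closure of a small set. -/

section FreeExtensionInDomain

variable {L : FirstOrder.Language.{0, 0}} [L.IsRelational] {𝓚 : StrongClass.{w} L}
  (h𝓚 : 𝓚.IsFullAmalgamationClass)
include h𝓚

theorem exists_common_cls {N : Type w} [L.Structure N] (hage : HasAge 𝓚 N) (X : Set N) {ι : Type u₁}
    [Finite ι] (y : ι → N) :
    ∃ F ⊆ X, F.Finite ∧ ∃ s, ∀ i, y i ∈ 𝓚.cl X → y i ∈ cls 𝓚 F s := by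
  have h1 : ∀ i, ∃ F ⊆ X, F.Finite ∧ ∃ s, y i ∈ 𝓚.cl X → y i ∈ cls 𝓚 F s := by
    intro i
    by_cases hi : y i ∈ 𝓚.cl X
    · obtain ⟨F, hF, hFX, s, h⟩ := (StrongClass.mem_cl_iff h𝓚 hage).1 hi
      exact ⟨F, hFX, hF, s, fun _ => h⟩
    · exact ⟨∅, Set.empty_subset _, Set.finite_empty, 0, fun h => absurd h hi⟩
  choose F hFX hF s hs using h1
  obtain ⟨m, hm⟩ := (Set.finite_range s).bddAbove
  refine ⟨⋃ i, F i, Set.iUnion_subset hFX, Set.finite_iUnion hF, m, fun i hi => ?_⟩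
  exact StrongClass.cls_mono_left (Set.subset_iUnion F i) m
    (StrongClass.cls_mono_right _ (hm ⟨i, rfl⟩) (hs i hi))

omit h𝓚 in
theorem cl_union_of_subset {N : Type w} [L.Structure N] {X A : Set N} (hA : A ⊆ 𝓚.cl X) :
    𝓚.cl (X ∪ A) = 𝓚.cl X :=
  Set.Subset.antisymm (StrongClass.cl_subset (Set.union_subset (StrongClass.subset_cl X) hA)
    (StrongClass.closed_cl X)) (StrongClass.cl_mono Set.subset_union_left)

variable [Finite (Σ n, L.Relations n)] {G : Type w} [L.Structure G] {C : Type w} [L.Structure C]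

/-- In a universal domain, a strong extension of a finite set in the closure of a small set `M` can be
realized freely over the closure of `M`. -/
theorem exists_free_extension [Nonempty G] (hG : 𝓚.IsGeneric G) {κ : Cardinal.{w}}
    (hC : IsUniversalDomain (L.completeTheory G) κ C) {M : Set C} (hM : #M < κ) {A B : Set C}
    (hB : B.Finite) (hBne : B.Nonempty) (hAB : 𝓚.Le A B) (hA : A ⊆ 𝓚.cl M) :
    ∃ g : C → C, PartialIso L g B ∧ (∀ a ∈ A, g a = a) ∧ 𝓚.cl M ∩ g '' B ⊆ A ∧
      (∀ (n : ℕ) (R : L.Relations n) (y : Fin n → C), Structure.RelMap R y →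
        Set.range y ⊆ 𝓚.cl M ∪ g '' B → Set.range y ⊆ 𝓚.cl M ∨ Set.range y ⊆ g '' B) ∧
      𝓚.cl (M ∪ g '' B) ⊆ 𝓚.cl M ∪ g '' B := by
  classical
  have hage := hasAge_of_model h𝓚 hG hC.model
  have := hB.fintype
  let e := (Fintype.equivFin B).symm
  set n := Fintype.card B
  let β : Fin n → C := fun i => e i
  have hβ : Function.Injective β := Subtype.val_injective.comp e.injective
  have hβB : Set.range β = B := by
    ext z
    constructor
    · rintro ⟨i, rfl⟩
      exact (e i).2
    · intro hz
      exact ⟨e.symm ⟨z, hz⟩, congrArg Subtype.val (e.apply_symm_apply _)⟩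
  let q : Set (Fin n) := {i | β i ∈ A}
  have hqA : β '' q = A := by
    ext z
    constructor
    · rintro ⟨i, hi, rfl⟩
      exact hi
    · intro hz
      obtain ⟨i, rfl⟩ := hβB.symm ▸ hAB.1 hz
      exact ⟨i, hz, rfl⟩
  -- Adjoining A leaves the closure unchanged and allows the conditions to say that the base of the
  -- extension is fixed.
  let W : Set C := M ∪ A
  have hAfin : A.Finite := hB.subset hAB.1
  have hW : #W < κ := (mk_union_le M A).trans_lt
    (add_lt_of_lt hC.aleph0_le hM ((lt_aleph0_iff_set_finite.2 hAfin).trans_le hC.aleph0_le))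
  let a : q → W := fun i => ⟨β i, Or.inr i.2⟩
  -- One condition for each finite parameter set that contains the base and each bound. Finitely
  -- many of them follow from freeness over the union of their parameter sets.
  let τ := {F : Finset W // ∀ i, a i ∈ F} × ℕ
  let P : τ → ∀ (N : Type w) [L.Structure N], (W ⊕ Fin n → N) → Prop := fun t N _ v =>
    AtomEq L β (fun i => v (Sum.inr i)) ∧ (∀ i : q, v (Sum.inr i) = v (Sum.inl (a i))) ∧
      FreeOver 𝓚 (Set.range fun z : t.1.1 => v (Sum.inl z)) q (fun i => v (Sum.inr i)) t.2
  have hP : ∀ t, FO L (W ⊕ Fin n) (P t) := by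
    intro t
    have hat : FO L (Fin n) (fun (N : Type w) _ v => AtomEq L β v) :=
      FO.of_atomEq fun N N' _ _ v v' h h' =>
        ⟨fun i j => (h'.eq i j).trans (h.eq i j), fun n R t => (h'.rel n R t).trans (h.rel n R t)⟩
    exact (hat.relabel Sum.inr).and ((FO.all_fin fun i : q => FO.eq _ _).and
      (FreeOver.fo h𝓚 q t.2 (fun z : t.1.1 => Sum.inl z.1) Sum.inr))
  have : Nonempty C := hBne.to_type
  obtain ⟨x, hx⟩ := hC.exists_forall hW (J := Fin n) (Subtype.val : W → C) hP (by
    intro S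
    let F : Finset W := S.biUnion (fun t => t.1.1) ∪ Finset.univ.image a
    obtain ⟨x, hx1, hx2, hx3⟩ := exists_freeOver_of_model h𝓚 hG hC.model hβ
      (by rw [hqA, hβB]; exact hAB) (fun z : F => (z.1 : C))
      (fun i => ⟨a i, Finset.mem_union_right _ (Finset.mem_image_of_mem a (Finset.mem_univ i))⟩)
      (fun i => rfl) (S.sup (fun t => t.2) + 1)
    refine ⟨x, fun t ht => ⟨hx1, hx2, ?_⟩⟩
    have h := hx3 {z | z.1 ∈ t.1.1} (fun i => t.1.2 i)
      ⟨t.2, Nat.lt_succ_of_le (Finset.le_sup (f := fun t : τ => t.2) ht)⟩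
    convert h using 1
    · ext z
      constructor
      · rintro ⟨y, rfl⟩
        exact ⟨⟨⟨y, Finset.mem_union_left _ (Finset.mem_biUnion.2 ⟨t, ht, y.2⟩)⟩, y.2⟩, rfl⟩
      · rintro ⟨y, rfl⟩
        exact ⟨⟨y.1, y.2⟩, rfl⟩
    · rfl)
  have : Nonempty (Fin n) := by
    obtain ⟨b, hb⟩ := hBne
    exact ⟨e.symm ⟨b, hb⟩⟩
  have hFree : ∀ F ⊆ W, F.Finite → ∀ s, ∃ F', F ⊆ F' ∧ F' ⊆ W ∧ FreeOver 𝓚 F' q x s := by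
    intro F hFW hF s
    have hfin : (F ∪ A).Finite := hF.union hAfin
    let F₀ : Finset W := (hfin.preimage (f := (Subtype.val : W → C))
      Subtype.val_injective.injOn).toFinset
    have h := (hx ⟨⟨F₀, fun i => (Set.Finite.mem_toFinset _).2 (Or.inr i.2)⟩, s⟩).2.2
    refine ⟨_, ?_, ?_, h⟩
    · intro z hz
      exact ⟨⟨⟨z, hFW hz⟩, (Set.Finite.mem_toFinset _).2 (Or.inl hz)⟩, rfl⟩
    · rintro _ ⟨y, rfl⟩
      exact y.1.2
  obtain ⟨hx1, hx2, -⟩ := hx ⟨⟨Finset.univ.image a, fun i =>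
    Finset.mem_image_of_mem a (Finset.mem_univ i)⟩, 0⟩
  have hclW : 𝓚.cl W = 𝓚.cl M := cl_union_of_subset hA
  obtain ⟨g, hg, hgx⟩ := hx1.exists_partialIso
  rw [hβB] at hg
  have hgB : g '' B = Set.range x := by
    rw [← hβB, ← Set.range_comp]
    exact congrArg Set.range (funext hgx)
  refine ⟨g, hg, ?_⟩
  rw [hgB, ← hclW]
  refine ⟨?_, ?_, ?_, ?_⟩
  · intro z hz
    obtain ⟨i, hi, rfl⟩ := hqA.symm ▸ hz
    exact (hgx i).trans (hx2 ⟨i, hi⟩)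
  · rintro _ ⟨hz, i, rfl⟩
    by_cases hi : i ∈ q
    · have : x i = β i := hx2 ⟨i, hi⟩
      rw [this]
      exact hi
    · obtain ⟨F, hFW, hF, s, hs⟩ := exists_common_cls h𝓚 hage W (fun _ : Unit => x i)
      obtain ⟨F', hFF', -, h⟩ := hFree F hFW hF s
      exact absurd (StrongClass.cls_mono_left hFF' s (hs () hz)) (h.disjoint i hi)
  · intro m R y hR hy
    obtain ⟨F, hFW, hF, s, hs⟩ := exists_common_cls h𝓚 hage W y
    obtain ⟨F', hFF', hF'W, h⟩ := hFree F hFW hF s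
    rcases h.edge ⟨m, R⟩ y hR (fun i => (hy ⟨i, rfl⟩).imp
      (fun h' => StrongClass.cls_mono_left hFF' s (hs i h')) fun ⟨j, hj⟩ => ⟨j, hj.symm⟩) with h1 | h1
    · right
      rintro _ ⟨i, rfl⟩
      obtain ⟨j, hj⟩ := h1 i
      exact ⟨j, hj.symm⟩
    · left
      rintro _ ⟨i, rfl⟩
      rcases hy ⟨i, rfl⟩ with h2 | ⟨j, hj⟩
      · exact h2
      · by_cases hjq : j ∈ q
        · have h3 : x j = β j := hx2 ⟨j, hjq⟩
          rw [← hj, h3]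
          exact StrongClass.subset_cl W (Or.inr hjq)
        · exact absurd hj.symm (h1 i j hjq)
  · intro b hb
    have hb' : b ∈ 𝓚.cl (W ∪ Set.range x) :=
      StrongClass.cl_mono (Set.union_subset_union_left _ Set.subset_union_left) hb
    obtain ⟨F, hFW, hF, s, hs⟩ := exists_common_cls h𝓚 hage (W ∪ Set.range x) (fun _ : Unit => b)
    obtain ⟨F', hFF', hF'W, h⟩ := hFree (F ∩ W) Set.inter_subset_right
      (hF.subset Set.inter_subset_left) s
    have hsub : F ⊆ F' ∪ Set.range x := fun z hz =>
      (hFW hz).elim (fun h => Or.inl (hFF' ⟨hz, h⟩)) Or.inr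
    rcases h.cls_subset b (StrongClass.cls_mono_left hsub s (hs () hb')) with ⟨j, hj⟩ | h1
    · exact Or.inr ⟨j, hj.symm⟩
    · exact Or.inl (StrongClass.cl_mono hF'W (StrongClass.cls_subset_cl h𝓚 hage _ _ h1))

end FreeExtensionInDomain

/-! ### Neumann's lemma on infinite orbits. -/

section Orbits

/-- If every element of the group moved some `ω i` into E, finitely many left cosets of stabilizers
would cover the group. By B. H. Neumann's lemma one stabilizer would have finite index, so its orbit
would be finite. -/
theorem exists_forall_notMem_of_infinite_orbit {X : Type u₁} (H : Subgroup (Equiv.Perm X)) {n : ℕ}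
    (ω : Fin n → X) (hω : ∀ i, (MulAction.orbit H (ω i)).Infinite) {E : Set X} (hE : E.Finite) :
    ∃ h ∈ H, ∀ i, h (ω i) ∉ E := by
  classical
  by_contra hcon
  push Not at hcon
  let s : Finset (Fin n × X) := Finset.univ ×ˢ hE.toFinset
  -- A coset representative for each pair; where `p.2` is not in the orbit of `ω p.1`, the default
  -- `1` only adds a superfluous coset.
  have hg : ∀ p : Fin n × X, ∃ g : H, (∃ h : H, h • ω p.1 = p.2) → g • ω p.1 = p.2 := by
    intro p
    by_cases hp : ∃ h : H, h • ω p.1 = p.2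
    · exact ⟨hp.choose, fun _ => hp.choose_spec⟩
    · exact ⟨1, fun h => absurd h hp⟩
  choose g hg using hg
  obtain ⟨p, -, hp⟩ := Subgroup.exists_finiteIndex_of_leftCoset_cover (s := s) (g := g)
    (H := fun p => MulAction.stabilizer H (ω p.1)) (by
      refine Set.eq_univ_of_forall fun h => ?_
      obtain ⟨i, hi⟩ := hcon h h.2
      refine Set.mem_iUnion₂.2 ⟨(i, h.1 (ω i)), by simp [s, hi], ?_⟩
      rw [mem_leftCoset_iff, SetLike.mem_coe, MulAction.mem_stabilizer_iff, mul_smul,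
        inv_smul_eq_iff]
      exact (hg (i, h.1 (ω i)) ⟨h, rfl⟩).symm)
  have h1 := MulAction.index_stabilizer H (ω p.1)
  exact hp.index_ne_zero (h1.trans (hω p.1).ncard)

end Orbits

/-! ### Automorphisms over a set, and algebraicity. -/

section Automorphisms

variable {L : FirstOrder.Language.{0, 0}} {C : Type w} [L.Structure C]

/-- The automorphisms of `C` that fix `A` pointwise, as permutations. -/
def autFix (L : FirstOrder.Language.{0, 0}) {C : Type w} [L.Structure C] (A : Set C) :
    Subgroup (Equiv.Perm C) where
  carrier := {σ | (∀ (n : ℕ) (R : L.Relations n) (x : Fin n → C),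
    Structure.RelMap R (fun i => σ (x i)) ↔ Structure.RelMap R x) ∧ ∀ a ∈ A, σ a = a}
  one_mem' := ⟨fun _ _ _ => Iff.rfl, fun _ _ => rfl⟩
  mul_mem' := fun {σ τ} hσ hτ => ⟨fun n R x => (hσ.1 n R fun i => τ (x i)).trans (hτ.1 n R x),
    fun a ha => by rw [Equiv.Perm.mul_apply, hτ.2 a ha, hσ.2 a ha]⟩
  inv_mem' := fun {σ} hσ => ⟨fun n R x => by
      have h : (fun i => σ (σ⁻¹ (x i))) = x := funext fun i => σ.apply_symm_apply (x i)
      have := hσ.1 n R fun i => σ⁻¹ (x i)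
      rw [h] at this
      exact this.symm, fun a ha => by rw [Equiv.Perm.inv_eq_iff_eq, hσ.2 a ha]⟩

theorem autFix_anti {A A' : Set C} (h : A ⊆ A') : autFix L A' ≤ autFix L A :=
  fun _ hσ => ⟨hσ.1, fun a ha => hσ.2 a (h ha)⟩

theorem partialIso_of_mem_autFix {A : Set C} {σ : Equiv.Perm C} (hσ : σ ∈ autFix L A) (B : Set C) :
    PartialIso L σ B :=
  ⟨σ.injective.injOn, fun n R x _ => hσ.1 n R x⟩

variable [L.IsRelational]

/-- A permutation that preserves the relations, as an automorphism. -/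
def toEquivOfMem {A : Set C} {σ : Equiv.Perm C} (hσ : σ ∈ autFix L A) : C ≃[L] C where
  toEquiv := σ
  map_fun' f := isEmptyElim f
  map_rel' R x := hσ.1 _ R x

theorem tpEq_of_mem_autFix {A : Set C} {σ : Equiv.Perm C} (hσ : σ ∈ autFix L A) {I : Type u₁}
    (a : I → C) : TpEq L a fun i => σ (a i) :=
  tpEq_equiv (toEquivOfMem hσ) a

omit [L.IsRelational] in
theorem IsUniversalDomain.exists_mem_autFix {T : L.Theory} {κ : Cardinal.{w}}
    (hC : IsUniversalDomain T κ C) {A : Set C} (hA : #A < κ) {n : ℕ} {x y : Fin n → C}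
    (h : TpEq L (Sum.elim (Subtype.val : A → C) x) (Sum.elim (Subtype.val : A → C) y)) :
    ∃ σ ∈ autFix L A, ∀ i, σ (x i) = y i := by
  obtain ⟨σ, hσ⟩ := hC.exists_equiv (I := A ⊕ Fin n) (by
    rw [mk_sum]
    simp only [mk_fin, lift_natCast, lift_uzero]
    exact add_lt_of_lt hC.aleph0_le hA (natCast_lt_aleph0.trans_le hC.aleph0_le)) h
  exact ⟨σ.toEquiv, ⟨fun n R x => σ.map_rel R x, fun a ha => hσ (Sum.inl ⟨a, ha⟩)⟩,
    fun i => hσ (Sum.inr i)⟩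

/-- A finite tuple of points none of which is algebraic over `A` has a conjugate over `A` that avoids
a given small set. -/
theorem IsUniversalDomain.exists_autFix_notMem [Nonempty C] {T : L.Theory} {κ : Cardinal.{w}}
    (hC : IsUniversalDomain T κ C) {A N : Set C} (hA : #A < κ) (hN : #N < κ) {n : ℕ} (ω : Fin n → C)
    (hω : ∀ i, ∀ A₀ ⊆ A, A₀.Finite → (MulAction.orbit (autFix L A₀) (ω i)).Infinite) :
    ∃ σ ∈ autFix L A, ∀ i, σ (ω i) ∉ N := by
  classical
  let τ := {φ : L.Formula (A ⊕ Fin n) // φ.Realize (Sum.elim Subtype.val ω)} ⊕ (N × Fin n)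
  let P : τ → ∀ (K : Type w) [L.Structure K], (↑(A ∪ N) ⊕ Fin n → K) → Prop := fun t K _ v =>
    t.elim (fun φ => φ.1.Realize fun i => v (Sum.map (fun a : A => (⟨a, Or.inl a.2⟩ : ↑(A ∪ N))) id i))
      fun p => ¬ v (Sum.inr p.2) = v (Sum.inl ⟨p.1, Or.inr p.1.2⟩)
  have hP : ∀ t, FO L _ (P t) := by
    rintro (φ | p)
    · exact FO.relabel (P := fun K _ v => φ.1.Realize v) ⟨φ.1, fun _ _ _ => Iff.rfl⟩ _
    · exact (FO.eq _ _).not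
  obtain ⟨x, hx⟩ := hC.exists_forall ((mk_union_le A N).trans_lt
    (add_lt_of_lt hC.aleph0_le hA hN)) (J := Fin n) (Subtype.val : ↑(A ∪ N) → C) hP (by
    intro S
    -- The points of A that occur in the finitely many formulas at hand. Only these have to be
    -- fixed, so infinite orbits over finite subsets of A suffice.
    let A₀ : Set C := ⋃ t ∈ S, t.elim (fun φ => {a : C | ∃ h : a ∈ A, (Sum.inl ⟨a, h⟩ : A ⊕ Fin n) ∈
      φ.1.freeVarFinset}) fun _ => ∅
    have hA₀ : A₀.Finite := by
      refine S.finite_toSet.biUnion fun t _ => ?_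
      rcases t with φ | p
      · refine (((φ.1.freeVarFinset : Set (A ⊕ Fin n)).toFinite.preimage
          (f := Sum.inl) Sum.inl_injective.injOn).image Subtype.val).subset ?_
        rintro a ⟨h, ha⟩
        exact ⟨⟨a, h⟩, ha, rfl⟩
      · exact Set.finite_empty
    have hA₀A : A₀ ⊆ A := by
      refine Set.iUnion₂_subset fun t _ => ?_
      rcases t with φ | p
      · rintro a ⟨h, -⟩
        exact h
      · exact Set.empty_subset _
    let E : Set C := ⋃ t ∈ S, t.elim (fun _ => ∅) fun p => {(p.1 : C)}
    have hE : E.Finite := by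
      refine S.finite_toSet.biUnion fun t _ => ?_
      rcases t with φ | p
      · exact Set.finite_empty
      · exact Set.finite_singleton _
    obtain ⟨σ, hσ, hσE⟩ := exists_forall_notMem_of_infinite_orbit (autFix L A₀) ω
      (fun i => hω i A₀ hA₀A hA₀) hE
    refine ⟨fun i => σ (ω i), fun t ht => ?_⟩
    rcases t with φ | p
    · have h1 := (tpEq_of_mem_autFix hσ _ φ.1).1 φ.2
      refine (BoundedFormula.realize_restrictFreeVar (φ := φ.1) (f := id)
        (v := fun i => σ (Sum.elim Subtype.val ω i.1)) _ ?_).1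
        ((BoundedFormula.realize_restrictFreeVar (φ := φ.1) (f := id) _ fun _ => rfl).2 h1)
      rintro ⟨a | i, hi⟩
      · exact hσ.2 a (Set.mem_iUnion₂.2 ⟨_, ht, a.2, hi⟩)
      · rfl
    · intro h
      exact hσE p.2 (Set.mem_iUnion₂.2 ⟨_, ht, h⟩))
  obtain ⟨σ, hσ, hσx⟩ := hC.exists_mem_autFix hA (x := ω) (y := x) (by
    have key : ∀ φ : L.Formula (A ⊕ Fin n), φ.Realize (Sum.elim Subtype.val ω) →
        φ.Realize (Sum.elim Subtype.val x) := fun φ hφ => by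
      have : φ.Realize fun i => Sum.elim (Subtype.val : ↑(A ∪ N) → C) x
        (Sum.map (fun a : A => (⟨a, Or.inl a.2⟩ : ↑(A ∪ N))) id i) := hx (Sum.inl ⟨φ, hφ⟩)
      convert this using 1
      funext i
      rcases i with i | i <;> rfl
    exact fun φ => ⟨key φ, fun h => by
      by_contra h2
      exact Formula.realize_not.1 (key φ.not (Formula.realize_not.2 h2)) h⟩)
  refine ⟨σ, hσ, fun i hi => hx (Sum.inr (⟨_, hi⟩, i)) (hσx i).symm⟩

omit [L.IsRelational] in
theorem exists_mem_elementarySubstructure (S : L.ElementarySubstructure C)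
    (φ : L.Formula (S ⊕ Unit)) (c : C) (h : φ.Realize (Sum.elim (fun x : S => (x : C)) fun _ => c)) :
    ∃ d ∈ S, φ.Realize (Sum.elim (fun x : S => (x : C)) fun _ => d) := by
  have h1 : (φ.iExs Unit).Realize (fun x : S => (x : C)) :=
    Formula.realize_iExs.2 ⟨fun _ => c, h⟩
  have h2 := (S.subtype.map_formula (φ.iExs Unit) id).1 h1
  obtain ⟨d, hd⟩ := Formula.realize_iExs.1 h2
  refine ⟨d (), (d ()).2, ?_⟩
  have h3 := (S.subtype.map_formula φ _).2 hd
  convert h3 using 1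
  funext i
  rcases i with i | i <;> rfl

omit [L.IsRelational] in
/-- A point that has finitely many conjugates over a small elementary submodel lies in it. -/
theorem IsUniversalDomain.mem_of_finite_orbit [Nonempty C] {T : L.Theory} {κ : Cardinal.{w}}
    (hC : IsUniversalDomain T κ C) (S : L.ElementarySubstructure C) (hS : #S < κ) {c : C}
    (hc : (MulAction.orbit (autFix L (S : Set C)) c).Finite) : c ∈ S := by
  classical
  -- Otherwise the type of `c` over S together with the statement that x is not in the orbit O is
  -- finitely satisfiable in S: points of O in S are excluded by a formula, the others are avoided
  -- by any point of S. A realization would be a conjugate of `c` outside its own orbit.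
  by_contra hcS
  let O := MulAction.orbit (autFix L (S : Set C)) c
  have hOκ : #O < κ := (lt_aleph0_iff_set_finite.2 hc).trans_le hC.aleph0_le
  let τ := {φ : L.Formula (S ⊕ Unit) // φ.Realize (Sum.elim (fun x : S => (x : C)) fun _ => c)} ⊕ O
  let P : τ → ∀ (K : Type w) [L.Structure K], ((S ⊕ O) ⊕ Unit → K) → Prop := fun t K _ v =>
    t.elim (fun φ => φ.1.Realize fun i => v (i.map Sum.inl id))
      fun p => ¬ v (Sum.inr ()) = v (Sum.inl (Sum.inr p))
  have hP : ∀ t, FO L _ (P t) := by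
    rintro (φ | p)
    · exact FO.relabel (P := fun K _ v => φ.1.Realize v) ⟨φ.1, fun _ _ _ => Iff.rfl⟩ _
    · exact (FO.eq _ _).not
  have hO : O.Finite := hc
  obtain ⟨x, hx⟩ := hC.exists_forall (I := S ⊕ O) (by
      rw [mk_sum, lift_id, lift_id]; exact add_lt_of_lt hC.aleph0_le hS hOκ) (J := Unit)
    (Sum.elim (fun x : S => (x : C)) fun p : O => (p : C)) hP (by
    intro s
    have hfin : Finite {p : O // (p : C) ∈ S} := by
      have : Finite O := hO
      infer_instance
    have hθ : FO L (S ⊕ Unit) (fun K _ v =>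
        (∀ t : s, t.1.elim (fun φ => φ.1.Realize v) fun _ => True) ∧
        ∀ p : {p : O // (p : C) ∈ S}, ¬ v (Sum.inr ()) = v (Sum.inl ⟨p.1, p.2⟩)) := by
      refine FO.and (FO.all_fin ?_) (FO.all_fin fun p => (FO.eq _ _).not)
      rintro ⟨φ | p, -⟩
      · exact ⟨φ.1, fun _ _ _ => Iff.rfl⟩
      · exact FO.const True
    obtain ⟨θ, hθ⟩ := hθ
    obtain ⟨d, hdS, hd⟩ := exists_mem_elementarySubstructure S θ c ((hθ C _).2 ⟨by
      rintro ⟨φ | p, -⟩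
      · exact φ.2
      · trivial, fun p hp => hcS (by
          have : c = p.1 := hp
          exact this ▸ p.2)⟩)
    obtain ⟨h1, h2⟩ := (hθ C _).1 hd
    refine ⟨fun _ => d, fun t ht => ?_⟩
    rcases t with φ | p
    · have h3 : φ.1.Realize (Sum.elim (fun x : S => (x : C)) fun _ => d) := h1 ⟨_, ht⟩
      change φ.1.Realize _
      convert h3 using 1
      funext i
      rcases i with i | i <;> rfl
    · intro h
      have h' : d = p := h
      exact h2 ⟨p, h' ▸ hdS⟩ h)
  obtain ⟨σ, hσ, hσx⟩ := hC.exists_mem_autFix (A := (S : Set C)) hS (x := fun _ : Fin 1 => c)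
    (y := fun _ : Fin 1 => x ()) (by
    have key : ∀ φ : L.Formula (S ⊕ Unit), φ.Realize (Sum.elim (fun x : S => (x : C)) fun _ => c) →
        φ.Realize (Sum.elim (fun x : S => (x : C)) fun _ => x ()) := fun φ hφ => by
      have : φ.Realize fun i => Sum.elim (Sum.elim (fun x : S => (x : C)) fun p : O => (p : C)) x
        (Sum.map Sum.inl id i) := hx (Sum.inl ⟨φ, hφ⟩)
      convert this using 1
      funext i
      rcases i with i | i <;> rfl
    have h : TpEq L (Sum.elim (fun x : S => (x : C)) fun _ : Unit => c)
        (Sum.elim (fun x : S => (x : C)) fun _ => x ()) := fun φ => ⟨key φ, fun h => by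
      by_contra h2
      exact Formula.realize_not.1 (key φ.not (Formula.realize_not.2 h2)) h⟩
    have h2 : ∀ d : C, (fun i : S ⊕ Fin 1 => Sum.elim (fun x : S => (x : C)) (fun _ : Unit => d)
        (Sum.map id (fun _ => ()) i)) = Sum.elim (fun x : S => (x : C)) fun _ => d := fun d =>
      funext fun i => by rcases i with i | i <;> rfl
    have h3 := h.comp (Sum.map id fun _ : Fin 1 => ())
    rw [h2, h2] at h3
    exact h3)
  have hxO : x () ∈ O := ⟨⟨σ, hσ⟩, hσx 0⟩
  exact hx (Sum.inr ⟨_, hxO⟩) rfl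

end Automorphisms

/-! ### Edges and closures under automorphisms. -/

section Edges

variable {L : FirstOrder.Language.{0, 0}} {C : Type w} [L.Structure C]

/-- The set of entries of a tuple of which a relation holds. -/
def IsEdge (L : FirstOrder.Language.{0, 0}) {C : Type w} [L.Structure C] (y : Set C) : Prop :=
  ∃ (n : ℕ) (R : L.Relations n) (x : Fin n → C), Structure.RelMap R x ∧ Set.range x = y

theorem IsEdge.finite {y : Set C} (h : IsEdge L y) : y.Finite := by
  obtain ⟨n, R, x, -, rfl⟩ := h
  exact Set.finite_range x

theorem IsEdge.image {D : Type w} [L.Structure D] {y B : Set C} (h : IsEdge L y) {f : C → D}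
    (hf : PartialIso L f B) (hy : y ⊆ B) : IsEdge L (f '' y) := by
  obtain ⟨n, R, x, hx, rfl⟩ := h
  exact ⟨n, R, fun i => f (x i), (hf.rel n R x fun i => hy ⟨i, rfl⟩).2 hx, Set.range_comp f x⟩

theorem image_image_inv (σ : Equiv.Perm C) (y : Set C) : σ '' ((σ⁻¹ : Equiv.Perm C) '' y) = y := by
  rw [← Set.image_comp]
  exact (Set.image_congr fun a _ => σ.apply_symm_apply a).trans (Set.image_id' y)

theorem inv_image_image (σ : Equiv.Perm C) (y : Set C) : (σ⁻¹ : Equiv.Perm C) '' (σ '' y) = y := by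
  have := image_image_inv σ⁻¹ y
  rwa [inv_inv] at this

theorem isEdge_image_iff {A : Set C} {σ : Equiv.Perm C} (hσ : σ ∈ autFix L A) {y : Set C} :
    IsEdge L (σ '' y) ↔ IsEdge L y := by
  refine ⟨fun h => ?_, fun h => h.image (partialIso_of_mem_autFix hσ y) subset_rfl⟩
  have := h.image (partialIso_of_mem_autFix (inv_mem hσ) _) subset_rfl
  rwa [inv_image_image] at this

theorem image_eq_of_mem_autFix {A B : Set C} {σ : Equiv.Perm C} (hσ : σ ∈ autFix L A) (hB : B ⊆ A) :
    σ '' B = B :=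
  (Set.image_congr fun a ha => hσ.2 a (hB ha)).trans (Set.image_id' B)

theorem infinite_orbit_anti {A A' : Set C} (h : A ⊆ A') {c : C}
    (hc : (MulAction.orbit (autFix L A') c).Infinite) :
    (MulAction.orbit (autFix L A) c).Infinite := by
  refine hc.mono ?_
  rintro _ ⟨σ, rfl⟩
  exact ⟨⟨σ, autFix_anti h σ.2⟩, rfl⟩

variable [L.IsRelational] {𝓚 : StrongClass.{w} L} (h𝓚 : 𝓚.IsFullAmalgamationClass)
include h𝓚

theorem apply_mem_cl {A X : Set C} {σ : Equiv.Perm C} (hσ : σ ∈ autFix L A) {a : C}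
    (ha : a ∈ 𝓚.cl X) : σ a ∈ 𝓚.cl (σ '' X) := by
  have : 𝓚.cl X ⊆ σ ⁻¹' 𝓚.cl (σ '' X) :=
    StrongClass.cl_subset (fun x hx => StrongClass.subset_cl _ ⟨x, hx, rfl⟩) fun P Q hP hPQ =>
      Set.image_subset_iff.1 (StrongClass.closed_cl _ _ _ (Set.image_subset_iff.2 hP)
        (h𝓚.isMinimalPair_image (partialIso_of_mem_autFix hσ Q) hPQ))
  exact this ha

theorem apply_mem_cl_iff {A X : Set C} {σ : Equiv.Perm C} (hσ : σ ∈ autFix L A) {a : C} :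
    σ a ∈ 𝓚.cl (σ '' X) ↔ a ∈ 𝓚.cl X := by
  refine ⟨fun h => ?_, apply_mem_cl h𝓚 hσ⟩
  have h1 := apply_mem_cl h𝓚 (inv_mem hσ) h
  rw [inv_image_image] at h1
  have h2 : σ⁻¹ (σ a) = a := σ.symm_apply_apply a
  rwa [h2] at h1

theorem apply_mem_cl_iff_of_subset {A X : Set C} {σ : Equiv.Perm C} (hσ : σ ∈ autFix L A) (hX : X ⊆ A)
    {a : C} : σ a ∈ 𝓚.cl X ↔ a ∈ 𝓚.cl X := by
  have := apply_mem_cl_iff h𝓚 hσ (X := X) (a := a)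
  rwa [image_eq_of_mem_autFix hσ hX] at this

end Edges

/-! ### Chains of conjugates, and the set Z of points that can be moved into them. -/

section Chains

variable {L : FirstOrder.Language.{0, 0}} [L.IsRelational] {𝓚 : StrongClass.{w} L}
  {C : Type w} [L.Structure C]

/-- A chain of small elementary submodels of `C` such that each point outside the closure of one of
them has a conjugate over it in the next one. -/
structure IsConjChain (𝓚 : StrongClass.{w} L) (κ : Cardinal.{w}) (M : ℕ → L.ElementarySubstructure C) :
    Prop where
  small : ∀ k, #(M k) < κ
  mono : Monotone fun k => (M k : Set C)
  conj : ∀ k, ∀ e ∉ 𝓚.cl (M k : Set C), ∃ σ ∈ autFix L (M k : Set C), σ e ∈ M (k + 1)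

variable {κ : Cardinal.{w}} {M : ℕ → L.ElementarySubstructure C}

/-- The finite set `t` has a conjugate over `M 0` in the union of the chain. -/
def Good (M : ℕ → L.ElementarySubstructure C) (t : Set C) : Prop :=
  ∃ σ ∈ autFix L (M 0 : Set C), ∃ k, σ '' t ⊆ M k

/-- The points that can be added to any good set. -/
def goodAdd (M : ℕ → L.ElementarySubstructure C) : Set C :=
  {z | ∀ t : Set C, t.Finite → Good M t → Good M (insert z t)}

omit [L.IsRelational] in
theorem Good.image {t : Set C} (h : Good M t) {ρ : Equiv.Perm C} (hρ : ρ ∈ autFix L (M 0 : Set C)) :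
    Good M (ρ '' t) := by
  obtain ⟨σ, hσ, k, hk⟩ := h
  refine ⟨σ * ρ⁻¹, mul_mem hσ (inv_mem hρ), k, ?_⟩
  have : ⇑(σ * ρ⁻¹) = σ ∘ (ρ⁻¹ : Equiv.Perm C) := rfl
  rwa [this, Set.image_comp, inv_image_image]

omit [L.IsRelational] in
theorem apply_mem_goodAdd {ρ : Equiv.Perm C} (hρ : ρ ∈ autFix L (M 0 : Set C)) {z : C}
    (hz : z ∈ goodAdd M) : ρ z ∈ goodAdd M := by
  intro t ht h
  have h1 := (hz _ (ht.image _) (h.image (inv_mem hρ))).image hρ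
  rwa [Set.image_insert_eq, image_image_inv] at h1

omit [L.IsRelational] in
theorem apply_mem_goodAdd_iff {ρ : Equiv.Perm C} (hρ : ρ ∈ autFix L (M 0 : Set C)) {z : C} :
    ρ z ∈ goodAdd M ↔ z ∈ goodAdd M := by
  refine ⟨fun h => ?_, apply_mem_goodAdd hρ⟩
  have := apply_mem_goodAdd (inv_mem hρ) h
  have h2 : ρ⁻¹ (ρ z) = z := ρ.symm_apply_apply z
  rwa [h2] at this

omit [L.IsRelational] in
theorem mem_goodAdd_of_mem {z : C} (hz : z ∈ M 0) (hM : Monotone fun k => (M k : Set C)) :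
    z ∈ goodAdd M := by
  rintro t ht ⟨σ, hσ, k, hk⟩
  refine ⟨σ, hσ, k, ?_⟩
  rw [Set.image_insert_eq, hσ.2 z hz]
  exact Set.insert_subset (hM (Nat.zero_le k) hz) hk

omit [L.IsRelational] in
theorem Good.union {t D : Set C} (ht : t.Finite) (hD : D.Finite) (hDz : D ⊆ goodAdd M) (h : Good M t) :
    Good M (D ∪ t) := by
  induction D, hD using Set.Finite.induction_on with
  | empty => rwa [Set.empty_union]
  | @insert a s ha hs ih =>
    rw [Set.insert_union]
    exact hDz (Set.mem_insert _ _) _ (hs.union ht) (ih ((Set.subset_insert _ _).trans hDz))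

omit [L.IsRelational] in
theorem good_of_subset {D : Set C} (hD : D.Finite) (hDz : D ⊆ goodAdd M) : Good M D := by
  have h : Good M (∅ : Set C) := ⟨1, one_mem _, 0, by simp⟩
  have := h.union Set.finite_empty hD hDz
  rwa [Set.union_empty] at this

variable (hM : IsConjChain 𝓚 κ M) {T : L.Theory}
include hM

/-- An automorphism over M 0 that moves D ∪ t into M k turns the finite orbit of `z` over M 0 ∪ D
into a finite orbit over M k, and an elementary submodel contains what is algebraic over it. -/
theorem mem_goodAdd_of_finite_orbit [Nonempty C] (hC : IsUniversalDomain T κ C) {D : Set C} (hD : D.Finite)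
    (hDz : D ⊆ goodAdd M) {z : C} (hz : (MulAction.orbit (autFix L ((M 0 : Set C) ∪ D)) z).Finite) :
    z ∈ goodAdd M := by
  intro t ht h
  obtain ⟨σ, hσ, k, hk⟩ := h.union ht hD hDz
  rw [Set.image_union] at hk
  refine ⟨σ, hσ, k, ?_⟩
  rw [Set.image_insert_eq]
  refine Set.insert_subset ?_ (Set.subset_union_right.trans hk)
  refine hC.mem_of_finite_orbit (M k) (hM.small k) ((hz.image σ).subset ?_)
  rintro _ ⟨ρ, rfl⟩
  have hρ : (ρ : Equiv.Perm C) ∈ autFix L (M k : Set C) := ρ.2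
  refine ⟨(σ⁻¹ * (ρ : Equiv.Perm C) * σ) z, ⟨⟨σ⁻¹ * ρ * σ, ?_, ?_⟩, rfl⟩, ?_⟩
  · exact (mul_mem (mul_mem (inv_mem (autFix_anti (Set.empty_subset _) hσ))
      (autFix_anti (Set.empty_subset _) hρ)) (autFix_anti (Set.empty_subset _) hσ) :
      σ⁻¹ * (ρ : Equiv.Perm C) * σ ∈ autFix L (∅ : Set C)).1
  · intro a ha
    have h1 : σ a ∈ M k := by
      rcases ha with ha | ha
      · rw [hσ.2 a ha]
        exact hM.mono (Nat.zero_le k) ha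
      · exact hk (Or.inl ⟨a, ha, rfl⟩)
    change σ⁻¹ (ρ.1 (σ a)) = a
    rw [hρ.2 _ h1]
    exact σ.symm_apply_apply a
  · exact σ.apply_symm_apply _

variable (h𝓚 : 𝓚.IsFullAmalgamationClass) [Finite (Σ n, L.Relations n)] {G : Type w} [L.Structure G]
  [Nonempty G]
include h𝓚

/-- Induction on |B \ A|. Realize B freely over cl(M k) by `g`, and move a new point e of the edge
into M (k+1). If the edge lies in cl(M k, e), freeness leaves `v` only finitely many conjugates over
M k and e, so its image is algebraic over M (k+1). Otherwise A may be replaced by cl(M k, e) ∩ gB,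
which contains the new point e but not the whole edge. -/
theorem IsConjChain.exists_conj_mem (hG : 𝓚.IsGeneric G)
    (hC : IsUniversalDomain (L.completeTheory G) κ C) (d k : ℕ) {A B y : Set C} {v : C}
    (hB : B.Finite) (hd : (B \ A).ncard ≤ d) (hAB : 𝓚.Le A B) (hA : A ⊆ 𝓚.cl (M k : Set C))
    (hv : v ∈ A) (hy : IsEdge L y) (hyB : y ⊆ B) (hvy : v ∈ y) (hyA : ¬ y ⊆ A) :
    ∃ τ ∈ autFix L (M k : Set C), ∃ m, τ v ∈ M m := by
  have : Nonempty C := ⟨v⟩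
  have hage := hasAge_of_model h𝓚 hG hC.model
  induction d generalizing k A B y v with
  | zero =>
    have h1 : (B \ A) = ∅ := (Set.ncard_eq_zero (hB.subset Set.sdiff_subset)).1 (Nat.le_zero.1 hd)
    exact absurd (hyB.trans (Set.sdiff_eq_empty.1 h1)) hyA
  | succ d ih =>
    obtain ⟨g, hg, hgA, hgcl, hedge, hclg⟩ := exists_free_extension h𝓚 hG hC (hM.small k) hB
      ⟨v, hAB.1 hv⟩ hAB hA
    have hgimA : g '' A = A := (Set.image_congr hgA).trans (Set.image_id' A)
    have hgv : g v = v := hgA v hv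
    obtain ⟨u, huy, huA⟩ := Set.not_subset.1 hyA
    have hguA : g u ∉ A := fun h => huA (by
      have := hg.injOn (hAB.1 h) (hyB huy) (hgA _ h)
      rwa [← this])
    have heB : g u ∈ g '' B := ⟨u, hyB huy, rfl⟩
    have hecl : g u ∉ 𝓚.cl (M k : Set C) := fun h => hguA (hgcl ⟨h, heB⟩)
    obtain ⟨σ, hσ, hσe⟩ := hM.conj k _ hecl
    have hclsub : 𝓚.cl (insert (g u) (M k : Set C)) ⊆ 𝓚.cl (M k : Set C) ∪ g '' B :=
      (StrongClass.cl_mono (Set.insert_subset (Set.mem_union_right _ heB)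
        Set.subset_union_left)).trans hclg
    have hσcl : ∀ a, a ∈ 𝓚.cl (insert (g u) (M k : Set C)) →
        σ a ∈ 𝓚.cl (insert (σ (g u)) (M k : Set C)) := fun a ha => by
      have := apply_mem_cl h𝓚 hσ ha
      rwa [Set.image_insert_eq, image_eq_of_mem_autFix hσ subset_rfl] at this
    have hk1 : autFix L (M (k + 1) : Set C) ≤ autFix L (M k : Set C) :=
      autFix_anti (hM.mono (Nat.le_succ k))
    by_cases hcase : g '' y ⊆ 𝓚.cl (insert (g u) (M k : Set C))
    · refine ⟨σ, hσ, k + 1, hC.mem_of_finite_orbit _ (hM.small _)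
        (((hB.subset hAB.1).image σ).subset ?_)⟩
      rintro _ ⟨ρ, rfl⟩
      have hρ : (ρ : Equiv.Perm C) ∈ autFix L (M (k + 1) : Set C) := ρ.2
      -- Pulling an automorphism over M (k+1) back along σ gives one that fixes M k and e; the
      -- conjugates of σ v are the images under σ of the points π v.
      let π : Equiv.Perm C := σ⁻¹ * ρ * σ
      have hπ : π ∈ autFix L (M k : Set C) := mul_mem (mul_mem (inv_mem hσ) (hk1 hρ)) hσ
      have hπe : π (g u) = g u := by
        change σ⁻¹ (ρ.1 (σ (g u))) = g u
        rw [hρ.2 _ hσe]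
        exact σ.symm_apply_apply _
      refine ⟨π v, ?_, σ.apply_symm_apply _⟩
      have h1 : IsEdge L (π '' (g '' y)) := (isEdge_image_iff hπ).2 (hy.image hg hyB)
      have h2 : π '' (g '' y) ⊆ 𝓚.cl (insert (g u) (M k : Set C)) := by
        rintro _ ⟨a, ha, rfl⟩
        have := apply_mem_cl h𝓚 hπ (hcase ha)
        rwa [Set.image_insert_eq, image_eq_of_mem_autFix hπ subset_rfl, hπe] at this
      have h3 : π v ∈ π '' (g '' y) := ⟨v, ⟨v, hvy, hgv⟩, rfl⟩
      have h4 : g u ∈ π '' (g '' y) := ⟨g u, ⟨u, huy, rfl⟩, hπe⟩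
      have h5 : π v ∈ 𝓚.cl (M k : Set C) := (apply_mem_cl_iff_of_subset h𝓚 hπ subset_rfl).2 (hA hv)
      obtain ⟨n, R, x, hx, hxy⟩ := h1
      -- The moved edge still contains e, which is outside cl(M k), so freeness puts it inside gB.
      -- Then π v lies in cl(M k) ∩ gB, hence in the finite set A.
      rcases hedge n R x hx (by rw [hxy]; exact h2.trans hclsub) with h | h
      · exact absurd (h (hxy ▸ h4)) hecl
      · exact hgcl ⟨h5, h (hxy ▸ h3)⟩
    · let A' := 𝓚.cl (insert (g u) (M k : Set C)) ∩ g '' B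
      have hA' : 𝓚.Le A' (g '' B) := (StrongClass.closed_cl _).inter_le h𝓚 hage (hB.image g)
      have hAA' : A ⊆ A' := fun a ha => ⟨StrongClass.cl_mono (Set.subset_insert _ _) (hA ha),
        a, hAB.1 ha, hgA a ha⟩
      have heA' : g u ∈ A' := ⟨StrongClass.subset_cl _ (Set.mem_insert _ _), heB⟩
      have hcard : (g '' B \ A').ncard ≤ d := by
        have h1 : (g '' B \ A').ncard < (g '' (B \ A)).ncard := by
          refine Set.ncard_lt_ncard ⟨?_, fun h => ?_⟩ ((hB.subset Set.sdiff_subset).image g)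
          · rintro _ ⟨⟨b, hb, rfl⟩, hbA⟩
            exact ⟨b, ⟨hb, fun h => hbA (hAA' (by rwa [hgA b h]))⟩, rfl⟩
          · exact (h ⟨u, ⟨hyB huy, huA⟩, rfl⟩).2 heA'
        have h2 := Set.ncard_image_le (f := g) (hB.subset (Set.sdiff_subset (t := A)))
        omega
      have hσB := partialIso_of_mem_autFix hσ (g '' B)
      obtain ⟨τ, hτ, m, hm⟩ := ih (k + 1) (A := σ '' A') (B := σ '' (g '' B)) (y := σ '' (g '' y))
        (v := σ v) ((hB.image g).image σ) (by
          rw [← Set.image_sdiff σ.injective, Set.ncard_image_of_injective _ σ.injective]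
          exact hcard) ((h𝓚.le_image hσB (hage _ (hB.image g)) hA'.1).2 hA') (by
          rintro _ ⟨a, ha, rfl⟩
          exact StrongClass.cl_mono (Set.insert_subset hσe (hM.mono (Nat.le_succ k))) (hσcl a ha.1))
        ⟨v, hAA' hv, rfl⟩ ((isEdge_image_iff hσ).2 (hy.image hg hyB))
        (Set.image_mono (Set.image_mono hyB)) ⟨v, ⟨v, hvy, hgv⟩, rfl⟩ (fun h => hcase (by
          have := (Set.image_subset_image_iff σ.injective).1 h
          exact this.trans Set.inter_subset_left))
      exact ⟨τ * σ, mul_mem (hk1 hτ) hσ, m, hm⟩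

/-- The automorphism that brings σ v into the chain is taken over M k, so it does not disturb the
conjugate of `t` that already lies there. -/
theorem IsConjChain.mem_goodAdd_of_edge (hG : 𝓚.IsGeneric G)
    (hC : IsUniversalDomain (L.completeTheory G) κ C) {v : C} (hv : v ∈ 𝓚.cl (M 0 : Set C)) {y : Set C}
    (hy : IsEdge L y) (hvy : v ∈ y) (hycl : ¬ y ⊆ 𝓚.cl (M 0 : Set C)) : v ∈ goodAdd M := by
  rintro t ht ⟨σ, hσ, k, hk⟩
  have hage := hasAge_of_model h𝓚 hG hC.model
  have hy' : IsEdge L (σ '' y) := (isEdge_image_iff hσ).2 hy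
  have hcl : ∀ a, σ a ∈ 𝓚.cl (M 0 : Set C) ↔ a ∈ 𝓚.cl (M 0 : Set C) := fun a =>
    apply_mem_cl_iff_of_subset h𝓚 hσ subset_rfl
  obtain ⟨τ, hτ, m, hm⟩ := hM.exists_conj_mem h𝓚 hG hC _ k hy'.finite le_rfl
    ((StrongClass.closed_cl (M 0 : Set C)).inter_le h𝓚 hage hy'.finite)
    (Set.inter_subset_left.trans (StrongClass.cl_mono (hM.mono (Nat.zero_le k))))
    ⟨(hcl v).2 hv, ⟨v, hvy, rfl⟩⟩ hy' subset_rfl ⟨v, hvy, rfl⟩ (fun h => hycl fun a ha =>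
      (hcl a).1 (h ⟨a, ha, rfl⟩).1)
  refine ⟨τ * σ, mul_mem (autFix_anti (hM.mono (Nat.zero_le k)) hτ) hσ, max k m, ?_⟩
  rw [Set.image_insert_eq]
  refine Set.insert_subset (hM.mono (le_max_right k m) hm) ?_
  rintro _ ⟨a, ha, rfl⟩
  have h1 : σ a ∈ M k := hk ⟨a, ha, rfl⟩
  have h2 : (τ * σ) a = σ a := hτ.2 _ h1
  rw [h2]
  exact hM.mono (le_max_left k m) h1

end Chains

/-! ### Components of the edge hypergraph cut along Z. -/

section Reach

variable {L : FirstOrder.Language.{0, 0}} {C : Type w} [L.Structure C]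

/-- `u` is outside `Z` and lies in a common edge with `v`, taken from `𝓔`. -/
def StepIn (Z : Set C) (𝓔 : Set (Set C)) (u v : C) : Prop :=
  u ∉ Z ∧ ∃ y ∈ 𝓔, u ∈ y ∧ v ∈ y

/-- The points that can be reached from `a` along edges, without passing through `Z`. -/
def reach (L : FirstOrder.Language.{0, 0}) {C : Type w} [L.Structure C] (Z : Set C) (a : C) : Set C :=
  {b | Relation.ReflTransGen (StepIn Z {y | IsEdge L y}) a b}

/-- The points outside `Z` that can be reached from `a`. -/
def core (L : FirstOrder.Language.{0, 0}) {C : Type w} [L.Structure C] (Z : Set C) (a : C) : Set C :=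
  reach L Z a \ Z

variable {Z : Set C} {a b c : C}

theorem mem_reach_self : a ∈ reach L Z a := Relation.ReflTransGen.refl

theorem mem_core_self (ha : a ∉ Z) : a ∈ core L Z a := ⟨mem_reach_self, ha⟩

theorem subset_reach_of_isEdge {y : Set C} (hy : IsEdge L y) (hb : b ∈ core L Z a) (hby : b ∈ y) :
    y ⊆ reach L Z a := fun _ hc => hb.1.tail ⟨hb.2, y, hy, hby, hc⟩

theorem reach_trans (hb : b ∈ reach L Z a) : reach L Z b ⊆ reach L Z a := fun _ hc => hb.trans hc

/-- Every step starts outside Z, so a path can be reversed only if its endpoint is outside Z too. -/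
theorem mem_reach_symm (hb : b ∈ core L Z a) : a ∈ reach L Z b := by
  obtain ⟨h1, h2⟩ := hb
  induction h1 with
  | refl => exact mem_reach_self
  | @tail u v huv hstep ih =>
    obtain ⟨hu, y, hy, huy, hvy⟩ := hstep
    exact Relation.ReflTransGen.head ⟨h2, y, hy, hvy, huy⟩ (ih hu)

theorem reach_eq (hb : b ∈ core L Z a) : reach L Z b = reach L Z a :=
  Set.Subset.antisymm (reach_trans hb.1) (reach_trans (mem_reach_symm hb))

theorem core_eq (hb : b ∈ core L Z a) : core L Z b = core L Z a := by
  rw [core, core, reach_eq hb]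

theorem core_eq_or_disjoint (a b : C) :
    core L Z a = core L Z b ∨ Disjoint (core L Z a) (core L Z b) := by
  by_cases h : Disjoint (core L Z a) (core L Z b)
  · exact Or.inr h
  · obtain ⟨x, hxa, hxb⟩ := Set.not_disjoint_iff.1 h
    exact Or.inl ((core_eq hxa).symm.trans (core_eq hxb))

theorem apply_mem_reach {A : Set C} {σ : Equiv.Perm C} (hσ : σ ∈ autFix L A)
    (hZ : ∀ z, σ z ∈ Z ↔ z ∈ Z) (hb : b ∈ reach L Z a) : σ b ∈ reach L Z (σ a) := by
  refine Relation.ReflTransGen.lift (f := σ) ?_ _ _ hb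
  rintro u v ⟨hu, y, hy, huy, hvy⟩
  exact ⟨fun h => hu ((hZ u).1 h), σ '' y, (isEdge_image_iff hσ).2 hy, ⟨u, huy, rfl⟩, v, hvy, rfl⟩

theorem exists_finite_reach {b : C} (hb : b ∈ reach L Z a) :
    ∃ 𝓔 : Set (Set C), 𝓔.Finite ∧ (∀ y ∈ 𝓔, IsEdge L y ∧ y ⊆ reach L Z a) ∧
      Relation.ReflTransGen (StepIn Z 𝓔) a b := by
  induction hb with
  | refl => exact ⟨∅, Set.finite_empty, by simp, Relation.ReflTransGen.refl⟩
  | @tail u v huv hstep ih =>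
    obtain ⟨𝓔, hfin, h𝓔, h⟩ := ih
    obtain ⟨hu, y, hy, huy, hvy⟩ := hstep
    refine ⟨insert y 𝓔, hfin.insert y, ?_, ?_⟩
    · rintro z (rfl | hz)
      · exact ⟨hy, subset_reach_of_isEdge hy ⟨huv, hu⟩ huy⟩
      · exact h𝓔 z hz
    · refine Relation.ReflTransGen.tail (Relation.ReflTransGen.mono ?_ _ _ h) ⟨hu, y, Set.mem_insert _ _, huy, hvy⟩
      rintro p q ⟨hp, z, hz, h⟩
      exact ⟨hp, z, Or.inr hz, h⟩

/-- Only finitely many edges are needed to connect finitely many points, so the paths can be carried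
along by a partial isomorphism of a finite set. -/
theorem exists_finite_reach_set {F : Set C} (hF : F.Finite) (hFa : F ⊆ reach L Z a) :
    ∃ 𝓔 : Set (Set C), 𝓔.Finite ∧ (∀ y ∈ 𝓔, IsEdge L y ∧ y ⊆ reach L Z a) ∧
      ∀ f ∈ F, Relation.ReflTransGen (StepIn Z 𝓔) a f := by
  have h1 : ∀ f : F, ∃ 𝓔 : Set (Set C), 𝓔.Finite ∧ (∀ y ∈ 𝓔, IsEdge L y ∧ y ⊆ reach L Z a) ∧
      Relation.ReflTransGen (StepIn Z 𝓔) a f := fun f => exists_finite_reach (hFa f.2)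
  choose 𝓔 h1 h2 h3 using h1
  have : Finite F := hF
  refine ⟨⋃ f, 𝓔 f, Set.finite_iUnion h1, fun y hy => ?_, fun f hf => Relation.ReflTransGen.mono ?_ _ _ (h3 ⟨f, hf⟩)⟩
  · obtain ⟨f, hf⟩ := Set.mem_iUnion.1 hy
    exact h2 f y hf
  · rintro p q ⟨hp, z, hz, h⟩
    exact ⟨hp, z, Set.mem_iUnion.2 ⟨_, hz⟩, h⟩

variable [L.IsRelational] {𝓚 : StrongClass.{w} L} (h𝓚 : 𝓚.IsFullAmalgamationClass)
include h𝓚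

/-- The complement of the core contains X but not `a`, so some minimal pair (P, Q) leads from it
into the core. Now Q is the free amalgam of its part in the reach and its part outside the core,
over its boundary points. Were the boundary points strong in the former, fullness would make Q \
core strong in Q, and P ≤ Q \ core would give P ≤ Q. -/
theorem exists_isMinimalPair_core (hage : HasAge 𝓚 C) {X : Set C} (hXZ : X ⊆ Z) (ha : a ∈ 𝓚.cl X)
    (haZ : a ∉ Z) : ∃ F B, F ⊆ reach L Z a ∩ Z ∧ 𝓚.IsMinimalPair F B ∧ B \ F ⊆ core L Z a := by
  have hnc : ¬ 𝓚.Closed (core L Z a)ᶜ := fun h =>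
    (StrongClass.cl_subset (X := X) (Y := (core L Z a)ᶜ) (fun x hx hc => hc.2 (hXZ hx)) h ha) (mem_core_self haZ)
  have hnc' : ∃ P Q : Set C, P ⊆ (core L Z a)ᶜ ∧ 𝓚.IsMinimalPair P Q ∧ ¬ Q ⊆ (core L Z a)ᶜ := by
    by_contra h
    push Not at h
    exact hnc fun P Q hP hPQ => h P Q hP hPQ
  obtain ⟨P, Q, hP, hPQ, hQ⟩ := hnc'
  have hnle : ¬ 𝓚.Le (Q ∩ (reach L Z a ∩ Z)) (Q ∩ reach L Z a) := by
    intro hle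
    have hfree : IsFreeAmalgam L (Q ∩ (reach L Z a ∩ Z)) (Q ∩ reach L Z a) (Q ∩ (core L Z a)ᶜ) Q := by
      refine ⟨?_, ?_, fun n R x hR hx => ?_⟩
      · ext z
        simp only [core, Set.mem_inter_iff, Set.mem_compl_iff, Set.mem_sdiff]
        tauto
      · ext z
        simp only [core, Set.mem_union, Set.mem_inter_iff, Set.mem_compl_iff, Set.mem_sdiff]
        tauto
      · by_cases h : ∃ i, x i ∈ core L Z a
        · obtain ⟨i, hi⟩ := h
          exact Or.inl (Set.subset_inter hx (subset_reach_of_isEdge ⟨n, R, x, hR, rfl⟩ hi ⟨i, rfl⟩))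
        · refine Or.inr (Set.subset_inter hx ?_)
          rintro _ ⟨i, rfl⟩ hi
          exact h ⟨i, hi⟩
    have h1 := (h𝓚.le_full (hage _ (hPQ.1.subset Set.inter_subset_left))
      (hage _ (hPQ.1.subset Set.inter_subset_left)) hfree hle).2
    refine hPQ.2.2.2.1 (h𝓚.le_trans hPQ.2.1 (hPQ.2.2.2.2 _ (Set.subset_inter hPQ.2.2.1 hP)
      ⟨Set.inter_subset_left, fun h => hQ (h.trans Set.inter_subset_right)⟩) h1)
  obtain ⟨B, hB, hFB⟩ := StrongClass.exists_isMinimalPair hage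
    (hPQ.1.subset (Set.inter_subset_left (t := reach L Z a)))
    (Set.inter_subset_inter_right Q Set.inter_subset_left) hnle
  refine ⟨_, B, Set.inter_subset_right, hFB, fun z hz => ⟨(hB hz.1).2, fun h => hz.2 ?_⟩⟩
  exact ⟨(hB hz.1).1, (hB hz.1).2, h⟩

end Reach

/-! ### Copying finite configurations into another universal domain. -/

section Transfer

variable {L : FirstOrder.Language.{0, 0}} [L.IsRelational] {𝓚 : StrongClass.{w} L}
  (h𝓚 : 𝓚.IsFullAmalgamationClass) [Finite (Σ n, L.Relations n)]
include h𝓚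

/-- Each bounded approximation of the closure is definable, so membership in the closure is part of
the type. -/
theorem TpEq.mem_cl {α : Type u₁} {β : Type u₂} {N N' : Type w} [L.Structure N] [L.Structure N']
    (hN : HasAge 𝓚 N) (hN' : HasAge 𝓚 N') {a : β → N} {b : β → N'} (h : TpEq L a b) (p : α → β)
    {i : β} (hi : a i ∈ 𝓚.cl (Set.range fun x => a (p x))) :
    b i ∈ 𝓚.cl (Set.range fun x => b (p x)) := by
  obtain ⟨F, hF, hFX, s, hs⟩ := (StrongClass.mem_cl_iff h𝓚 hN).1 hi
  have hpre : ∀ x : F, ∃ y, a (p y) = x := fun x => hFX x.2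
  choose q hq using hpre
  have : Finite F := hF
  have hFq : F = Set.range fun x : F => a (p (q x)) := by
    ext z
    refine ⟨fun hz => ⟨⟨z, hz⟩, hq _⟩, ?_⟩
    rintro ⟨x, rfl⟩
    simp only [hq]
    exact x.2
  rw [hFq] at hs
  have := (h.fo (FO.cls h𝓚 s β i fun x => p (q x))).1 hs
  exact (StrongClass.mem_cl_iff h𝓚 hN').2 ⟨_, Set.finite_range _, by
    rintro _ ⟨x, rfl⟩
    exact ⟨q x, rfl⟩, s, this⟩

/-- An automorphism over A moves W off N, by the infinite orbits. The type of the moved V over N is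
then realized in the second domain over j(N), where the copies of W are again new. -/
theorem exists_transfer {T : L.Theory} {κ κ₁ : Cardinal.{w}} {C C₁ : Type w} [L.Structure C]
    [L.Structure C₁] (hC : IsUniversalDomain T κ C) (hC₁ : IsUniversalDomain T κ₁ C₁)
    (hage : HasAge 𝓚 C) (hage₁ : HasAge 𝓚 C₁) (N : L.ElementarySubstructure C)
    (hN : #N < κ) (j : N ↪ₑ[L] C₁) (hN₁ : #N < κ₁) {A V W : Set C} (hAN : A ⊆ N) (hV : V.Finite)
    (hVne : V.Nonempty) (hWV : W ⊆ V)
    (hW : ∀ v ∈ W, ∀ A₀ ⊆ A, A₀.Finite → (MulAction.orbit (autFix L A₀) v).Infinite) :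
    ∃ h : C → C₁, PartialIso L h V ∧ (∀ a (ha : a ∈ A), a ∈ V → h a = j ⟨a, hAN ha⟩) ∧
      (∀ v ∈ W, h v ∉ Set.range j) ∧ ∀ v ∈ V, v ∈ 𝓚.cl A → h v ∈ 𝓚.cl (Set.range j) := by
  have : Nonempty C := hVne.to_type
  have : Nonempty V := hVne.to_subtype
  have : Finite V := hV
  have hWf : Finite W := hV.subset hWV
  obtain ⟨n, ⟨e⟩⟩ := Finite.exists_equiv_fin W
  obtain ⟨σ, hσ, hσN⟩ := hC.exists_autFix_notMem (A := A) (N := (N : Set C))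
    ((mk_le_mk_of_subset hAN).trans_lt hN) hN (fun i => (e.symm i : C))
    fun i => hW _ (e.symm i).2
  have hval : TpEq L (fun x : N => (x : C)) fun x => j x :=
    (tpEq_elementary N.subtype id).symm.trans (tpEq_elementary j id)
  obtain ⟨b, hb⟩ := hC₁.exists_tpEq_finite hN₁ hval fun v : V => σ v
  have h1 : TpEq L (fun v : V => (v : C)) b :=
    (tpEq_of_mem_autFix hσ _).trans (hb.comp Sum.inr)
  obtain ⟨h, hh, hhb⟩ := h1.atomEq.exists_partialIso
  rw [Subtype.range_coe] at hh
  refine ⟨h, hh, ?_, ?_, ?_⟩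
  · intro a ha haV
    rw [hhb ⟨a, haV⟩]
    exact (hb.atomEq.eq (Sum.inr ⟨a, haV⟩) (Sum.inl ⟨a, hAN ha⟩)).1 (hσ.2 a ha)
  · rintro v hv ⟨x, hx⟩
    rw [hhb ⟨v, hWV hv⟩] at hx
    have h2 : σ v = x := ((hb.atomEq.eq (Sum.inl x) (Sum.inr ⟨v, hWV hv⟩)).2 hx).symm
    refine hσN (e ⟨v, hv⟩) ?_
    rw [e.symm_apply_apply, h2]
    exact x.2
  · intro v hv hvA
    rw [hhb ⟨v, hv⟩]
    have h2 : σ v ∈ 𝓚.cl (N : Set C) :=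
      StrongClass.cl_mono hAN ((apply_mem_cl_iff_of_subset h𝓚 hσ subset_rfl).2 hvA)
    have h3 := hb.mem_cl h𝓚 hage hage₁ (fun x : N => Sum.inl x) (i := Sum.inr ⟨v, hv⟩) (by
      have h4 : (Set.range fun x : N => (x : C)) = (N : Set C) := Subtype.range_coe
      exact h4.symm ▸ h2)
    exact h3

end Transfer

/-! ### Limiting supports bound the boundaries of the cores. -/

section SupportBound

variable {L : FirstOrder.Language.{0, 0}} [L.IsRelational] {𝓚 : StrongClass.{w} L}

theorem ecl_inter_subset {C : Type w} [L.Structure C] {m S : Set C} :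
    𝓚.ecl m S ∩ m ⊆ S := by
  rintro x ⟨hx | hx, hxm⟩
  · exact hx
  · obtain ⟨i, hi⟩ := Set.mem_iUnion.1 hx
    cases i with
    | zero =>
      obtain ⟨B, ⟨X', -, -, hB⟩, hxB⟩ := hi
      exact hB ⟨hxB, hxm⟩
    | succ i =>
      obtain ⟨B, ⟨X', -, -, hB⟩, hxB⟩ := hi
      exact hB ⟨hxB, hxm⟩

/-- The core of `a` contains the new points of a minimal pair over `F`. -/
structure IsBased (𝓚 : StrongClass.{w} L) {C : Type w} [L.Structure C] (M Z F : Set C) (a : C) :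
    Prop where
  mem_cl : a ∈ 𝓚.cl M
  notMem : a ∉ Z
  subset : F ⊆ reach L Z a ∩ Z
  exists_pair : ∃ B, 𝓚.IsMinimalPair F B ∧ B \ F ⊆ core L Z a

theorem card_le_aleph0 [Finite (Σ n, L.Relations n)] : L.card ≤ ℵ₀ := by
  have : IsEmpty (Σ n, L.Functions n) := ⟨fun f => isEmptyElim f.2⟩
  have : Countable L.Symbols := inferInstanceAs (Countable ((Σ n, L.Functions n) ⊕ Σ n, L.Relations n))
  exact mk_le_aleph0

theorem exists_elementarySubstructure [Finite (Σ n, L.Relations n)] {C : Type w} [L.Structure C]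
    (s : Set C) {μ : Cardinal.{w}} (hμ : ℵ₀ ≤ μ) (hs : #s ≤ μ) (hC : μ ≤ #C) :
    ∃ S : L.ElementarySubstructure C, s ⊆ S ∧ #S = μ := by
  obtain ⟨S, h1, h2⟩ := exists_elementarySubstructure_card_eq L s μ hμ (by simpa using hs)
    ((lift_le.2 card_le_aleph0).trans (by simpa using hμ)) (by simpa using hC)
  exact ⟨S, h1, by simpa using h2⟩

variable (h𝓚 : 𝓚.IsFullAmalgamationClass) {C : Type w} [L.Structure C] {M Z : Set C}

theorem reach_subset_cl (hcl : ∀ v ∈ 𝓚.cl M, v ∉ Z → ∀ y, IsEdge L y → v ∈ y → y ⊆ 𝓚.cl M) {a : C}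
    (ha : a ∈ 𝓚.cl M) : reach L Z a ⊆ 𝓚.cl M := by
  intro b hb
  induction hb with
  | refl => exact ha
  | @tail u v huv hstep ih =>
    obtain ⟨hu, y, hy, huy, hvy⟩ := hstep
    exact hcl u ih hu y hy huy hvy

variable [Finite (Σ n, L.Relations n)]
include h𝓚

/-- The image, in another universal domain over an elementary submodel `N`, of a point of the core of
`a`: its support contains each given boundary point `c`, and is determined by `F`. -/
theorem exists_supported_point {T : L.Theory} {κ κ₁ : Cardinal.{w}} {C₁ : Type w}
    [L.Structure C₁] (hC : IsUniversalDomain T κ C) (hC₁ : IsUniversalDomain T κ₁ C₁)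
    (hage : HasAge 𝓚 C) (hage₁ : HasAge 𝓚 C₁) (N : L.ElementarySubstructure C)
    (hN : #N < κ) (j : N ↪ₑ[L] C₁) (hN₁ : #N < κ₁) {A F : Set C} (hAN : A ⊆ N) (hAZ : A ⊆ Z)
    (hMA : M ⊆ A) (hFA : F ⊆ A)
    (hZ : ∀ v ∉ Z, ∀ A₀ ⊆ Z, A₀.Finite → (MulAction.orbit (autFix L A₀) v).Infinite)
    (hcl : ∀ v ∈ 𝓚.cl M, v ∉ Z → ∀ y, IsEdge L y → v ∈ y → y ⊆ 𝓚.cl M)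
    {a c : C} (ha : IsBased 𝓚 M Z F a) (hcA : c ∈ A) (hca : c ∈ reach L Z a)
    {𝒮 : Set (Set C₁)}
    (hedge : 𝓚.IsEdgeClosed (Set.range j) 𝒮) :
    ∃ b ∈ 𝓚.cl (Set.range j) \ Set.range j,
      (∀ S ∈ 𝒮, b ∈ 𝓚.ecl (Set.range j) S → j ⟨c, hAN hcA⟩ ∈ S ∧ ∀ f (hf : f ∈ F), j ⟨f, hAN (hFA hf)⟩ ∈ S) ∧
      ∀ S ∈ 𝒮, (∀ f (hf : f ∈ F), j ⟨f, hAN (hFA hf)⟩ ∈ S) → b ∈ 𝓚.ecl (Set.range j) S := by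
  obtain ⟨B, hFB, hBF⟩ := ha.exists_pair
  have hne : ∃ b, b ∈ B \ F := by
    by_contra h
    push Not at h
    have : F = B := Set.Subset.antisymm hFB.2.2.1 fun z hz => by
      by_contra hzF
      exact h z ⟨hz, hzF⟩
    exact hFB.2.2.2.1 (this ▸ h𝓚.le_refl (h𝓚.mem_subset hFB.2.1 hFB.2.2.1))
  obtain ⟨b, hb⟩ := hne
  have hbc := hBF hb
  have hreach : reach L Z b = reach L Z a := reach_eq hbc
  have hFr : F ⊆ reach L Z a := fun f hf => (ha.subset hf).1
  obtain ⟨𝓔, hfin, h𝓔, hpath⟩ := exists_finite_reach_set (Z := Z) (a := b)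
    ((hFB.1.subset hFB.2.2.1).insert c) (by
      rw [hreach]
      exact Set.insert_subset hca hFr)
  -- The finite configuration to be copied: the minimal pair, the point `c`, and edges that connect
  -- `b` to `c` and to all of F.
  let V : Set C := insert c (B ∪ ⋃₀ 𝓔)
  have hV : V.Finite := (hFB.1.union (hfin.sUnion fun y hy => (h𝓔 y hy).1.finite)).insert c
  have hBr : B ⊆ reach L Z a := fun z hz => by
    by_cases h : z ∈ F
    · exact hFr h
    · exact (hBF ⟨hz, h⟩).1
  have hVr : V ⊆ reach L Z a := by
    refine Set.insert_subset hca (Set.union_subset hBr (Set.sUnion_subset fun y hy => ?_))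
    exact hreach ▸ (h𝓔 y hy).2
  have hrcl : reach L Z a ⊆ 𝓚.cl A := (reach_subset_cl hcl ha.mem_cl).trans (StrongClass.cl_mono hMA)
  have hbV : b ∈ V := Or.inr (Or.inl hb.1)
  obtain ⟨h, hiso, hjA, hW, hclj⟩ := exists_transfer h𝓚 hC hC₁ hage hage₁ N hN j hN₁ hAN hV
    ⟨b, hbV⟩ (W := V \ Z) Set.sdiff_subset fun v hv A₀ hA₀ hfin => hZ v hv.2 A₀ (hA₀.trans hAZ) hfin
  have hhcl : ∀ v ∈ V, h v ∈ 𝓚.cl (Set.range j) := fun v hv => hclj v hv (hrcl (hVr hv))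
  have hFV : F ⊆ V := fun f hf => Or.inr (Or.inl (hFB.2.2.1 hf))
  refine ⟨h b, ⟨hhcl b hbV, hW b ⟨hbV, hbc.2⟩⟩, fun S hS hbS => ?_, fun S hS hFS => ?_⟩
  -- Edge-closedness propagates membership in ecl(S) along the path: each step leaves from a point
  -- outside Z, whose copy is outside N. A boundary point reached in this way is in N, hence in
  -- ecl(S) ∩ N ⊆ S.
  · have key : ∀ u, Relation.ReflTransGen (StepIn Z 𝓔) b u → h u ∈ 𝓚.ecl (Set.range j) S := by
      intro u hu
      induction hu with
      | refl => exact hbS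
      | @tail u v huv hstep ih =>
        obtain ⟨huZ, y, hy, huy, hvy⟩ := hstep
        have hyV : y ⊆ V := fun z hz => Or.inr (Or.inr ⟨y, hy, hz⟩)
        obtain ⟨n, R, x, hx, hxy⟩ := (h𝓔 y hy).1.image hiso hyV
        have := hedge.2 (h u) ⟨hhcl u (hyV huy), hW u ⟨hyV huy, huZ⟩⟩ S hS ih n R x hx (by
          rw [hxy]
          rintro _ ⟨z, hz, rfl⟩
          exact hhcl z (hyV hz)) (hxy ▸ ⟨u, huy, rfl⟩)
        exact this (hxy ▸ ⟨v, hvy, rfl⟩)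
    have key2 : ∀ u (huA : u ∈ A), u ∈ V → Relation.ReflTransGen (StepIn Z 𝓔) b u →
        j ⟨u, hAN huA⟩ ∈ S := by
      intro u huA huV hu
      have := key u hu
      rw [hjA u huA huV] at this
      exact ecl_inter_subset ⟨this, ⟨_, rfl⟩⟩
    exact ⟨key2 c hcA (Set.mem_insert _ _) (hpath c (Set.mem_insert _ _)),
      fun f hf => key2 f (hFA hf) (hFV hf) (hpath f (Or.inr hf))⟩
  -- The copied minimal pair meets N only in the copy of F, so as soon as S contains this copy, the
  -- pair already occurs in stage 0 of ecl(S).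
  · refine Or.inr (Set.mem_iUnion.2 ⟨0, h '' B, ⟨h '' F, ?_, h𝓚.isMinimalPair_image
      (hiso.mono fun z hz => Or.inr (Or.inl hz)) hFB, ?_⟩, b, hb.1, rfl⟩)
    · rintro _ ⟨f, hf, rfl⟩
      rw [hjA f (hFA hf) (hFV hf)]
      exact hFS f hf
    · rintro _ ⟨⟨z, hz, rfl⟩, hzj⟩
      have hzF : z ∈ F := by
        by_contra hzF
        exact hW z ⟨Or.inr (Or.inl hz), (hBF ⟨hz, hzF⟩).2⟩ hzj
      rw [hjA z (hFA hzF) (hFV hzF)]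
      exact hFS z hzF

/-- The boundary points of the cores that are based on a fixed finite set are few. -/
theorem mk_boundary_lt {G : Type w} [L.Structure G] (hG : 𝓚.IsGeneric G) {κ μ lam : Cardinal.{w}}
    (hC : IsUniversalDomain (L.completeTheory G) κ C) (hμ : ℵ₀ ≤ μ) (hM : #M ≤ μ) (hμκ : μ < κ)
    (hCμ : μ ≤ #C) (hlam : 1 ≤ lam) (hlamμ : lam ≤ μ) (hMZ : M ⊆ Z)
    (hZ : ∀ v ∉ Z, ∀ A₀ ⊆ Z, A₀.Finite → (MulAction.orbit (autFix L A₀) v).Infinite)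
    (hcl : ∀ v ∈ 𝓚.cl M, v ∉ Z → ∀ y, IsEdge L y → v ∈ y → y ⊆ 𝓚.cl M)
    (hsup : ∀ (N : Type w) [L.Structure N] [N ⊨ L.completeTheory G], #N = μ →
      ∃ (C : Type w) (_ : L.Structure C) (j : N ↪ₑ[L] C), IsUniversalDomainOver (L.completeTheory G) j ∧
        ∃ 𝒮 : Set (Set C), 𝓚.IsSupportSystem (Set.range j) 𝒮 ∧ (∀ S ∈ 𝒮, #S < lam) ∧
          𝓚.IsEdgeClosed (Set.range j) 𝒮)
    {F : Set C} (hF : F.Finite) :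
    #{c | ∃ a, IsBased 𝓚 M Z F a ∧ c ∈ reach L Z a ∩ Z} < lam := by
  by_contra hcon
  -- Exactly `lam` boundary points are taken, so that a model of size μ can contain them.
  obtain ⟨D, hD, hDlam⟩ := le_mk_iff_exists_subset.1 (not_lt.1 hcon)
  obtain ⟨c₀⟩ : Nonempty D := by
    rw [← mk_ne_zero_iff, hDlam]
    exact (zero_lt_one.trans_le hlam).ne'
  obtain ⟨a₀, ha₀, -⟩ := hD c₀.2
  let A : Set C := M ∪ D ∪ F
  have hAμ : #A ≤ μ := by
    refine (mk_union_le _ _).trans (add_le_of_le hμ ((mk_union_le _ _).trans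
      (add_le_of_le hμ hM (hDlam.trans_le hlamμ))) ?_)
    exact (lt_aleph0_iff_set_finite.2 hF).le.trans hμ
  obtain ⟨N, hAN, hN⟩ := exists_elementarySubstructure (L := L) A hμ hAμ hCμ
  have := hC.model
  obtain ⟨C₁, _, j, ⟨κ₁, hN₁, hC₁⟩, 𝒮, h𝒮, hSlam, hedge⟩ := hsup N hN
  have hDZ : D ⊆ Z := fun c hc => by
    obtain ⟨a, -, h⟩ := hD hc
    exact h.2
  have hFZ : F ⊆ Z := fun f hf => (ha₀.subset hf).2
  have hAZ : A ⊆ Z := Set.union_subset (Set.union_subset hMZ hDZ) hFZ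
  have hMA : M ⊆ A := fun x hx => Or.inl (Or.inl hx)
  have hFA : F ⊆ A := fun x hx => Or.inr hx
  have hDA : ∀ c : D, c.1 ∈ A := fun c => Or.inl (Or.inr c.2)
  have key : ∀ c : D, _ := fun c =>
    exists_supported_point h𝓚 hC hC₁ (hasAge_of_model h𝓚 hG hC.model)
      (hasAge_of_model h𝓚 hG hC₁.model) N (hN.trans_lt hμκ) j hN₁ hAN hAZ hMA hFA hZ hcl
      (hD c.2).choose_spec.1 (hDA c) (hD c.2).choose_spec.2.1 hedge
  choose b hb h1 h2 using key
  -- A support of one copy contains F, hence supports the copies for all `c` in D, and therefore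
  -- contains all of D.
  obtain ⟨S₀, ⟨hS₀, hbS₀⟩, -⟩ := hedge.1 (b c₀) (hb c₀)
  have h3 : ∀ c : D, j ⟨c, hAN (hDA c)⟩ ∈ S₀ := fun c =>
    (h1 c S₀ hS₀ (h2 c S₀ hS₀ (h1 c₀ S₀ hS₀ hbS₀).2)).1
  have h4 : #D ≤ #S₀ := mk_le_of_injective (f := fun c : D => (⟨_, h3 c⟩ : S₀)) fun c c' h => by
    have := j.injective (congrArg Subtype.val h)
    exact Subtype.ext (congrArg (fun x : N => (x : C)) this)
  exact absurd (hSlam S₀ hS₀) (not_lt.2 (hDlam.symm.trans_le h4))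

end SupportBound

/-! ### Back-and-forth invariants of the cores. -/

section Codes

variable {L : FirstOrder.Language.{0, 0}} {C : Type w} [L.Structure C]

/-- The atomic statements about an `n`-tuple with parameters in `D`. -/
abbrev AtomIndex (L : FirstOrder.Language.{0, 0}) {C : Type w} (D : Set C) (n : ℕ) : Type w :=
  Fin n ⊕ (Fin n × Fin n) ⊕ Σ R : (Σ m, L.Relations m), (Fin R.1 → Fin n ⊕ D)

/-- The possible values of the back-and-forth invariants of rank `k` of `n`-tuples. -/
def Code (L : FirstOrder.Language.{0, 0}) {C : Type w} (D : Set C) : ℕ → ℕ → Type w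
  | 0, n => Set (AtomIndex L D n)
  | k + 1, n => Code L D k n × Set (Code L D k (n + 1))

/-- The back-and-forth invariant of rank `k` of a tuple, with respect to the set `Ω`: it ignores the
entries outside `Ω`. -/
def code (L : FirstOrder.Language.{0, 0}) {C : Type w} [L.Structure C] (D Ω : Set C) :
    ∀ (k n : ℕ), (Fin n → C) → Code L D k n
  | 0, n, x => {s : AtomIndex L D n |
      s.elim (fun i => x i ∈ Ω) fun s => s.elim
        (fun p => x p.1 ∈ Ω ∧ x p.2 ∈ Ω ∧ x p.1 = x p.2) fun t =>
          (∀ i j, t.2 i = Sum.inl j → x j ∈ Ω) ∧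
            Structure.RelMap t.1.2 fun i => Sum.elim x Subtype.val (t.2 i)}
  | k + 1, n, x => (code L D Ω k n x, {q | ∃ c : C, code L D Ω k (n + 1) (Fin.snoc x c) = q})

variable {D Ω Ω' : Set C}

theorem code_congr (k n : ℕ) {x x' : Fin n → C}
    (h : ∀ i, x i = x' i ∨ (x i ∉ Ω ∧ x' i ∉ Ω)) : code L D Ω k n x = code L D Ω k n x' := by
  induction k generalizing n x x' with
  | zero =>
    have h1 : ∀ i, x i ∈ Ω ↔ x' i ∈ Ω := fun i => by
      rcases h i with h | h
      · rw [h]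
      · exact iff_of_false h.1 h.2
    have h2 : ∀ i, x i ∈ Ω → x i = x' i := fun i hi => (h i).resolve_right fun h => h.1 hi
    refine Set.ext (α := AtomIndex L D n) fun s => ?_
    rcases s with i | p | t
    · exact h1 i
    · change (x p.1 ∈ Ω ∧ x p.2 ∈ Ω ∧ x p.1 = x p.2) ↔ (x' p.1 ∈ Ω ∧ x' p.2 ∈ Ω ∧ x' p.1 = x' p.2)
      rw [← h1, ← h1]
      refine and_congr_right fun h3 => and_congr_right fun h4 => ?_
      rw [h2 _ h3, h2 _ h4]
    · change ((∀ i j, t.2 i = Sum.inl j → x j ∈ Ω) ∧ _) ↔ ((∀ i j, t.2 i = Sum.inl j → x' j ∈ Ω) ∧ _)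
      simp only [← h1]
      refine and_congr_right fun h3 => ?_
      have : (fun i => Sum.elim x (Subtype.val : D → C) (t.2 i)) =
          fun i => Sum.elim x' (Subtype.val : D → C) (t.2 i) := by
        funext i
        cases hi : t.2 i with
        | inl j => exact h2 j (h3 i j hi)
        | inr d => rfl
      rw [this]
  | succ k ih =>
    refine Prod.ext (ih n h) ?_
    have : ∀ c, code L D Ω k (n + 1) (Fin.snoc x c) = code L D Ω k (n + 1) (Fin.snoc x' c) := fun c =>
      ih (n + 1) fun i => by
        refine Fin.lastCases ?_ (fun i => ?_) i
        · left
          simp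
        · simpa using h i
    simp only [code, this]

theorem code_zero_of_code (k n : ℕ) {x y : Fin n → C} (h : code L D Ω k n x = code L D Ω' k n y) :
    code L D Ω 0 n x = code L D Ω' 0 n y := by
  induction k with
  | zero => exact h
  | succ k ih => exact ih (congrArg Prod.fst h)

theorem code_of_le {k k' n : ℕ} (hk : k ≤ k') {x y : Fin n → C}
    (h : code L D Ω k' n x = code L D Ω' k' n y) : code L D Ω k n x = code L D Ω' k n y := by
  induction hk with
  | refl => exact h
  | step _ ih => exact ih (congrArg Prod.fst h)

theorem mem_iff_of_code {k n : ℕ} {x y : Fin n → C} (h : code L D Ω k n x = code L D Ω' k n y)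
    (i : Fin n) : x i ∈ Ω ↔ y i ∈ Ω' := by
  have := code_zero_of_code k n h
  exact iff_of_eq (congrArg (fun q : Set (AtomIndex L D n) => Sum.inl i ∈ q) this)

theorem eq_iff_of_code {n : ℕ} {x y : Fin n → C} (h : code L D Ω 0 n x = code L D Ω' 0 n y)
    (i j : Fin n) : (x i ∈ Ω ∧ x j ∈ Ω ∧ x i = x j) ↔ (y i ∈ Ω' ∧ y j ∈ Ω' ∧ y i = y j) := by
  exact iff_of_eq (congrArg (fun q : Set (AtomIndex L D n) => Sum.inr (Sum.inl (i, j)) ∈ q) h)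

theorem rel_iff_of_code {n m : ℕ} {x y : Fin n → C} (h : code L D Ω 0 n x = code L D Ω' 0 n y)
    (R : L.Relations m) (t : Fin m → Fin n ⊕ D) :
    ((∀ i j, t i = Sum.inl j → x j ∈ Ω) ∧
      Structure.RelMap R fun i => Sum.elim x (Subtype.val : D → C) (t i)) ↔
    ((∀ i j, t i = Sum.inl j → y j ∈ Ω') ∧
      Structure.RelMap R fun i => Sum.elim y (Subtype.val : D → C) (t i)) := by
  let s : AtomIndex L D n := Sum.inr (Sum.inr ⟨⟨m, R⟩, t⟩)
  exact iff_of_eq (congrArg (fun q : Set (AtomIndex L D n) => s ∈ q) h)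

theorem exists_code_snoc {k n : ℕ} {x y : Fin n → C}
    (h : code L D Ω (k + 1) n x = code L D Ω' (k + 1) n y) (c : C) :
    ∃ d, code L D Ω k (n + 1) (Fin.snoc x c) = code L D Ω' k (n + 1) (Fin.snoc y d) ∧
      (c ∈ Ω ↔ d ∈ Ω') := by
  have h1 : code L D Ω k (n + 1) (Fin.snoc x c) ∈
      {q | ∃ c : C, code L D Ω' k (n + 1) (Fin.snoc y c) = q} := by
    have := congrArg Prod.snd h
    change {q | ∃ c : C, code L D Ω k (n + 1) (Fin.snoc x c) = q} = _ at this
    change _ ∈ (code L D Ω' (k + 1) n y).2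
    rw [← this]
    exact ⟨c, rfl⟩
  obtain ⟨d, hd⟩ := h1
  refine ⟨d, hd.symm, ?_⟩
  have := mem_iff_of_code hd.symm (Fin.last n)
  simpa using this

/-- Whatever answers `c` lies outside Ω' as well, and codes do not distinguish between entries
outside their set. -/
theorem exists_code_snoc_of_notMem {k n : ℕ} {x y : Fin n → C}
    (h : code L D Ω (k + 1) n x = code L D Ω' (k + 1) n y) {c d : C} (hc : c ∉ Ω) (hd : d ∉ Ω') :
    code L D Ω k (n + 1) (Fin.snoc x c) = code L D Ω' k (n + 1) (Fin.snoc y d) := by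
  obtain ⟨d', hd', h1⟩ := exists_code_snoc h c
  rw [hd']
  refine code_congr _ _ fun i => ?_
  refine Fin.lastCases ?_ (fun i => ?_) i
  · right
    simp only [Fin.snoc_last]
    exact ⟨fun h => hc (h1.2 h), hd⟩
  · left
    simp

/-- The tuples `x` and `y` agree outside `Ω ∪ Ω'`, and their parts in `Ω` and `Ω'` correspond to
each other up to rank `k`. -/
structure Swap (L : FirstOrder.Language.{0, 0}) {C : Type w} [L.Structure C] (D Ω Ω' : Set C)
    (k : ℕ) {n : ℕ} (x y : Fin n → C) : Prop where
  pos : ∀ i, (x i ∉ Ω ∪ Ω' ∧ y i = x i) ∨ (x i ∈ Ω ∧ y i ∈ Ω') ∨ (x i ∈ Ω' ∧ y i ∈ Ω)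
  left : code L D Ω k n x = code L D Ω' k n y
  right : code L D Ω' k n x = code L D Ω k n y

theorem Swap.symm {k n : ℕ} {x y : Fin n → C} (h : Swap L D Ω Ω' k x y) : Swap L D Ω Ω' k y x := by
  refine ⟨fun i => ?_, h.right.symm, h.left.symm⟩
  rcases h.pos i with h | h | h
  · exact Or.inl ⟨h.2.symm ▸ h.1, h.2.symm⟩
  · exact Or.inr (Or.inr h.symm)
  · exact Or.inr (Or.inl h.symm)

theorem Swap.flip {k n : ℕ} {x y : Fin n → C} (h : Swap L D Ω Ω' k x y) : Swap L D Ω' Ω k x y := by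
  refine ⟨fun i => ?_, h.right, h.left⟩
  rw [Set.union_comm]
  rcases h.pos i with h | h | h
  · exact Or.inl h
  · exact Or.inr (Or.inr h)
  · exact Or.inr (Or.inl h)

theorem Swap.of_le {k k' n : ℕ} (hk : k ≤ k') {x y : Fin n → C} (h : Swap L D Ω Ω' k' x y) :
    Swap L D Ω Ω' k x y :=
  ⟨h.pos, code_of_le hk h.left, code_of_le hk h.right⟩

/-- A point of Ω is answered through the left codes, a point of Ω' through the right ones, any other
point by itself. If the sets are disjoint, the remaining code sees a new entry outside its set on
both sides; if they are equal, there is only one code. -/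
theorem Swap.exists_snoc (hΩ : Ω = Ω' ∨ Disjoint Ω Ω') {k n : ℕ} {x y : Fin n → C}
    (h : Swap L D Ω Ω' (k + 1) x y) (c : C) :
    ∃ d, Swap L D Ω Ω' k (Fin.snoc x c : Fin (n + 1) → C) (Fin.snoc y d) := by
  have main : ∀ d, ((c ∉ Ω ∪ Ω' ∧ d = c) ∨ (c ∈ Ω ∧ d ∈ Ω') ∨ (c ∈ Ω' ∧ d ∈ Ω)) →
      code L D Ω k (n + 1) (Fin.snoc x c) = code L D Ω' k (n + 1) (Fin.snoc y d) →
      code L D Ω' k (n + 1) (Fin.snoc x c) = code L D Ω k (n + 1) (Fin.snoc y d) →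
      Swap L D Ω Ω' k (Fin.snoc x c : Fin (n + 1) → C) (Fin.snoc y d) := fun d h1 h2 h3 =>
    ⟨fun i => by
      refine Fin.lastCases ?_ (fun i => ?_) i
      · simpa only [Fin.snoc_last] using h1
      · simpa only [Fin.snoc_castSucc] using h.pos i, h2, h3⟩
  by_cases h1 : c ∈ Ω
  · obtain ⟨d, hd, hcd⟩ := exists_code_snoc h.left c
    refine ⟨d, main d (Or.inr (Or.inl ⟨h1, hcd.1 h1⟩)) hd ?_⟩
    rcases hΩ with rfl | hdis
    · exact hd
    · exact exists_code_snoc_of_notMem h.right (Set.disjoint_left.1 hdis h1)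
        (Set.disjoint_right.1 hdis (hcd.1 h1))
  · by_cases h2 : c ∈ Ω'
    · obtain ⟨d, hd, hcd⟩ := exists_code_snoc h.right c
      refine ⟨d, main d (Or.inr (Or.inr ⟨h2, hcd.1 h2⟩)) ?_ hd⟩
      rcases hΩ with rfl | hdis
      · exact hd
      · exact exists_code_snoc_of_notMem h.left h1 (Set.disjoint_left.1 hdis (hcd.1 h2))
    · exact ⟨c, main c (Or.inl ⟨fun h => h.elim h1 h2, rfl⟩) (exists_code_snoc_of_notMem h.left h1 h2)
        (exists_code_snoc_of_notMem h.right h2 h1)⟩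

section Atomic

variable {α : Type u₁} {v : α → C} (hv : ∀ i, v i ∉ Ω ∪ Ω') {n : ℕ} {x y : Fin n → C}
include hv

theorem Swap.eq_of_eq (h : Swap L D Ω Ω' 0 x y) {s s' : α ⊕ Fin n}
    (hs : Sum.elim v x s = Sum.elim v x s') : Sum.elim v y s = Sum.elim v y s' := by
  have key : ∀ s : α ⊕ Fin n, Sum.elim v x s ∉ Ω ∪ Ω' → Sum.elim v y s = Sum.elim v x s := by
    rintro (i | i) hi
    · rfl
    · rcases h.pos i with h | h | h
      · exact h.2
      · exact absurd (Or.inl h.1) hi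
      · exact absurd (Or.inr h.1) hi
  by_cases h1 : Sum.elim v x s ∈ Ω ∪ Ω'
  · have h2 : Sum.elim v x s' ∈ Ω ∪ Ω' := hs ▸ h1
    rcases s with i | i
    · exact absurd h1 (hv i)
    rcases s' with j | j
    · exact absurd h2 (hv j)
    change x i = x j at hs
    change y i = y j
    rcases h1 with h1 | h1
    · exact ((eq_iff_of_code h.left i j).1 ⟨h1, hs ▸ h1, hs⟩).2.2
    · exact ((eq_iff_of_code h.right i j).1 ⟨h1, hs ▸ h1, hs⟩).2.2
  · rw [key s h1, key s' (hs ▸ h1), hs]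

/-- The whole edge lies in Ω ∪ D, so the code of rank 0 decides the relation. Entries in D are
outside both Ω and Ω', hence unchanged by the swap and available as parameters of the code. -/
theorem Swap.rel_of_mem (hD : Disjoint D (Ω ∪ Ω'))
    (hedge : ∀ e, IsEdge L e → (e ∩ Ω).Nonempty → e ⊆ Ω ∪ D) (h : Swap L D Ω Ω' 0 x y) {m : ℕ}
    (R : L.Relations m) (s : Fin m → α ⊕ Fin n)
    (hR : Structure.RelMap R fun i => Sum.elim v x (s i)) (hmem : ∃ i, Sum.elim v x (s i) ∈ Ω) :
    Structure.RelMap R fun i => Sum.elim v y (s i) := by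
  obtain ⟨i₀, hi₀⟩ := hmem
  have h1 : ∀ i, Sum.elim v x (s i) ∈ Ω ∪ D := fun i =>
    hedge _ ⟨m, R, _, hR, rfl⟩ ⟨_, ⟨i₀, rfl⟩, hi₀⟩ ⟨i, rfl⟩
  have h2 : ∀ i, ∃ t : Fin n ⊕ D, (∀ j, t = Sum.inl j → x j ∈ Ω) ∧
      Sum.elim x (Subtype.val : D → C) t = Sum.elim v x (s i) ∧
      Sum.elim y (Subtype.val : D → C) t = Sum.elim v y (s i) := by
    intro i
    rcases h1 i with hi | hi
    · cases hs : s i with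
      | inl j => exact absurd (Or.inl (by rwa [hs] at hi)) (hv j)
      | inr j =>
        refine ⟨Sum.inl j, ?_, rfl, rfl⟩
        rintro _ ⟨⟩
        rwa [hs] at hi
    · refine ⟨Sum.inr ⟨_, hi⟩, fun j hj => absurd hj (by simp), rfl, ?_⟩
      have hni := Set.disjoint_left.1 hD hi
      change Sum.elim v x (s i) = Sum.elim v y (s i)
      cases hs : s i with
      | inl j => rfl
      | inr j =>
        rw [hs] at hni
        rcases h.pos j with h | h | h
        · exact h.2.symm
        · exact absurd (Or.inl h.1) hni
        · exact absurd (Or.inr h.1) hni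
  choose t ht1 ht2 ht3 using h2
  have := ((rel_iff_of_code h.left R t).1 ⟨ht1, by simpa only [ht2] using hR⟩).2
  simpa only [ht3] using this

theorem Swap.rel (hD : Disjoint D (Ω ∪ Ω'))
    (hedge : ∀ e, IsEdge L e → (e ∩ Ω).Nonempty → e ⊆ Ω ∪ D)
    (hedge' : ∀ e, IsEdge L e → (e ∩ Ω').Nonempty → e ⊆ Ω' ∪ D) (h : Swap L D Ω Ω' 0 x y) {m : ℕ}
    (R : L.Relations m) (s : Fin m → α ⊕ Fin n)
    (hR : Structure.RelMap R fun i => Sum.elim v x (s i)) :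
    Structure.RelMap R fun i => Sum.elim v y (s i) := by
  by_cases h1 : ∃ i, Sum.elim v x (s i) ∈ Ω
  · exact h.rel_of_mem hv hD hedge R s hR h1
  by_cases h2 : ∃ i, Sum.elim v x (s i) ∈ Ω'
  · rw [Set.union_comm] at hD
    exact h.flip.rel_of_mem (fun i => Set.union_comm Ω Ω' ▸ hv i) hD hedge' R s hR h2
  push Not at h1 h2
  have : (fun i => Sum.elim v y (s i)) = fun i => Sum.elim v x (s i) := by
    funext i
    have hi1 := h1 i
    have hi2 := h2 i
    cases hs : s i with
    | inl j => rfl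
    | inr j =>
      rw [hs] at hi1 hi2
      rcases h.pos j with h | h | h
      · exact h.2
      · exact absurd h.1 hi1
      · exact absurd h.1 hi2
  rwa [this]

/-- An Ehrenfeucht–Fraïssé argument: each quantifier costs one rank, and implications take the
maximum. -/
theorem exists_swap_realize_iff [L.IsRelational] (hΩ : Ω = Ω' ∨ Disjoint Ω Ω') (hD : Disjoint D (Ω ∪ Ω'))
    (hedge : ∀ e, IsEdge L e → (e ∩ Ω).Nonempty → e ⊆ Ω ∪ D)
    (hedge' : ∀ e, IsEdge L e → (e ∩ Ω').Nonempty → e ⊆ Ω' ∪ D) {n : ℕ} (φ : L.BoundedFormula α n) :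
    ∃ k, ∀ x y : Fin n → C, Swap L D Ω Ω' k x y → (φ.Realize v x ↔ φ.Realize v y) := by
  have hterm : ∀ {n : ℕ} (t : L.Term (α ⊕ Fin n)), ∃ s, ∀ x : Fin n → C,
      t.realize (Sum.elim v x) = Sum.elim v x s := by
    intro n t
    cases t with
    | var s => exact ⟨s, fun x => rfl⟩
    | func f => exact isEmptyElim f
  induction φ with
  | falsum => exact ⟨0, fun x y h => Iff.rfl⟩
  | equal t₁ t₂ =>
    obtain ⟨s₁, h₁⟩ := hterm t₁
    obtain ⟨s₂, h₂⟩ := hterm t₂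
    refine ⟨0, fun x y h => ?_⟩
    simp only [BoundedFormula.Realize, h₁, h₂]
    exact ⟨h.eq_of_eq hv, h.symm.eq_of_eq hv⟩
  | rel R ts =>
    choose s hs using fun i => hterm (ts i)
    refine ⟨0, fun x y h => ?_⟩
    simp only [BoundedFormula.Realize, hs]
    exact ⟨h.rel hv hD hedge hedge' R s, h.symm.rel hv hD hedge hedge' R s⟩
  | imp φ ψ ih₁ ih₂ =>
    obtain ⟨k₁, h₁⟩ := ih₁
    obtain ⟨k₂, h₂⟩ := ih₂
    refine ⟨max k₁ k₂, fun x y h => ?_⟩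
    simp only [BoundedFormula.Realize]
    rw [h₁ x y (h.of_le (le_max_left _ _)), h₂ x y (h.of_le (le_max_right _ _))]
  | all φ ih =>
    obtain ⟨k, hk⟩ := ih
    refine ⟨k + 1, fun x y h => ⟨fun h1 d => ?_, fun h1 c => ?_⟩⟩
    · obtain ⟨c, hc⟩ := h.symm.exists_snoc hΩ d
      exact (hk _ _ hc).2 (h1 c)
    · obtain ⟨d, hd⟩ := h.exists_snoc hΩ c
      exact (hk _ _ hd).2 (h1 d)

end Atomic

/-- For disjoint Ω and Ω' the swap must also match what Ω' sees of `a` with what Ω sees of `a'`.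
Both are entries outside, and the codes of the dummy point `p` compare these two views. -/
theorem tpEq_of_code [L.IsRelational] {α : Type u₁} {v : α → C} (hv : ∀ i, v i ∉ Ω ∪ Ω')
    (hΩ : Ω = Ω' ∨ Disjoint Ω Ω') (hD : Disjoint D (Ω ∪ Ω'))
    (hedge : ∀ e, IsEdge L e → (e ∩ Ω).Nonempty → e ⊆ Ω ∪ D)
    (hedge' : ∀ e, IsEdge L e → (e ∩ Ω').Nonempty → e ⊆ Ω' ∪ D) {a a' p : C} (ha : a ∈ Ω) (ha' : a' ∈ Ω')
    (hp : p ∉ Ω ∪ Ω')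
    (h1 : ∀ k, code L D Ω k 1 (fun _ => a) = code L D Ω' k 1 fun _ => a')
    (h2 : ∀ k, code L D Ω k 1 (fun _ => p) = code L D Ω' k 1 fun _ => p) :
    TpEq L (Sum.elim v fun _ : Fin 1 => a) (Sum.elim v fun _ : Fin 1 => a') := by
  have hswap : ∀ k, Swap L D Ω Ω' k (fun _ : Fin 1 => a) fun _ => a' := fun k =>
    ⟨fun _ => Or.inr (Or.inl ⟨ha, ha'⟩), h1 k, by
      rcases hΩ with rfl | hdis
      · exact h1 k
      · have h3 : code L D Ω' k 1 (fun _ => a) = code L D Ω' k 1 fun _ => p :=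
          code_congr _ _ fun _ => Or.inr ⟨Set.disjoint_left.1 hdis ha, fun h => hp (Or.inr h)⟩
        have h4 : code L D Ω k 1 (fun _ => p) = code L D Ω k 1 fun _ => a' :=
          code_congr _ _ fun _ => Or.inr ⟨fun h => hp (Or.inl h), Set.disjoint_right.1 hdis ha'⟩
        rw [h3, ← h2, h4]⟩
  intro φ
  let ψ : L.BoundedFormula α 1 := BoundedFormula.relabel (n := 1) (fun s : α ⊕ Fin 1 => s) φ
  obtain ⟨k, hk⟩ := exists_swap_realize_iff hv hΩ hD hedge hedge' ψ
  have h3 : ∀ x : Fin 1 → C, ψ.Realize v x ↔ φ.Realize (Sum.elim v x) := fun x => by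
    refine BoundedFormula.realize_relabel.trans ?_
    exact iff_of_eq (congrArg₂ _ rfl (Subsingleton.elim _ _))
  exact (h3 _).symm.trans ((hk _ _ (hswap k)).trans (h3 _))

/-- A bound for the number of codes of rank `k` over a set of size at most `lam`. -/
def codeBound (lam : Cardinal.{w}) : ℕ → Cardinal.{w}
  | 0 => 2 ^ lam
  | k + 1 => codeBound lam k * 2 ^ codeBound lam k

omit [L.Structure C] in
theorem mk_code_le [Finite (Σ n, L.Relations n)] {lam : Cardinal.{w}} (hlam : ℵ₀ ≤ lam) (hD : #D ≤ lam)
    (k n : ℕ) : #(Code L D k n) ≤ codeBound lam k := by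
  induction k generalizing n with
  | zero =>
    have h2 : #(Fin n ⊕ D) ≤ lam := by
      rw [mk_sum, mk_fin, lift_natCast, lift_uzero]
      exact add_le_of_le hlam (natCast_lt_aleph0.le.trans hlam) hD
    have h3 : ∀ R : (Σ m, L.Relations m), #(Fin R.1 → Fin n ⊕ D) ≤ lam := fun R => by
      rw [mk_arrow, mk_fin, lift_natCast, lift_uzero]
      exact (power_le_power_right h2).trans (power_nat_le hlam)
    have h4 : #(Σ R : (Σ m, L.Relations m), (Fin R.1 → Fin n ⊕ D)) ≤ lam := by
      rw [mk_sigma]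
      refine (sum_le_sum _ (fun _ => lam) h3).trans ?_
      rw [sum_const, lift_uzero]
      refine mul_le_of_le hlam ?_ le_rfl
      exact (lift_le_aleph0.2 mk_le_aleph0).trans hlam
    change #(Set _) ≤ 2 ^ lam
    rw [mk_set]
    refine power_le_power_left two_ne_zero ?_
    have h5 : ∀ m : ℕ, (m : Cardinal.{w}) ≤ lam := fun m => natCast_lt_aleph0.le.trans hlam
    rw [mk_sum, mk_sum, lift_uzero, mk_prod, mk_fin]
    simp only [lift_natCast, lift_uzero, ← Nat.cast_mul]
    exact add_le_of_le hlam (h5 n) (add_le_of_le hlam (h5 _) h4)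
  | succ k ih =>
    change #(Code L D k n × Set (Code L D k (n + 1))) ≤ codeBound lam k * 2 ^ codeBound lam k
    rw [mk_prod, mk_set, lift_id, lift_id]
    exact mul_le_mul' (ih n) (power_le_power_left two_ne_zero (ih (n + 1)))

end Codes

/-! ### Counting the orbits over M 0. -/

section Counting

variable {L : FirstOrder.Language.{0, 0}} [L.IsRelational] {𝓚 : StrongClass.{w} L}
  {C : Type w} [L.Structure C]

/-- The orbits of the points of `C` over `A`. -/
abbrev Orbits (L : FirstOrder.Language.{0, 0}) {C : Type w} [L.Structure C] (A : Set C) : Type w :=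
  MulAction.orbitRel.Quotient (autFix L A) C

/-- The orbit of a point over `A`. -/
def toOrbit (L : FirstOrder.Language.{0, 0}) {C : Type w} [L.Structure C] (A : Set C) (c : C) :
    Orbits L A := Quotient.mk _ c

omit [L.IsRelational] in
theorem toOrbit_eq_iff {A : Set C} {c c' : C} :
    toOrbit L A c = toOrbit L A c' ↔ ∃ σ ∈ autFix L A, σ c' = c := by
  refine Quotient.eq.trans ?_
  rw [MulAction.orbitRel_apply]
  constructor
  · rintro ⟨σ, hσ⟩
    exact ⟨σ, σ.2, hσ⟩
  · rintro ⟨σ, hσ, h⟩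
    exact ⟨⟨σ, hσ⟩, h⟩

/-- A bound for the number of sequences of codes over a set of size at most `lam`. -/
def dataBound (lam : Cardinal.{w}) : Cardinal.{w} :=
  Cardinal.prod fun k : ℕ => codeBound lam k * codeBound lam k

omit [L.IsRelational] [L.Structure C] in
theorem mk_data_le [Finite (Σ n, L.Relations n)] {lam : Cardinal.{w}} (hlam : ℵ₀ ≤ lam) {D : Set C}
    (hD : #D ≤ lam) : #(∀ k : ℕ, Code L D k 1 × Code L D k 1) ≤ dataBound lam := by
  rw [mk_pi]
  refine prod_le_prod _ _ fun k => ?_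
  rw [mk_prod, lift_id]
  exact mul_le_mul' (mk_code_le hlam hD k 1) (mk_code_le hlam hD k 1)

omit [L.IsRelational] in
theorem mk_image_le_of_eq {X Y : Type w} (S : Set C) (f : C → X) (g : C → Y)
    (h : ∀ a ∈ S, ∀ a' ∈ S, g a = g a' → f a = f a') : #(f '' S) ≤ #Y := by
  refine mk_le_of_injective (f := fun q : f '' S => g q.2.choose) fun q q' hq => ?_
  have h1 := q.2.choose_spec
  have h2 := q'.2.choose_spec
  exact Subtype.ext (h1.2.symm.trans ((h _ h1.1 _ h2.1 hq).trans h2.2))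

theorem IsBased.image (h𝓚 : 𝓚.IsFullAmalgamationClass) {M Z F : Set C} {a : C}
    (h : IsBased 𝓚 M Z F a) {σ : Equiv.Perm C} (hσ : σ ∈ autFix L M) (hZ : ∀ z, σ z ∈ Z ↔ z ∈ Z) :
    IsBased 𝓚 M Z (σ '' F) (σ a) := by
  obtain ⟨B, hFB, hB⟩ := h.exists_pair
  refine ⟨(apply_mem_cl_iff_of_subset h𝓚 hσ subset_rfl).2 h.mem_cl, fun h' => h.notMem ((hZ a).1 h'),
    ?_, σ '' B, h𝓚.isMinimalPair_image (partialIso_of_mem_autFix hσ B) hFB, ?_⟩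
  · rintro _ ⟨f, hf, rfl⟩
    exact ⟨apply_mem_reach hσ hZ (h.subset hf).1, (hZ f).2 (h.subset hf).2⟩
  · rw [← Set.image_sdiff σ.injective]
    rintro _ ⟨f, hf, rfl⟩
    exact ⟨apply_mem_reach hσ hZ (hB hf).1, fun h' => (hB hf).2 ((hZ f).1 h')⟩

variable (h𝓚 : 𝓚.IsFullAmalgamationClass) [Finite (Σ n, L.Relations n)]
include h𝓚

omit h𝓚 in
-- All cores based on F share the parameter set D, so their codes take values in the same small
-- sets. Equal codes of all ranks give equal types over M, hence conjugacy.
theorem mk_orbits_based_le {T : L.Theory} {κ lam : Cardinal.{w}}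
    (hC : IsUniversalDomain T κ C) (hlam : ℵ₀ ≤ lam) {M Z F : Set C} (hM : #M < κ) (hMne : M.Nonempty)
    (hMZ : M ⊆ Z) (hF : #{c | ∃ a, IsBased 𝓚 M Z F a ∧ c ∈ reach L Z a ∩ Z} ≤ lam) :
    #(toOrbit L M '' {a | IsBased 𝓚 M Z F a}) ≤ dataBound lam := by
  set D := {c | ∃ a, IsBased 𝓚 M Z F a ∧ c ∈ reach L Z a ∩ Z}
  obtain ⟨p, hp⟩ := hMne
  refine (mk_image_le_of_eq (Y := ∀ k : ℕ, Code L D k 1 × Code L D k 1) _ _ (fun a k =>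
    (code L D (core L Z a) k 1 fun _ => a, code L D (core L Z a) k 1 fun _ => p)) ?_).trans
    (mk_data_le hlam hF)
  intro a ha a' ha' h
  have hedge : ∀ a, IsBased 𝓚 M Z F a → ∀ e, IsEdge L e → (e ∩ core L Z a).Nonempty →
      e ⊆ core L Z a ∪ D := by
    rintro a ha e he ⟨x, hxe, hx⟩ y hy
    have := subset_reach_of_isEdge he hx hxe hy
    by_cases hyZ : y ∈ Z
    · exact Or.inr ⟨a, ha, this, hyZ⟩
    · exact Or.inl ⟨this, hyZ⟩
  have hout : ∀ x ∈ Z, x ∉ core L Z a ∪ core L Z a' := fun x hx h => h.elim (fun h => h.2 hx) fun h => h.2 hx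
  have htp := tpEq_of_code (v := (Subtype.val : M → C)) (fun i => hout _ (hMZ i.2))
    (core_eq_or_disjoint a a') (Set.disjoint_left.2 fun x hx => hout x (by
      obtain ⟨_, _, h⟩ := hx
      exact h.2)) (hedge a ha) (hedge a' ha') (mem_core_self ha.notMem) (mem_core_self ha'.notMem)
      (hout p (hMZ hp)) (fun k => congrArg Prod.fst (congrFun h k))
      (fun k => congrArg Prod.snd (congrFun h k))
  obtain ⟨σ, hσ, hσa⟩ := hC.exists_mem_autFix hM htp
  exact (toOrbit_eq_iff.2 ⟨σ, hσ, hσa 0⟩).symm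

theorem mk_orbits_le {G : Type w} [L.Structure G] [Nonempty G] (hG : 𝓚.IsGeneric G)
    {κ μ lam : Cardinal.{w}} (hC : IsUniversalDomain (L.completeTheory G) κ C)
    {M : ℕ → L.ElementarySubstructure C} (hM : IsConjChain 𝓚 κ M) (hMμ : ∀ k, #(M k) = μ)
    (hμ : ℵ₀ ≤ μ) (hμκ : μ < κ) (hlam : ℵ₀ ≤ lam) (hlamμ : lam ≤ μ) (hdata : dataBound lam ≤ μ)
    (hsup : ∀ (N : Type w) [L.Structure N] [N ⊨ L.completeTheory G], #N = μ →
      ∃ (C : Type w) (_ : L.Structure C) (j : N ↪ₑ[L] C), IsUniversalDomainOver (L.completeTheory G) j ∧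
        ∃ 𝒮 : Set (Set C), 𝓚.IsSupportSystem (Set.range j) 𝒮 ∧ (∀ S ∈ 𝒮, #S < lam) ∧
          𝓚.IsEdgeClosed (Set.range j) 𝒮) :
    #(Orbits L (M 0 : Set C)) ≤ μ := by
  set M₀ : Set C := (M 0 : Set C)
  set Z := goodAdd M
  set Mb : Set C := ⋃ k, (M k : Set C)
  have hne : Nonempty (M 0) := by
    rw [← mk_ne_zero_iff, hMμ]
    exact (aleph0_pos.trans_le hμ).ne'
  have hM₀ne : M₀.Nonempty := ⟨hne.some, hne.some.2⟩
  have : Nonempty C := ⟨hne.some⟩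
  have hage := hasAge_of_model h𝓚 hG hC.model
  have hM₀μ : #M₀ = μ := hMμ 0
  have hMZ : M₀ ⊆ Z := fun x hx => mem_goodAdd_of_mem hx hM.mono
  have hσZ : ∀ σ ∈ autFix L M₀, ∀ z, σ z ∈ Z ↔ z ∈ Z := fun σ hσ z => apply_mem_goodAdd_iff hσ
  have hMb : #Mb ≤ μ := by
    have h1 := mk_iUnion_le_lift fun k => (M k : Set C)
    rw [mk_nat, lift_aleph0, lift_uzero] at h1
    refine h1.trans (mul_le_of_le hμ hμ (ciSup_le' fun k => ?_))
    exact ((lift_uzero _).trans (hMμ k)).le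
  have hMbinf : Infinite Mb := by
    rw [infinite_iff]
    exact hμ.trans (hM₀μ.symm.le.trans (mk_le_mk_of_subset (Set.subset_iUnion (fun k => (M k : Set C)) 0)))
  have hsub : ∀ k, (M k : Set C) ⊆ Mb := fun k => Set.subset_iUnion (fun k => (M k : Set C)) k
  have hZ : ∀ v ∉ Z, ∀ A₀ ⊆ Z, A₀.Finite → (MulAction.orbit (autFix L A₀) v).Infinite := by
    intro v hv A₀ hA₀ hfin
    refine infinite_orbit_anti (A' := M₀ ∪ A₀) Set.subset_union_right fun h => hv ?_
    exact mem_goodAdd_of_finite_orbit hM hC hfin hA₀ h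
  have hcl : ∀ v ∈ 𝓚.cl M₀, v ∉ Z → ∀ y, IsEdge L y → v ∈ y → y ⊆ 𝓚.cl M₀ := by
    intro v hv hvZ y hy hvy
    by_contra h
    exact hvZ (hM.mem_goodAdd_of_edge h𝓚 hG hC hv hy hvy h)
  have hCμ : μ ≤ #C := hM₀μ ▸ mk_set_le M₀
  -- Only bases inside the union of the chain occur here: every finite subset of Z has a conjugate
  -- there over M 0, and the union has at most μ finite subsets.
  let R : Set C := ⋃ F : Finset Mb, {a | IsBased 𝓚 M₀ Z (Subtype.val '' (F : Set Mb)) a}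
  have hR : #(toOrbit L M₀ '' R) ≤ μ := by
    rw [Set.image_iUnion]
    refine (mk_iUnion_le _).trans (mul_le_of_le hμ ?_ (ciSup_le' fun F => ?_))
    · exact (mk_finset_of_infinite Mb).le.trans hMb
    · refine (mk_orbits_based_le hC hlam (hM₀μ.trans_lt hμκ) hM₀ne hMZ ?_).trans hdata
      exact (mk_boundary_lt h𝓚 hG hC hμ hM₀μ.le hμκ hCμ (one_le_aleph0.trans hlam) hlamμ hMZ hZ hcl
        hsup ((F.finite_toSet).image _)).le
  have hcover : (Set.univ : Set (Orbits L M₀)) ⊆ toOrbit L M₀ '' Mb ∪ toOrbit L M₀ '' R := by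
    rintro q -
    obtain ⟨c, rfl⟩ : ∃ c, toOrbit L M₀ c = q := Quotient.exists_rep q
    by_cases hc : c ∈ 𝓚.cl M₀
    · by_cases hcZ : c ∈ Z
      · obtain ⟨σ, hσ, k, hk⟩ := good_of_subset (M := M) (Set.finite_singleton c)
          (Set.singleton_subset_iff.2 hcZ)
        exact Or.inl ⟨σ c, hsub k (hk ⟨c, rfl, rfl⟩), toOrbit_eq_iff.2 ⟨σ, hσ, rfl⟩⟩
      · obtain ⟨F, B, hF, hFB, hB⟩ := exists_isMinimalPair_core h𝓚 hage hMZ hc hcZ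
        have hfin : F.Finite := hFB.1.subset hFB.2.2.1
        obtain ⟨σ, hσ, k, hk⟩ := good_of_subset (M := M) hfin fun f hf => (hF hf).2
        have hb := (IsBased.mk hc hcZ hF ⟨B, hFB, hB⟩).image h𝓚 hσ (hσZ σ hσ)
        refine Or.inr ⟨σ c, Set.mem_iUnion.2 ⟨((hfin.image σ).preimage
          (Subtype.val_injective (p := (· ∈ Mb))).injOn).toFinset, ?_⟩, toOrbit_eq_iff.2 ⟨σ, hσ, rfl⟩⟩
        rw [Set.mem_ofPred_eq, Set.Finite.coe_toFinset, Subtype.image_preimage_coe,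
          Set.inter_eq_right.2 (hk.trans (hsub k))]
        exact hb
    · obtain ⟨σ, hσ, h⟩ := hM.conj 0 c hc
      exact Or.inl ⟨σ c, hsub 1 h, toOrbit_eq_iff.2 ⟨σ, hσ, rfl⟩⟩
  rw [← mk_univ]
  refine (mk_le_mk_of_subset hcover).trans ((mk_union_le _ _).trans (add_le_of_le hμ ?_ hR))
  exact mk_image_le.trans hMb

end Counting

/-! ### Complete types in terms of formulas with parameters. -/

section CompleteTypes

variable {L : FirstOrder.Language.{0, 0}} {γ : Type w}

/-- A formula with parameters from `γ`, as a sentence about the generic realization of a type. -/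
def toSentence (θ : L.Formula (γ ⊕ Fin 1)) : L[[γ]][[Fin 1]].Sentence :=
  Formula.equivSentence (BoundedFormula.constantsVarsEquiv.symm θ : L[[γ]].Formula (Fin 1))

theorem realize_constantsVarsEquiv_symm {K : Type w} [L.Structure K] [(constantsOn γ).Structure K]
    (θ : L.Formula (γ ⊕ Fin 1)) (v : Fin 1 → K) :
    Formula.Realize (L := L[[γ]]) (BoundedFormula.constantsVarsEquiv.symm θ) v ↔
      θ.Realize (Sum.elim (fun i => ((L.con i : L[[γ]].Constants) : K)) v) := by
  rw [Formula.Realize, ← BoundedFormula.realize_constantsVarsEquiv, _root_.Equiv.apply_symm_apply]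
  rfl

theorem exists_toSentence_eq (φ : L[[γ]][[Fin 1]].Sentence) :
    ∃ θ : L.Formula (γ ⊕ Fin 1), toSentence θ = φ := by
  refine ⟨BoundedFormula.constantsVarsEquiv (Formula.equivSentence.symm φ : L[[γ]].Formula (Fin 1)), ?_⟩
  rw [toSentence, _root_.Equiv.symm_apply_apply, _root_.Equiv.apply_symm_apply]

theorem completeType_ext {T : L[[γ]].Theory} {p q : T.CompleteType (Fin 1)}
    (h : ∀ θ : L.Formula (γ ⊕ Fin 1), toSentence θ ∈ p ↔ toSentence θ ∈ q) : p = q :=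
  SetLike.ext fun φ => by
    obtain ⟨θ, rfl⟩ := exists_toSentence_eq φ
    exact h θ

theorem toSentence_mem_typeOf {T : L[[γ]].Theory} {K : Type w} [L.Structure K]
    [(constantsOn γ).Structure K] [Nonempty K] [K ⊨ T] {v : Fin 1 → K} {θ : L.Formula (γ ⊕ Fin 1)} :
    toSentence θ ∈ T.typeOf v ↔
      θ.Realize (Sum.elim (fun i => ((L.con i : L[[γ]].Constants) : K)) v) :=
  Theory.CompleteType.formula_mem_typeOf.trans (realize_constantsVarsEquiv_symm θ v)

variable {N : Type w} [L.Structure N] [(constantsOn γ).Structure N]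

theorem exists_realization_of_type (p : (L[[γ]].completeTheory N).CompleteType (Fin 1)) :
    ∃ (K : Type w) (_ : L.Structure K) (a : γ → K) (d : Fin 1 → K),
      TpEq L (fun i => ((L.con i : L[[γ]].Constants) : N)) a ∧
        ∀ θ : L.Formula (γ ⊕ Fin 1), toSentence θ ∈ p ↔ θ.Realize (Sum.elim a d) := by
  obtain ⟨K, d, rfl⟩ := Theory.exists_modelType_is_realized_in _ p
  let : L.Structure K := (L.lhomWithConstants γ).reduct K
  have key : ∀ ψ : L.Formula γ, ψ.Realize (fun i => ((L.con i : L[[γ]].Constants) : N)) →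
      ψ.Realize (fun i => ((L.con i : L[[γ]].Constants) : K)) := fun ψ hψ => by
    have : (L.lhomWithConstants γ).IsExpansionOn K := LHom.isExpansionOn_reduct _ _
    refine (Formula.realize_equivSentence K ψ).1 ?_
    exact K.is_model.realize_of_mem _ (mem_completeTheory.2 ((Formula.realize_equivSentence N ψ).2 hψ))
  refine ⟨K, inferInstance, fun i => ((L.con i : L[[γ]].Constants) : K), d, fun ψ => ⟨key ψ, fun h => ?_⟩,
    fun θ => ?_⟩
  · by_contra h2
    exact Formula.realize_not.1 (key ψ.not (Formula.realize_not.2 h2)) h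
  · have : (L.lhomWithConstants γ).IsExpansionOn K := LHom.isExpansionOn_reduct _ _
    refine Theory.CompleteType.formula_mem_typeOf.trans ?_
    rw [Formula.Realize, ← BoundedFormula.realize_constantsVarsEquiv, _root_.Equiv.apply_symm_apply]
    rfl

theorem exists_type_of_tpEq {K : Type w} [L.Structure K] {a : γ → K}
    (h : TpEq L (fun i => ((L.con i : L[[γ]].Constants) : N)) a) (d : K) :
    ∃ p : (L[[γ]].completeTheory N).CompleteType (Fin 1),
      ∀ θ : L.Formula (γ ⊕ Fin 1), toSentence θ ∈ p ↔ θ.Realize (Sum.elim a fun _ => d) := by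
  let : (constantsOn γ).Structure K := constantsOn.structure a
  have : Nonempty K := ⟨d⟩
  have hmod : K ⊨ L[[γ]].completeTheory N := by
    refine ⟨fun φ hφ => ?_⟩
    rw [mem_completeTheory] at hφ
    refine (Formula.realize_equivSentence_symm K φ a).1 ?_
    rw [← h]
    exact (Formula.realize_equivSentence_symm_con N φ).2 hφ
  exact ⟨(L[[γ]].completeTheory N).typeOf fun _ => d, fun θ => toSentence_mem_typeOf⟩

theorem realizes_iff {M C : Type w} [L.Structure M] [L.Structure C] {j : M → C} {c : C}
    {p : TypesOver L M} : Realizes j c p ↔ ∀ θ : L.Formula (M ⊕ Fin 1), toSentence θ ∈ p →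
      θ.Realize (Sum.elim j fun _ => c) := by
  let : (constantsOn M).Structure C := constantsOn.structure j
  constructor
  · intro h θ hθ
    exact (realize_constantsVarsEquiv_symm (K := C) θ fun _ => c).1 (h _ hθ)
  · intro h φ hφ
    have h1 := h (BoundedFormula.constantsVarsEquiv φ) (by
      rwa [toSentence, _root_.Equiv.symm_apply_apply])
    have h2 := (realize_constantsVarsEquiv_symm (K := C) _ fun _ => c).2 h1
    rwa [_root_.Equiv.symm_apply_apply] at h2

end CompleteTypes

/-! ### Extrinsic types and the construction of the chain. -/

section Extrinsic

variable {L : FirstOrder.Language.{0, 0}} [L.IsRelational] {𝓚 : StrongClass.{w} L}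
  (h𝓚 : 𝓚.IsFullAmalgamationClass) [Finite (Σ n, L.Relations n)] {G : Type w} [L.Structure G]
  {κ : Cardinal.{w}} {C : Type w} [L.Structure C]
include h𝓚

/-- The orbits outside the closure of a small elementary submodel are no more than the extrinsic
types. -/
theorem mk_orbits_compl_cl_le [Nonempty G] (hG : 𝓚.IsGeneric G)
    (hC : IsUniversalDomain (L.completeTheory G) κ C) (S : L.ElementarySubstructure C) (hS : #S < κ) :
    #(toOrbit L (S : Set C) '' (𝓚.cl (S : Set C))ᶜ) ≤
      #{p : TypesOver L S // 𝓚.IsExtrinsic (L.completeTheory G) p} := by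
  have hage := hasAge_of_model h𝓚 hG hC.model
  choose f hf using fun e : C => exists_type_of_tpEq (N := S) (γ := S)
    (a := fun x : S => (x : C)) (tpEq_elementary S.subtype fun x => x) e
  -- A realization inside the closure in another domain would have the same type over S as `e`, and
  -- membership in the closure depends on this type only.
  have hext : ∀ e ∉ 𝓚.cl (S : Set C), 𝓚.IsExtrinsic (L.completeTheory G) (f e) := by
    rintro e he ⟨C', _, j', ⟨κ', -, hC'⟩, a, ha, hreal⟩
    have key : ∀ θ : L.Formula (S ⊕ Fin 1), θ.Realize (Sum.elim (fun x : S => (x : C)) fun _ => e) →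
        θ.Realize (Sum.elim j' fun _ => a) := fun θ hθ => realizes_iff.1 hreal θ ((hf e θ).2 hθ)
    have htp : TpEq L (Sum.elim j' fun _ : Fin 1 => a)
        (Sum.elim (fun x : S => (x : C)) fun _ : Fin 1 => e) := fun θ => ⟨fun h => by
      by_contra h2
      exact Formula.realize_not.1 (key θ.not (Formula.realize_not.2 h2)) h, key θ⟩
    have h1 := htp.mem_cl h𝓚 (hasAge_of_model h𝓚 hG hC'.model) hage (fun x : S => Sum.inl x)
      (i := Sum.inr 0) ha
    have h2 : (Set.range fun x : S => (x : C)) = (S : Set C) := Subtype.range_coe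
    exact he (h2 ▸ h1)
  have hinj : ∀ e e', f e = f e' → toOrbit L (S : Set C) e = toOrbit L (S : Set C) e' := by
    intro e e' h
    have htp : TpEq L (Sum.elim (fun x : S => (x : C)) fun _ : Fin 1 => e)
        (Sum.elim (fun x : S => (x : C)) fun _ : Fin 1 => e') := fun θ =>
      (hf e θ).symm.trans (h ▸ hf e' θ)
    obtain ⟨σ, hσ, h⟩ := hC.exists_mem_autFix (A := (S : Set C)) hS htp
    exact (toOrbit_eq_iff.2 ⟨σ, hσ, h 0⟩).symm
  refine mk_le_of_injective (f := fun q => ⟨f q.2.choose, hext _ q.2.choose_spec.1⟩) fun q q' h => ?_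
  have h1 := hinj _ _ (congrArg Subtype.val h)
  exact Subtype.ext (q.2.choose_spec.2.symm.trans (h1.trans q'.2.choose_spec.2))

/-- There are at most μ orbits outside the closure, so a submodel of size μ can contain a
representative of each of them. -/
theorem exists_isConjChain [Nonempty G] (hG : 𝓚.IsGeneric G)
    (hC : IsUniversalDomain (L.completeTheory G) κ C) {μ : Cardinal.{w}} (hμ : ℵ₀ ≤ μ) (hμκ : μ < κ)
    (hext : ∀ (M : Type w) [L.Structure M] [M ⊨ L.completeTheory G], #M = μ →
      #{p : TypesOver L M // 𝓚.IsExtrinsic (L.completeTheory G) p} ≤ μ)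
    (S : L.ElementarySubstructure C) (hS : #S = μ) :
    ∃ M : ℕ → L.ElementarySubstructure C, IsConjChain 𝓚 κ M ∧ (∀ k, #(M k) = μ) ∧ M 0 = S := by
  have := hC.model
  have hCμ : μ ≤ #C := hS ▸ mk_set_le (S : Set C)
  have hnext : ∀ S : {S : L.ElementarySubstructure C // #S = μ},
      ∃ S' : {S : L.ElementarySubstructure C // #S = μ}, (S.1 : Set C) ⊆ S'.1 ∧
        ∀ e ∉ 𝓚.cl (S.1 : Set C), ∃ σ ∈ autFix L (S.1 : Set C), σ e ∈ S'.1 := by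
    rintro ⟨S, hS⟩
    let E := toOrbit L (S : Set C) '' (𝓚.cl (S : Set C))ᶜ
    have hE : #E ≤ μ := (mk_orbits_compl_cl_le h𝓚 hG hC S (hS.trans_lt hμκ)).trans (hext S hS)
    let r : E → C := fun q => q.1.out
    obtain ⟨S', hS', hcard⟩ := exists_elementarySubstructure (L := L) ((S : Set C) ∪ Set.range r) hμ
      ((mk_union_le _ _).trans (add_le_of_le hμ hS.le (mk_range_le.trans hE))) hCμ
    refine ⟨⟨S', hcard⟩, Set.subset_union_left.trans hS', fun e he => ?_⟩
    let q : E := ⟨toOrbit L (S : Set C) e, e, he, rfl⟩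
    have h1 : toOrbit L (S : Set C) (r q) = toOrbit L (S : Set C) e := Quotient.out_eq q.1
    obtain ⟨σ, hσ, h⟩ := toOrbit_eq_iff.1 h1
    exact ⟨σ, hσ, h ▸ hS' (Or.inr ⟨q, rfl⟩)⟩
  choose next hnext1 hnext2 using hnext
  let M : ℕ → {S : L.ElementarySubstructure C // #S = μ} := fun k => Nat.rec ⟨S, hS⟩ (fun _ => next) k
  exact ⟨fun k => (M k).1, ⟨fun k => (M k).2.trans_lt hμκ, monotone_nat_of_le_succ fun k => hnext1 (M k),
    fun k => hnext2 (M k)⟩, fun k => (M k).2, rfl⟩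

end Extrinsic

/-! ### From orbits to stability. -/

section Stability

variable {L : FirstOrder.Language.{0, 0}} [L.IsRelational] {𝓚 : StrongClass.{w} L}
  (h𝓚 : 𝓚.IsFullAmalgamationClass) [Finite (Σ n, L.Relations n)] {G : Type w} [L.Structure G]
include h𝓚

/-- The empty set is strong in a one-point set, so a point can be realized freely over any finite
set; over a finite universe this would give a point outside the universe. -/
theorem infinite_of_model [Nonempty G] (hG : 𝓚.IsGeneric G) {N : Type w} [L.Structure N]
    (hN : N ⊨ L.completeTheory G) [Nonempty N] : Infinite N := by
  by_contra hfin
  rw [not_infinite_iff_finite] at hfin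
  have hage := hasAge_of_model h𝓚 hG hN
  have hinj : Function.Injective fun _ : Fin 1 => Classical.arbitrary N :=
    Function.injective_of_subsingleton _
  obtain ⟨x, -, -, h⟩ := exists_freeOver_of_model h𝓚 hG hN (q := ∅) hinj
    (by rw [Set.image_empty]; exact h𝓚.empty_le (hage _ (Set.finite_range _))) (π := N) id
    -- With 2, the bound 1 becomes available, the least one for which `cls` contains its base.
    (fun i => i.2.elim) (fun i => i.2.elim) 2
  have h1 := (h Set.univ (fun i => i.2.elim) 1).disjoint 0 (Set.notMem_empty _)
  have h2 : x 0 ∈ Set.range fun a : (Set.univ : Set N) => id (a : N) := ⟨⟨x 0, trivial⟩, rfl⟩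
  exact h1 (StrongClass.mem_cls_of_mem hage h2 le_rfl)

omit [L.IsRelational] h𝓚 [Finite (Σ n, L.Relations n)] in
theorem nonempty_of_model {N : Type w} [L.Structure N] (hN : N ⊨ L.completeTheory G) [Nonempty N] :
    Nonempty G := by
  obtain ⟨φ, hφ⟩ : FO L Empty fun (N : Type w) _ v => ∃ x : Fin 1 → N, True :=
    FO.ex (β := Fin 1) (P := fun (N : Type w) _ _ => True) (FO.const True)
  obtain ⟨x, -⟩ := (fo_of_model hN ⟨φ, hφ⟩).1 ⟨fun _ => Classical.arbitrary N, trivial⟩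
  exact ⟨x 0⟩

theorem isStableIn_of_mk_extrinsic_le (hG : 𝓚.IsGeneric G) {μ lam : Cardinal.{w}}
    (hμ : ℵ₀ ≤ μ) (hlam : ℵ₀ ≤ lam) (hlamμ : lam ≤ μ) (hdata : dataBound lam ≤ μ)
    (hext : ∀ (M : Type w) [L.Structure M] [M ⊨ L.completeTheory G], #M = μ →
      #{p : TypesOver L M // 𝓚.IsExtrinsic (L.completeTheory G) p} ≤ μ)
    (hsup : ∀ (N : Type w) [L.Structure N] [N ⊨ L.completeTheory G], #N = μ →
      ∃ (C : Type w) (_ : L.Structure C) (j : N ↪ₑ[L] C), IsUniversalDomainOver (L.completeTheory G) j ∧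
        ∃ 𝒮 : Set (Set C), 𝓚.IsSupportSystem (Set.range j) 𝒮 ∧ (∀ S ∈ 𝒮, #S < lam) ∧
          𝓚.IsEdgeClosed (Set.range j) 𝒮) :
    IsStableIn (L.completeTheory G) μ := by
  intro N _ hN A hA
  choose K hK a d had hpd using fun p : TypesOverSet L A => exists_realization_of_type p
  by_cases hne : Nonempty (TypesOverSet L A)
  swap
  · rw [not_nonempty_iff] at hne
    exact (mk_eq_zero _).le.trans zero_le
  obtain ⟨p₀⟩ := hne
  have hNne : Nonempty N := by
    obtain ⟨φ, hφ⟩ : FO L A fun (N : Type w) _ v => ∃ x : Fin 1 → N, True :=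
      FO.ex (β := Fin 1) (P := fun (N : Type w) _ _ => True) (FO.const True)
    obtain ⟨x, -⟩ := ((had p₀).fo ⟨φ, hφ⟩).2 ⟨d p₀, trivial⟩
    exact ⟨x 0⟩
  have : Nonempty G := nonempty_of_model hN
  have : Infinite N := infinite_of_model h𝓚 hG hN
  -- Universal domains are supplied only for models of size μ. N is enlarged to have at least μ
  -- elements, and a submodel of size μ around the copy of A is taken.
  obtain ⟨N₁, ⟨i₁⟩, hN₁⟩ := exists_elementaryEmbedding_card_eq_of_ge L N (max μ #N)
    ((lift_le.2 card_le_aleph0).trans (by simp [hμ])) (by simp)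
  obtain ⟨S₁, hS₁, hS₁μ⟩ := exists_elementarySubstructure (L := L) (Set.range fun x : A => i₁ x) hμ
    (mk_range_le.trans hA) (by rw [hN₁]; exact le_max_left _ _)
  have hN₁T : N₁ ⊨ L.completeTheory G := (i₁.theory_model_iff _).1 hN
  obtain ⟨C, _, j, ⟨κ, hκ, hC⟩, -⟩ := hsup S₁ hS₁μ
  let c : A → C := fun x => j ⟨i₁ x, hS₁ ⟨x, rfl⟩⟩
  have hc : TpEq L (fun x : A => (x : N)) c := by
    have h1 : TpEq L (fun x : A => (⟨i₁ x, hS₁ ⟨x, rfl⟩⟩ : S₁)) (fun x : A => i₁ x) :=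
      tpEq_elementary S₁.subtype _
    exact (tpEq_elementary i₁ _).trans (h1.symm.trans (tpEq_elementary j _))
  have hμκ : μ < κ := hS₁μ ▸ hκ
  have hCμ : μ ≤ #C := hS₁μ ▸ mk_le_of_injective j.injective
  obtain ⟨S, hcS, hS⟩ := exists_elementarySubstructure (L := L) (Set.range c) hμ
    (mk_range_le.trans hA) hCμ
  obtain ⟨M, hM, hMμ, hM0⟩ := exists_isConjChain h𝓚 hG hC hμ hμκ hext S hS
  have horb := mk_orbits_le h𝓚 hG hC hM hMμ hμ hμκ hlam hlamμ hdata hsup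
  rw [hM0] at horb
  -- Each type over A is realized in C over the copy of A. Realizations in one orbit over S, which
  -- contains this copy, belong to the same type.
  choose d' hd' using fun p : TypesOverSet L A =>
    hC.exists_tpEq_option (hA.trans_lt hμκ) ((had p).symm.trans hc) (d p 0)
  refine (mk_le_of_injective (f := fun p => toOrbit L (S : Set C) (d' p)) fun p q h => ?_).trans horb
  obtain ⟨σ, hσ, hσd⟩ := toOrbit_eq_iff.1 h
  have h1 : ∀ p, TpEq L (Sum.elim (a p) (d p)) (Sum.elim c fun _ => d' p) := by
    intro p
    have h2 := (hd' p).comp (Sum.elim some fun _ : Fin 1 => none)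
    convert h2 using 1 <;>
    · funext s
      rcases s with s | s
      · rfl
      · first | rfl | exact congrArg (d p) (Subsingleton.elim s 0)
  have h3 : TpEq L (Sum.elim c fun _ : Fin 1 => d' q) (Sum.elim c fun _ : Fin 1 => d' p) := by
    have h2 := tpEq_of_mem_autFix hσ (Sum.elim c fun _ : Fin 1 => d' q)
    convert h2 using 1
    funext s
    rcases s with s | s
    · exact (hσ.2 _ (hcS ⟨s, rfl⟩)).symm
    · exact hσd.symm
  exact completeType_ext fun θ => (hpd p θ).trans ((h1 p θ).trans ((h3 θ).symm.trans
    ((h1 q θ).symm.trans (hpd q θ).symm)))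

end Stability

end GenericStability

theorem mainTheorem8 (L : FirstOrder.Language.{0, 0}) [L.IsRelational]
    [Finite (Σ n, L.Relations n)]
    (𝓚 : GenericStability.StrongClass.{w} L) (h𝓚 : 𝓚.IsFullAmalgamationClass)
    (G : Type w) [L.Structure G] (hG : 𝓚.IsGeneric G)
    (hlim : 𝓚.HasLimitingSupports (L.completeTheory G)) :
    ((∀ (M : Type w) [L.Structure M] [M ⊨ L.completeTheory G], (2 : Cardinal.{w}) ^ ℵ₀ ≤ #M →
        #{p : GenericStability.TypesOver L M // 𝓚.IsExtrinsic (L.completeTheory G) p} ≤ #M) →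
      GenericStability.IsSuperstable.{w} (L.completeTheory G)) ∧
    ((∀ (M : Type w) [L.Structure M] [M ⊨ L.completeTheory G], (2 : Cardinal.{w}) ^ ℵ₀ ≤ #M →
        #{p : GenericStability.TypesOver L M // 𝓚.IsExtrinsic (L.completeTheory G) p}
          ≤ #M ^ ℵ₀) →
      GenericStability.IsStable.{w} (L.completeTheory G)) := by
  obtain ⟨lam, θ, hsup⟩ := hlim
  -- The bound on supports is made infinite so that the cardinal arithmetic for the codes applies.
  let lam' : Cardinal.{w} := max lam ℵ₀
  let μ₀ : Cardinal.{w} := max (max (2 ^ ℵ₀) θ) (max lam' (GenericStability.dataBound lam'))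
  have h2μ₀ : (2 : Cardinal.{w}) ^ ℵ₀ ≤ μ₀ := (le_max_left _ _).trans (le_max_left _ _)
  have hμ₀ : ℵ₀ ≤ μ₀ := (cantor _).le.trans h2μ₀
  have main : ∀ μ : Cardinal.{w}, μ₀ ≤ μ →
      (∀ (M : Type w) [L.Structure M] [M ⊨ L.completeTheory G], #M = μ →
        #{p : GenericStability.TypesOver L M // 𝓚.IsExtrinsic (L.completeTheory G) p} ≤ μ) →
      GenericStability.IsStableIn (L.completeTheory G) μ := by
    intro μ hμ hext
    refine GenericStability.isStableIn_of_mk_extrinsic_le h𝓚 hG (lam := lam') (hμ₀.trans hμ)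
      (le_max_right _ _) (((le_max_left _ _).trans (le_max_right _ _)).trans hμ)
      (((le_max_right _ _).trans (le_max_right _ _)).trans hμ) hext ?_
    intro N _ _ hN
    obtain ⟨C, i, j, hC, 𝒮, h1, h2, -, h3⟩ := hsup N
      (((le_max_right _ _).trans (le_max_left _ _)).trans (hμ.trans hN.ge))
    exact ⟨C, i, j, hC, 𝒮, h1, fun S hS => (h2 S hS).trans_le (le_max_left _ _), h3⟩
  -- In the second part μ = 2^{μ₀}, so that μ^{ℵ₀} = μ and the weaker hypothesis still gives at most
  -- μ extrinsic types.
  refine ⟨fun hext => ⟨μ₀, fun μ hμ => main μ hμ fun M _ _ hM => ?_⟩,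
    fun hext => ⟨2 ^ μ₀, hμ₀.trans (cantor _).le, main _ (cantor _).le fun M _ _ hM => ?_⟩⟩
  · exact hM ▸ hext M (h2μ₀.trans (hμ.trans hM.ge))
  · refine (hext M (h2μ₀.trans ((cantor _).le.trans hM.ge))).trans ?_
    rw [hM, ← power_mul, mul_eq_left hμ₀ hμ₀ aleph0_ne_zero]
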